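/- Let $\mathbb{D}$ be the open unit disc, $\mathbb{T}$ the unit circle and $H^2$ the Hardy space of $\mathbb{D}$. For a finite positive Borel measure $\mu$ on $\mathbb{D}$ let $$G_\mu(z)=\int_{\mathbb{D}}\log\left|\frac{1-\overline{w}z}{z-w}\right|\,d\mu(w),\qquad \mathcal{D}_\mu(f)=\frac1\pi\int_{\mathbb{D}}|f'(z)|^2\,G_\mu(z)\,dx\,dy ,$$ and let $\mathcal{D}_\mu=\{f\in H^2:\mathcal{D}_\mu(f)<\infty\}$, with the Hilbert space norm given by $\|f\|_{\mathcal{D}_\mu}^2=\|f\|_{H^2}^2+\mathcal{D}_\mu(f)$. An invariant subspace of $\mathcal{D}_\mu$ is a closed linear subspace $\mathcal{M}$ such that $zf\in\mathcal{M}$ for every $f\in\mathcal{M}$. An inner function $I$ divides $f\in H^2$ if $f\in I H^2$, and $\mathcal{I}_{\mathcal{M}}$ denotes the greatest common inner divisor of $\mathcal{M}$: an inner function that divides every $f\in\mathcal{M}$ and is divisible by every inner function that divides every $f\in\mathcal{M}$ (it is unique up to a unimodular constant factor). Theorem. Let $\mu$ be a finite positive Borel measure on $\mathbb{D}$, and let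 $\mathcal{M}\neq\{0\}$ be an invariant subspace of $\mathcal{D}_\mu$. Then $\mathcal{M}$ has a greatest common inner divisor $\mathcal{I}_{\mathcal{M}}$, and $$\mathcal{M}=\mathcal{I}_{\mathcal{M}}H^2\cap\mathcal{D}_\mu .$$ -/

import Mathlib

namespace DirichletDisc

open MeasureTheory Filter Topology

/-- The open unit disc of the complex plane, as a type. -/
abbrev Disc : Type := ↥(Metric.ball (0 : ℂ) 1)

open Classical in
/-- The extension by zero to the plane of a function on the disc. -/
noncomputable def zeroExt (f : Disc → ℂ) : ℂ → ℂ := fun z =>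
  if h : z ∈ Metric.ball (0 : ℂ) 1 then f ⟨z, h⟩ else 0

/-- `f` is holomorphic on the unit disc. -/
def IsHolo (f : Disc → ℂ) : Prop :=
  DifferentiableOn ℂ (zeroExt f) (Metric.ball (0 : ℂ) 1)

/-- `‖f‖²` in the Hardy space `H²`: the supremum over `0 ≤ r < 1` of the mean of `|f|²` over the
circle of radius `r`. -/
noncomputable def hardyNormSq (f : Disc → ℂ) : ENNReal :=
  ⨆ r ∈ Set.Ico (0 : ℝ) 1,
    ENNReal.ofReal (2 * Real.pi)⁻¹ *
      ∫⁻ θ in Set.Ioc (0 : ℝ) (2 * Real.pi),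
        ‖zeroExt f ((r : ℂ) * Complex.exp ((θ : ℂ) * Complex.I))‖ₑ ^ 2

/-- The Hardy space `H²` of the unit disc. -/
def hardySpace : Set (Disc → ℂ) :=
  {f | IsHolo f ∧ hardyNormSq f < ⊤}

open Classical in
/-- The Green function `log |(1 - conj w * z) / (z - w)|` of the disc, equal to `∞` at `z = w`. -/
noncomputable def greenKernel (w : Disc) (z : ℂ) : ENNReal :=
  if z = (w : ℂ) then ⊤
  else ENNReal.ofReal (Real.log ‖(1 - (starRingEnd ℂ) (w : ℂ) * z) / (z - (w : ℂ))‖)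

/-- The Green potential `G_μ` of a positive Borel measure `μ` on the disc. -/
noncomputable def greenPotential (μ : Measure Disc) (z : ℂ) : ENNReal :=
  ∫⁻ w, greenKernel w z ∂μ

/-- The Dirichlet integral of `f` with weight `G_μ`, with respect to the normalized area measure
`dx dy / π` on the disc. -/
noncomputable def dirichletIntegral (μ : Measure Disc) (f : Disc → ℂ) : ENNReal :=
  ENNReal.ofReal Real.pi⁻¹ *
    ∫⁻ z in Metric.ball (0 : ℂ) 1, ‖deriv (zeroExt f) z‖ₑ ^ 2 * greenPotential μ z

/-- The weighted Dirichlet space `D_μ`. -/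
def dirichletSpace (μ : Measure Disc) : Set (Disc → ℂ) :=
  {f | f ∈ hardySpace ∧ dirichletIntegral μ f < ⊤}

/-- The square of the Hilbert space norm of `D_μ`. -/
noncomputable def dirichletNormSq (μ : Measure Disc) (f : Disc → ℂ) : ENNReal :=
  hardyNormSq f + dirichletIntegral μ f

/-- `M` is a closed linear subspace of `D_μ` that is invariant under multiplication by `z`. -/
structure IsInvariantSubspace (μ : Measure Disc) (M : Submodule ℂ (Disc → ℂ)) : Prop where
  subset : ∀ f ∈ M, f ∈ dirichletSpace μ
  closed : ∀ (g : ℕ → Disc → ℂ) (f : Disc → ℂ), (∀ n, g n ∈ M) → f ∈ dirichletSpace μ →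
    Tendsto (fun n => dirichletNormSq μ (g n - f)) atTop (𝓝 0) → f ∈ M
  shift : ∀ f ∈ M, (fun z : Disc => (z : ℂ) * f z) ∈ M

/-- `I` is an inner function: a holomorphic function on the disc, bounded by `1`, with unimodular
radial limits at almost every point of the unit circle. -/
structure IsInner (I : Disc → ℂ) : Prop where
  holo : IsHolo I
  bound : ∀ z, ‖I z‖ ≤ 1
  radial : ∀ᵐ θ : ℝ, ∃ ζ : ℂ, ‖ζ‖ = 1 ∧
    Tendsto (fun r : ℝ => zeroExt I ((r : ℂ) * Complex.exp ((θ : ℂ) * Complex.I)))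
      (𝓝[<] 1) (𝓝 ζ)

/-- The set `I H²` of the multiples of `I` in `H²`. For an inner function `I`, the functions of
`H²` that `I` divides are exactly the elements of `I H²`. -/
def innerMultiples (I : Disc → ℂ) : Set (Disc → ℂ) :=
  {f | ∃ h ∈ hardySpace, f = I * h}

/-- `I` is a greatest common inner divisor of `M`: an inner function that divides every element of
`M` and that is divisible by every inner function which divides every element of `M`. -/
structure IsGreatestCommonInnerDivisor (M : Submodule ℂ (Disc → ℂ)) (I : Disc → ℂ) : Prop where
  inner : IsInner I
  dvd : ∀ f ∈ M, f ∈ innerMultiples I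
  greatest : ∀ J : Disc → ℂ, IsInner J → (∀ f ∈ M, f ∈ innerMultiples J) → I ∈ innerMultiples J

end DirichletDisc

/-!
By the Littlewood–Paley formula and conformal invariance, `𝒟_μ(f)` is half the integral over `w`,
with respect to `μ`, of the variance of `f` for the harmonic measure at `w`. This form of the
Dirichlet integral only involves `H²` norms, and it gives good control of products.

By Mazur's theorem `M` contains every pointwise limit of a norm bounded sequence in `M`. Applied to
polynomials, and then to dilations `φ(rz)`, this shows that `M` contains `φ f` whenever `f ∈ M`, `φ`
is bounded and `φ f ∈ 𝒟_μ`. The crux is that `M` is closed in `𝒟_μ` even for the weaker topology of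
`H²`. Let `fₙ ∈ M` converge in `H²` to `f ∈ 𝒟_μ`, and let `u` be the Herglotz transform of `|f|²` on
the circle, so that `Re u` is the least harmonic majorant of `|f|²`. The functions
`fₙ / (1 + ε uₙ)` are bounded by `ε^(-1/2)` and lie in `M`; for `n → ∞` they tend to
`f / (1 + ε u)`, whose norm is controlled by that of `f` uniformly in `ε`, and for `ε → 0` these
tend to `f`.

The closure of `M` in `H²` is shift-invariant, hence equal to `p H²` with `p` inner by Beurling's
theorem, and therefore `M = p H² ∩ 𝒟_μ`. As multiplication by an inner function `J` is isometric,
`J H²` is closed, so it contains `p` as soon as it contains `M`: `p` is a greatest common inner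
divisor. Any other one is a multiple of `p` in the closure of `M`, and generates it as well.
-/

namespace DirichletDisc

open MeasureTheory Filter Topology
open scoped ComplexConjugate

/-! ### Holomorphic functions on the disc -/

lemma Disc.norm_lt_one (z : Disc) : ‖(z : ℂ)‖ < 1 :=
  mem_ball_zero_iff.1 z.2

lemma Disc.one_sub_norm_sq_pos (z : Disc) : 0 < 1 - ‖(z : ℂ)‖ ^ 2 := by
  nlinarith [norm_nonneg (z : ℂ), z.norm_lt_one]

lemma zeroExt_of_mem (f : Disc → ℂ) {z : ℂ} (h : z ∈ Metric.ball (0 : ℂ) 1) :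
    zeroExt f z = f ⟨z, h⟩ :=
  dif_pos h

@[simp] lemma zeroExt_coe (f : Disc → ℂ) (z : Disc) : zeroExt f z = f z :=
  zeroExt_of_mem f z.2

section IsHolo

variable {f g : Disc → ℂ}

lemma isHolo_of_differentiableOn {F : ℂ → ℂ} (hF : DifferentiableOn ℂ F (Metric.ball 0 1))
    (h : ∀ z : Disc, f z = F z) : IsHolo f :=
  hF.congr fun z hz => by rw [zeroExt_of_mem f hz, h]

lemma IsHolo.continuous (hf : IsHolo f) : Continuous f :=
  (continuousOn_iff_continuous_domRestrict.1 (DifferentiableOn.continuousOn hf)).congr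
    (zeroExt_coe f)

lemma IsHolo.add (hf : IsHolo f) (hg : IsHolo g) : IsHolo (f + g) :=
  isHolo_of_differentiableOn (DifferentiableOn.add hf hg) fun z => by simp

lemma IsHolo.sub (hf : IsHolo f) (hg : IsHolo g) : IsHolo (f - g) :=
  isHolo_of_differentiableOn (DifferentiableOn.sub hf hg) fun z => by simp

lemma IsHolo.mul (hf : IsHolo f) (hg : IsHolo g) : IsHolo (f * g) :=
  isHolo_of_differentiableOn (DifferentiableOn.mul hf hg) fun z => by simp

lemma IsHolo.smul (c : ℂ) (hf : IsHolo f) : IsHolo (c • f) :=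
  isHolo_of_differentiableOn (DifferentiableOn.const_smul hf c) fun z => by simp

lemma isHolo_const (c : ℂ) : IsHolo fun _ => c :=
  isHolo_of_differentiableOn (differentiableOn_const c) fun _ => rfl

lemma isHolo_coe : IsHolo fun z => (z : ℂ) :=
  isHolo_of_differentiableOn differentiableOn_id fun _ => rfl

lemma IsHolo.inv (hf : IsHolo f) (h0 : ∀ z, f z ≠ 0) : IsHolo fun z => (f z)⁻¹ :=
  isHolo_of_differentiableOn
    (DifferentiableOn.inv hf fun z hz => by rw [zeroExt_of_mem f hz]; exact h0 _)
    fun z => by simp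

end IsHolo

/-- The power series with coefficients `c` converges to `f` on the disc. -/
def HasPowerSeries (f : Disc → ℂ) (c : ℕ → ℂ) : Prop :=
  ∀ z : Disc, HasSum (fun n => c n * (z : ℂ) ^ n) (f z)

lemma IsHolo.hasPowerSeries {f : Disc → ℂ} (hf : IsHolo f) :
    HasPowerSeries f fun n => (n.factorial : ℂ)⁻¹ * iteratedDeriv n (zeroExt f) 0 := fun z => by
  simpa [mul_comm, mul_left_comm, mul_assoc] using
    Complex.hasSum_taylorSeries_on_ball (f := zeroExt f) hf z.2

namespace HasPowerSeries

variable {f g : Disc → ℂ} {c d : ℕ → ℂ}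

lemma summable_norm_mul_pow (h : HasPowerSeries f c) {r : ℝ} (h0 : 0 ≤ r) (h1 : r < 1) :
    Summable fun n => ‖c n‖ * r ^ n := by
  simpa [abs_of_nonneg h0] using
    (h ⟨(r : ℂ), by simpa [abs_of_nonneg h0] using h1⟩).summable.norm

lemma isHolo (h : HasPowerSeries f c) : IsHolo f := by
  refine isHolo_of_differentiableOn (F := fun z => ∑' n, c n * z ^ n) (fun z hz => ?_)
    fun z => (h z).tsum_eq.symm
  obtain ⟨r, hzr, hr1⟩ := exists_between (mem_ball_zero_iff.1 hz)
  have hr0 : 0 ≤ r := (norm_nonneg z).trans hzr.le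
  have hd : DifferentiableOn ℂ (fun z => ∑' n, c n * z ^ n) (Metric.ball 0 r) := by
    refine Complex.differentiableOn_tsum_of_summable_norm (h.summable_norm_mul_pow hr0 hr1)
      (fun n => by fun_prop) Metric.isOpen_ball fun n w hw => ?_
    rw [norm_mul, norm_pow]
    gcongr
    exact (mem_ball_zero_iff.1 hw).le
  exact (hd.differentiableAt
    (Metric.isOpen_ball.mem_nhds (mem_ball_zero_iff.2 hzr))).differentiableWithinAt

lemma add (hf : HasPowerSeries f c) (hg : HasPowerSeries g d) :
    HasPowerSeries (f + g) (c + d) := fun z => by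
  simpa [add_mul] using (hf z).add (hg z)

lemma sub (hf : HasPowerSeries f c) (hg : HasPowerSeries g d) :
    HasPowerSeries (f - g) (c - d) := fun z => by
  simpa [sub_mul] using (hf z).sub (hg z)

lemma apply_zero (h : HasPowerSeries f c) : f 0 = c 0 := by
  refine (h 0).unique ?_
  simpa using hasSum_single (f := fun n => c n * ((0 : Disc) : ℂ) ^ n) 0 fun n hn => by simp [hn]

lemma sub_apply_zero (h : HasPowerSeries f c) :
    HasPowerSeries (fun z => f z - f 0) (Function.update c 0 0) := fun z => by
  rw [h.apply_zero]
  refine ((h z).sub (hasSum_ite_eq (0 : ℕ) (c 0))).congr_fun fun n => ?_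
  rcases eq_or_ne n 0 with rfl | hn
  · simp
  · simp [hn]

end HasPowerSeries

lemma circle_mem_ball {r : ℝ} (h0 : 0 ≤ r) (h1 : r < 1) (θ : ℝ) :
    (r : ℂ) * Complex.exp ((θ : ℂ) * Complex.I) ∈ Metric.ball (0 : ℂ) 1 := by
  simpa [Complex.norm_exp_ofReal_mul_I, abs_of_nonneg h0] using h1

/-- The point of the disc with polar coordinates `r` and `θ`. -/
noncomputable def polarPoint {r : ℝ} (h0 : 0 ≤ r) (h1 : r < 1) (θ : ℝ) : Disc :=
  ⟨(r : ℂ) * Complex.exp ((θ : ℂ) * Complex.I), circle_mem_ball h0 h1 θ⟩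

lemma continuous_polarPoint {r : ℝ} (h0 : 0 ≤ r) (h1 : r < 1) :
    Continuous (polarPoint h0 h1) := by
  unfold polarPoint
  fun_prop

lemma integrableOn_polarPoint {E : Type*} [NormedAddCommGroup E] {f : Disc → E}
    (hf : Continuous f) {r : ℝ} (h0 : 0 ≤ r) (h1 : r < 1) :
    IntegrableOn (fun θ => f (polarPoint h0 h1 θ)) (Set.Ioc (0 : ℝ) (2 * Real.pi)) :=
  (hf.comp (continuous_polarPoint h0 h1)).integrableOn_Ioc

lemma integral_exp_int_mul_I (k : ℤ) :
    ∫ θ in (0 : ℝ)..2 * Real.pi, Complex.exp (k * θ * Complex.I) =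
      if k = 0 then 2 * (Real.pi : ℂ) else 0 := by
  split_ifs with hk
  · simp [hk]
  · have hkI : (k : ℂ) * Complex.I ≠ 0 := by simp [hk]
    have hperiod : (k : ℂ) * Complex.I * ((2 * Real.pi : ℝ) : ℂ) =
        k * (2 * Real.pi * Complex.I) := by
      push_cast; ring
    simp only [mul_right_comm (k : ℂ) _ Complex.I]
    rw [integral_exp_mul_complex hkI, hperiod, Complex.exp_int_mul_two_pi_mul_I]
    simp

section TrigonometricSeries

variable {c : ℕ → ℂ} {F : ℝ → ℂ}

lemma integral_exp_mul_of_hasSum_exp (hc : Summable fun n => ‖c n‖)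
    (hF : ∀ θ : ℝ, HasSum (fun n : ℕ => c n * Complex.exp (n * θ * Complex.I)) (F θ)) (m : ℤ) :
    ∫ θ in (0 : ℝ)..2 * Real.pi, Complex.exp (-m * θ * Complex.I) * F θ =
      if 0 ≤ m then c m.toNat * (2 * Real.pi) else 0 := by
  let u : ℕ → C(ℝ, ℂ) := fun n =>
    ⟨fun θ => c n * Complex.exp (((n - m : ℤ) : ℂ) * θ * Complex.I), by fun_prop⟩
  have hu : ∀ θ : ℝ, ∑' n, u n θ = Complex.exp (-m * θ * Complex.I) * F θ := fun θ => by
    refine (((hF θ).mul_left (Complex.exp (-m * θ * Complex.I))).congr_fun fun n => ?_).tsum_eq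
    simp only [u, ContinuousMap.coe_mk, mul_left_comm _ (c n), ← Complex.exp_add]
    congr 2
    push_cast
    ring
  have hsum : HasSum (fun n => ∫ θ in (0 : ℝ)..2 * Real.pi, u n θ)
      (∫ θ in (0 : ℝ)..2 * Real.pi, Complex.exp (-m * θ * Complex.I) * F θ) := by
    simp only [← hu]
    refine intervalIntegral.hasSum_intervalIntegral_of_summable_norm
      (hc.of_nonneg_of_le (fun n => norm_nonneg _) fun n => ?_)
    refine (ContinuousMap.norm_le _ (norm_nonneg _)).2 fun θ => ?_
    rw [ContinuousMap.restrict_apply, ContinuousMap.coe_mk, norm_mul]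
    norm_cast
    rw [Complex.norm_exp_ofReal_mul_I, mul_one]
  have hcoeff : ∀ n : ℕ, ∫ θ in (0 : ℝ)..2 * Real.pi, u n θ =
      if (n : ℤ) = m then c n * (2 * Real.pi) else 0 := fun n => by
    simp only [u, ContinuousMap.coe_mk, intervalIntegral.integral_const_mul]
    simp only [integral_exp_int_mul_I, sub_eq_zero, mul_ite, mul_zero]
  simp only [hcoeff] at hsum
  refine hsum.unique ?_
  split_ifs with hm
  · lift m to ℕ using hm
    simpa using hasSum_single (f := fun n : ℕ => if n = m then c n * (2 * Real.pi : ℂ) else 0) m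
      fun n hn => if_neg hn
  · have hne : ∀ n : ℕ, (n : ℤ) ≠ m := fun n hn => hm (hn ▸ Int.natCast_nonneg n)
    simpa only [if_neg (hne _)] using hasSum_zero

lemma fourierCoeffOn_of_hasSum_exp (hc : Summable fun n => ‖c n‖)
    (hF : ∀ θ : ℝ, HasSum (fun n : ℕ => c n * Complex.exp (n * θ * Complex.I)) (F θ)) (m : ℤ) :
    fourierCoeffOn Real.two_pi_pos F m = if 0 ≤ m then c m.toNat else 0 := by
  rw [fourierCoeffOn_eq_integral]
  have hfourier : ∀ θ : ℝ, fourier (-m) (θ : AddCircle (2 * Real.pi - 0)) =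
      Complex.exp (-m * θ * Complex.I) := fun θ => by
    rw [fourier_coe_apply]
    congr 1
    push_cast
    field_simp
    ring
  simp only [hfourier, smul_eq_mul, integral_exp_mul_of_hasSum_exp hc hF]
  split_ifs
  · rw [Complex.real_smul]
    push_cast
    field_simp
    ring
  · simp

lemma hasSum_norm_sq_of_hasSum_exp (hc : Summable fun n => ‖c n‖)
    (hF : ∀ θ : ℝ, HasSum (fun n : ℕ => c n * Complex.exp (n * θ * Complex.I)) (F θ)) :
    HasSum (fun n => ‖c n‖ ^ 2)
      ((2 * Real.pi)⁻¹ * ∫ θ in Set.Ioc 0 (2 * Real.pi), ‖F θ‖ ^ 2) := by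
  have hcont : Continuous F := by
    have htsum : F = fun θ : ℝ => ∑' n : ℕ, c n * Complex.exp (n * θ * Complex.I) :=
      funext fun θ => (hF θ).tsum_eq.symm
    rw [htsum]
    refine continuous_tsum (fun n => by fun_prop) hc fun n θ => le_of_eq ?_
    rw [norm_mul]
    norm_cast
    rw [Complex.norm_exp_ofReal_mul_I, mul_one]
  have hL2 : MemLp F 2 (volume.restrict (Set.Ioc 0 (2 * Real.pi))) :=
    (memLp_two_iff_integrable_sq_norm hcont.aestronglyMeasurable).2
      (hcont.norm.pow 2).integrableOn_Ioc
  have hparseval := hasSum_sq_fourierCoeffOn Real.two_pi_pos hL2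
  simp only [fourierCoeffOn_of_hasSum_exp hc hF] at hparseval
  rw [← intervalIntegral.integral_of_le Real.two_pi_pos.le]
  rw [← (Nat.cast_injective : Function.Injective ((↑) : ℕ → ℤ)).hasSum_iff
    fun m hm => ?_] at hparseval
  · simpa [Function.comp_def] using hparseval
  · rw [if_neg fun h => hm ⟨m.toNat, Int.toNat_of_nonneg h⟩]
    simp

end TrigonometricSeries

lemma HasPowerSeries.hasSum_norm_sq {f : Disc → ℂ} {c : ℕ → ℂ} (h : HasPowerSeries f c) {r : ℝ}
    (h0 : 0 ≤ r) (h1 : r < 1) :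
    HasSum (fun n => ‖c n‖ ^ 2 * r ^ (2 * n))
      ((2 * Real.pi)⁻¹ *
        ∫ θ in Set.Ioc 0 (2 * Real.pi), ‖f (polarPoint h0 h1 θ)‖ ^ 2) := by
  have hterm : ∀ n, ‖c n * (r : ℂ) ^ n‖ = ‖c n‖ * r ^ n := fun n => by
    rw [norm_mul, norm_pow, Complex.norm_of_nonneg h0]
  have hmode : ∀ θ : ℝ, HasSum (fun n : ℕ => c n * (r : ℂ) ^ n * Complex.exp (n * θ * Complex.I))
      (f (polarPoint h0 h1 θ)) := fun θ =>
    (h (polarPoint h0 h1 θ)).congr_fun fun n => by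
      rw [polarPoint, mul_pow, ← Complex.exp_nat_mul, mul_assoc, mul_assoc]
  refine (hasSum_norm_sq_of_hasSum_exp
    (by simpa only [hterm] using h.summable_norm_mul_pow h0 h1) hmode).congr_fun fun n => ?_
  rw [hterm]
  ring

lemma enorm_sq_eq_ofReal {E : Type*} [SeminormedAddGroup E] (x : E) :
    ‖x‖ₑ ^ 2 = ENNReal.ofReal (‖x‖ ^ 2) := by
  rw [ENNReal.ofReal_pow (norm_nonneg x), ofReal_norm]

/-- The mean of `|f|²` over the circle of radius `r` centred at the origin. -/
noncomputable def meanSq (f : Disc → ℂ) (r : ℝ) : ENNReal :=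
  ENNReal.ofReal (2 * Real.pi)⁻¹ *
    ∫⁻ θ in Set.Ioc (0 : ℝ) (2 * Real.pi),
      ‖zeroExt f ((r : ℂ) * Complex.exp ((θ : ℂ) * Complex.I))‖ₑ ^ 2

section meanSq

variable {f g : Disc → ℂ} {r : ℝ}

lemma meanSq_eq_lintegral (f : Disc → ℂ) (h0 : 0 ≤ r) (h1 : r < 1) :
    meanSq f r = ENNReal.ofReal (2 * Real.pi)⁻¹ *
      ∫⁻ θ in Set.Ioc (0 : ℝ) (2 * Real.pi), ‖f (polarPoint h0 h1 θ)‖ₑ ^ 2 := by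
  simp only [meanSq, zeroExt_of_mem f (circle_mem_ball h0 h1 _), polarPoint]

lemma HasPowerSeries.meanSq_eq_tsum {c : ℕ → ℂ} (h : HasPowerSeries f c) (h0 : 0 ≤ r)
    (h1 : r < 1) : meanSq f r = ∑' n, ‖c n‖ₑ ^ 2 * ENNReal.ofReal (r ^ (2 * n)) := by
  have hparseval := h.hasSum_norm_sq h0 h1
  have hint : IntegrableOn (fun θ => ‖f (polarPoint h0 h1 θ)‖ ^ 2) (Set.Ioc 0 (2 * Real.pi)) :=
    integrableOn_polarPoint (h.isHolo.continuous.norm.pow 2) h0 h1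
  simp only [meanSq_eq_lintegral f h0 h1, enorm_sq_eq_ofReal]
  rw [← ofReal_integral_eq_lintegral_ofReal hint (ae_of_all _ fun _ => by positivity),
    ← ENNReal.ofReal_mul (by positivity), ← hparseval.tsum_eq,
    ENNReal.ofReal_tsum_of_nonneg (fun n => by positivity) hparseval.summable]
  simp only [ENNReal.ofReal_mul (sq_nonneg _)]

lemma meanSq_mono (h : ∀ z, ‖f z‖ ≤ ‖g z‖) (h0 : 0 ≤ r) (h1 : r < 1) :
    meanSq f r ≤ meanSq g r := by
  rw [meanSq_eq_lintegral f h0 h1, meanSq_eq_lintegral g h0 h1]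
  gcongr
  exact enorm_le_iff_norm_le.2 (h _)

lemma meanSq_smul (c : ℂ) (f : Disc → ℂ) (r : ℝ) : meanSq (c • f) r = ‖c‖ₑ ^ 2 * meanSq f r := by
  have hext : ∀ z, zeroExt (c • f) z = c * zeroExt f z := fun z => by
    by_cases hz : z ∈ Metric.ball (0 : ℂ) 1 <;> simp [zeroExt, hz]
  simp only [meanSq, hext, enorm_mul, mul_pow]
  rw [lintegral_const_mul' _ _ (by simp), mul_left_comm]

lemma meanSq_one (h0 : 0 ≤ r) (h1 : r < 1) : meanSq (fun _ => 1) r = 1 := by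
  rw [meanSq_eq_lintegral _ h0 h1]
  simp only [enorm_one, one_pow, lintegral_const, MeasurableSet.univ, Measure.restrict_apply,
    Set.univ_inter, Real.volume_Ioc, sub_zero, one_mul]
  rw [← ENNReal.ofReal_mul (by positivity), inv_mul_cancel₀ (by positivity), ENNReal.ofReal_one]

lemma meanSq_le_liminf {F : ℕ → Disc → ℂ} (hF : ∀ n, IsHolo (F n))
    (hlim : ∀ z, Tendsto (fun n => F n z) atTop (𝓝 (f z))) (h0 : 0 ≤ r) (h1 : r < 1) :
    meanSq f r ≤ liminf (fun n => meanSq (F n) r) atTop := by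
  simp only [meanSq_eq_lintegral _ h0 h1]
  have hmeas : ∀ n, Measurable fun θ => ‖F n (polarPoint h0 h1 θ)‖ₑ ^ 2 := fun n =>
    ((hF n).continuous.comp (continuous_polarPoint h0 h1)).measurable.enorm.pow_const 2
  have hliminf : ∀ θ, ‖f (polarPoint h0 h1 θ)‖ₑ ^ 2 =
      liminf (fun n => ‖F n (polarPoint h0 h1 θ)‖ₑ ^ 2) atTop := fun θ =>
    (((ENNReal.continuous_pow 2).comp continuous_enorm).tendsto _ |>.comp
      (hlim (polarPoint h0 h1 θ))).liminf_eq.symm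
  rw [ENNReal.liminf_const_mul_of_ne_top (by simp)]
  simp only [hliminf]
  gcongr
  exact lintegral_liminf_le hmeas

end meanSq

section hardyNormSq

variable {f g : Disc → ℂ}

lemma hardyNormSq_eq_iSup (f : Disc → ℂ) : hardyNormSq f = ⨆ r ∈ Set.Ico (0 : ℝ) 1, meanSq f r :=
  rfl

lemma meanSq_le_hardyNormSq (f : Disc → ℂ) {r : ℝ} (h0 : 0 ≤ r) (h1 : r < 1) :
    meanSq f r ≤ hardyNormSq f :=
  le_iSup₂ (f := fun r (_ : r ∈ Set.Ico (0 : ℝ) 1) => meanSq f r) r ⟨h0, h1⟩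

lemma hardyNormSq_le {C : ENNReal} (h : ∀ r, 0 ≤ r → r < 1 → meanSq f r ≤ C) :
    hardyNormSq f ≤ C :=
  iSup₂_le fun r hr => h r hr.1 hr.2

lemma HasPowerSeries.hardyNormSq_eq_tsum {c : ℕ → ℂ} (h : HasPowerSeries f c) :
    hardyNormSq f = ∑' n, ‖c n‖ₑ ^ 2 := by
  apply le_antisymm
  · refine hardyNormSq_le fun r h0 h1 => ?_
    rw [h.meanSq_eq_tsum h0 h1]
    refine ENNReal.tsum_le_tsum fun n => mul_le_of_le_one_right' ?_
    exact ENNReal.ofReal_le_one.2 (pow_le_one₀ h0 h1.le)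
  · rw [ENNReal.tsum_eq_iSup_sum]
    refine iSup_le fun s => ?_
    have hlim : Tendsto (fun r : ℝ => ∑ n ∈ s, ‖c n‖ₑ ^ 2 * ENNReal.ofReal (r ^ (2 * n)))
        (𝓝[<] 1) (𝓝 (∑ n ∈ s, ‖c n‖ₑ ^ 2)) := by
      refine tendsto_finsetSum _ fun n _ => ?_
      have hcont : Continuous fun r : ℝ => ‖c n‖ₑ ^ 2 * ENNReal.ofReal (r ^ (2 * n)) :=
        (ENNReal.continuous_const_mul (by simp)).comp
          (ENNReal.continuous_ofReal.comp (continuous_pow _))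
      simpa using (hcont.tendsto 1).mono_left nhdsWithin_le_nhds
    refine le_of_tendsto hlim ?_
    filter_upwards [Ioo_mem_nhdsLT zero_lt_one] with r hr
    calc ∑ n ∈ s, ‖c n‖ₑ ^ 2 * ENNReal.ofReal (r ^ (2 * n))
        ≤ meanSq f r := (ENNReal.sum_le_tsum s).trans_eq (h.meanSq_eq_tsum hr.1.le hr.2).symm
      _ ≤ hardyNormSq f := meanSq_le_hardyNormSq f hr.1.le hr.2

lemma HasPowerSeries.unique {c d : ℕ → ℂ} (hc : HasPowerSeries f c) (hd : HasPowerSeries f d) :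
    c = d := by
  have hzero : HasPowerSeries (f - f) 0 := fun z => by simp
  have hsum : ∑' n, ‖(c - d) n‖ₑ ^ 2 = 0 := by
    rw [← (hc.sub hd).hardyNormSq_eq_tsum, hzero.hardyNormSq_eq_tsum]
    simp
  funext n
  simpa [sub_eq_zero] using ENNReal.tsum_eq_zero.1 hsum n

lemma hardyNormSq_mono (h : ∀ z, ‖f z‖ ≤ ‖g z‖) : hardyNormSq f ≤ hardyNormSq g :=
  hardyNormSq_le fun _ h0 h1 => (meanSq_mono h h0 h1).trans (meanSq_le_hardyNormSq g h0 h1)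

lemma hardyNormSq_smul (c : ℂ) (f : Disc → ℂ) :
    hardyNormSq (c • f) = ‖c‖ₑ ^ 2 * hardyNormSq f := by
  simp only [hardyNormSq_eq_iSup, meanSq_smul, ENNReal.mul_iSup]

lemma hardyNormSq_one : hardyNormSq (fun _ => 1) = 1 :=
  le_antisymm (hardyNormSq_le fun _ h0 h1 => (meanSq_one h0 h1).le)
    ((meanSq_one le_rfl zero_lt_one).symm.trans_le (meanSq_le_hardyNormSq _ le_rfl zero_lt_one))

lemma hardyNormSq_le_of_norm_le {C : ℝ} (h : ∀ z, ‖f z‖ ≤ C) :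
    hardyNormSq f ≤ ENNReal.ofReal (C ^ 2) := by
  have hC : 0 ≤ C := (norm_nonneg _).trans (h 0)
  calc hardyNormSq f ≤ hardyNormSq ((C : ℂ) • fun _ => 1) :=
        hardyNormSq_mono fun z => by simpa [abs_of_nonneg hC] using h z
    _ = ENNReal.ofReal (C ^ 2) := by
        rw [hardyNormSq_smul, hardyNormSq_one, mul_one, enorm_sq_eq_ofReal,
          Complex.norm_of_nonneg hC]

lemma enorm_add_sq_add_enorm_sub_sq {E : Type*} [NormedAddCommGroup E] [InnerProductSpace ℝ E]
    (x y : E) : ‖x + y‖ₑ ^ 2 + ‖x - y‖ₑ ^ 2 = 2 * ‖x‖ₑ ^ 2 + 2 * ‖y‖ₑ ^ 2 := by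
  have hreal : ‖x + y‖ ^ 2 + ‖x - y‖ ^ 2 = 2 * ‖x‖ ^ 2 + 2 * ‖y‖ ^ 2 := by
    linear_combination parallelogram_law_with_norm ℝ x y
  simp only [enorm_sq_eq_ofReal]
  rw [← ENNReal.ofReal_add (by positivity) (by positivity), hreal,
    ENNReal.ofReal_add (by positivity) (by positivity), ENNReal.ofReal_mul zero_le_two,
    ENNReal.ofReal_mul zero_le_two, ENNReal.ofReal_ofNat]

lemma hardyNormSq_parallelogram (hf : IsHolo f) (hg : IsHolo g) :
    hardyNormSq (f + g) + hardyNormSq (f - g) = 2 * hardyNormSq f + 2 * hardyNormSq g := by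
  have hc := hf.hasPowerSeries
  have hd := hg.hasPowerSeries
  rw [(hc.add hd).hardyNormSq_eq_tsum, (hc.sub hd).hardyNormSq_eq_tsum, hc.hardyNormSq_eq_tsum,
    hd.hardyNormSq_eq_tsum, ← ENNReal.tsum_mul_left, ← ENNReal.tsum_mul_left, ← ENNReal.tsum_add,
    ← ENNReal.tsum_add]
  exact tsum_congr fun n => enorm_add_sq_add_enorm_sub_sq _ _

lemma hardyNormSq_add_le (hf : IsHolo f) (hg : IsHolo g) :
    hardyNormSq (f + g) ≤ 2 * hardyNormSq f + 2 * hardyNormSq g :=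
  le_self_add.trans_eq (hardyNormSq_parallelogram hf hg)

lemma hardyNormSq_le_liminf {F : ℕ → Disc → ℂ} (hF : ∀ n, IsHolo (F n))
    (hlim : ∀ z, Tendsto (fun n => F n z) atTop (𝓝 (f z))) :
    hardyNormSq f ≤ liminf (fun n => hardyNormSq (F n)) atTop :=
  hardyNormSq_le fun _ h0 h1 => (meanSq_le_liminf hF hlim h0 h1).trans <|
    liminf_le_liminf (Eventually.of_forall fun _ => meanSq_le_hardyNormSq _ h0 h1)

lemma HasPowerSeries.hardyNormSq_eq_add {c : ℕ → ℂ} (h : HasPowerSeries f c) :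
    hardyNormSq f = ‖f 0‖ₑ ^ 2 + hardyNormSq fun z => f z - f 0 := by
  rw [h.hardyNormSq_eq_tsum, h.sub_apply_zero.hardyNormSq_eq_tsum,
    tsum_eq_zero_add' ENNReal.summable, tsum_eq_zero_add' (f := fun n =>
      ‖Function.update c 0 0 n‖ₑ ^ 2) ENNReal.summable, h.apply_zero]
  simp

end hardyNormSq

/-! ### The Hardy space as a space of sequences -/

/-- The Hardy space, modelled on the square summable sequences of power series coefficients. -/
abbrev HardySeq : Type := lp (fun _ : ℕ => ℂ) 2

lemma HardySeq.hasSum_norm_sq (a : HardySeq) : HasSum (fun n => ‖a n‖ ^ 2) (‖a‖ ^ 2) := by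
  simpa using lp.hasSum_norm (by norm_num) a

lemma memℓp_two_iff {ι E : Type*} [NormedAddCommGroup E] {c : ι → E} :
    Memℓp c 2 ↔ Summable fun i => ‖c i‖ ^ 2 := by
  rw [memℓp_gen_iff (by norm_num)]
  simp

lemma hasSum_norm_pow_sq (z : Disc) :
    HasSum (fun n => ‖(z : ℂ) ^ n‖ ^ 2) (1 - ‖(z : ℂ)‖ ^ 2)⁻¹ := by
  simpa only [norm_pow, pow_right_comm _ 2] using
    hasSum_geometric_of_lt_one (sq_nonneg ‖(z : ℂ)‖) (sub_pos.1 z.one_sub_norm_sq_pos)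

/-- The reproducing (Szegő) kernel of the Hardy space at `z`, as a sequence of coefficients. -/
noncomputable def szegoKernel (z : Disc) : HardySeq :=
  ⟨fun n => conj (z : ℂ) ^ n, memℓp_two_iff.2 <| by simpa using (hasSum_norm_pow_sq z).summable⟩

lemma norm_szegoKernel_sq (z : Disc) : ‖szegoKernel z‖ ^ 2 = (1 - ‖(z : ℂ)‖ ^ 2)⁻¹ :=
  (szegoKernel z).hasSum_norm_sq.unique (by simpa [szegoKernel] using hasSum_norm_pow_sq z)

/-- The function on the disc with a given sequence of power series coefficients. -/
noncomputable def hardyFun : HardySeq →ₗ[ℂ] (Disc → ℂ) where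
  toFun a z := inner ℂ (szegoKernel z) a
  map_add' a b := by ext z; simp
  map_smul' c a := by ext z; simp

section hardyFun

variable {a : HardySeq}

lemma hardyFun_apply (a : HardySeq) (z : Disc) : hardyFun a z = inner ℂ (szegoKernel z) a := rfl

lemma hasPowerSeries_hardyFun (a : HardySeq) : HasPowerSeries (hardyFun a) a := fun z => by
  simpa [szegoKernel, hardyFun_apply] using lp.hasSum_inner (𝕜 := ℂ) (szegoKernel z) a

lemma isHolo_hardyFun (a : HardySeq) : IsHolo (hardyFun a) := (hasPowerSeries_hardyFun a).isHolo

lemma hardyFun_injective : Function.Injective hardyFun := fun a b h =>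
  lp.ext <| (hasPowerSeries_hardyFun a).unique (h ▸ hasPowerSeries_hardyFun b)

lemma hardyNormSq_hardyFun (a : HardySeq) :
    hardyNormSq (hardyFun a) = ENNReal.ofReal (‖a‖ ^ 2) := by
  rw [(hasPowerSeries_hardyFun a).hardyNormSq_eq_tsum, ← a.hasSum_norm_sq.tsum_eq,
    ENNReal.ofReal_tsum_of_nonneg (fun n => by positivity) a.hasSum_norm_sq.summable]
  simp only [enorm_sq_eq_ofReal]

lemma hardyFun_mem_hardySpace (a : HardySeq) : hardyFun a ∈ hardySpace :=
  ⟨isHolo_hardyFun a, (hardyNormSq_hardyFun a).trans_lt ENNReal.ofReal_lt_top⟩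

lemma exists_hardyFun_eq {f : Disc → ℂ} (hf : f ∈ hardySpace) : ∃ a, hardyFun a = f := by
  have hc := hf.1.hasPowerSeries
  have hfin := hf.2.ne
  simp only [hc.hardyNormSq_eq_tsum, enorm_sq_eq_ofReal] at hfin
  have hsummable := ENNReal.summable_toReal hfin
  simp only [ENNReal.toReal_ofReal (sq_nonneg _)] at hsummable
  exact ⟨⟨_, memℓp_two_iff.2 hsummable⟩,
    funext fun z => (hasPowerSeries_hardyFun _ z).unique (hc z)⟩

lemma exists_hardyFun_eq_of_hardyNormSq_le {f : Disc → ℂ} (hf : IsHolo f) {C : ℝ} (hC : 0 ≤ C)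
    (h : hardyNormSq f ≤ ENNReal.ofReal (C ^ 2)) : ∃ b, hardyFun b = f ∧ ‖b‖ ≤ C := by
  obtain ⟨b, rfl⟩ := exists_hardyFun_eq ⟨hf, h.trans_lt ENNReal.ofReal_lt_top⟩
  rw [hardyNormSq_hardyFun, ENNReal.ofReal_le_ofReal_iff (sq_nonneg C)] at h
  exact ⟨b, rfl, le_of_sq_le_sq h hC⟩

lemma norm_hardyFun_sq_le (a : HardySeq) (z : Disc) :
    (1 - ‖(z : ℂ)‖ ^ 2) * ‖hardyFun a z‖ ^ 2 ≤ ‖a‖ ^ 2 := by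
  have hsq : ‖hardyFun a z‖ ^ 2 ≤ (1 - ‖(z : ℂ)‖ ^ 2)⁻¹ * ‖a‖ ^ 2 := by
    rw [← norm_szegoKernel_sq, ← mul_pow]
    gcongr
    exact norm_inner_le_norm (𝕜 := ℂ) (szegoKernel z) a
  exact (le_inv_mul_iff₀ z.one_sub_norm_sq_pos).1 hsq

lemma tendsto_hardyFun {ι : Type*} {l : Filter ι} {A : ι → HardySeq} (h : Tendsto A l (𝓝 a))
    (z : Disc) : Tendsto (fun i => hardyFun (A i) z) l (𝓝 (hardyFun a z)) :=
  (tendsto_const_nhds (x := szegoKernel z)).inner h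

lemma exists_hardyFun_eq_mul {φ : Disc → ℂ} (hφ : IsHolo φ) {C : ℝ} (hC : ∀ z, ‖φ z‖ ≤ C)
    (a : HardySeq) : ∃ b, hardyFun b = φ * hardyFun a ∧ ‖b‖ ≤ C * ‖a‖ := by
  have hC0 : 0 ≤ C := (norm_nonneg _).trans (hC 0)
  refine exists_hardyFun_eq_of_hardyNormSq_le (hφ.mul (isHolo_hardyFun a)) (by positivity) ?_
  calc hardyNormSq (φ * hardyFun a) ≤ hardyNormSq (hardyFun ((C : ℂ) • a)) :=
        hardyNormSq_mono fun z => by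
          simp only [Pi.mul_apply, norm_mul, map_smul, Pi.smul_apply, norm_smul,
            Complex.norm_of_nonneg hC0]
          gcongr
          exact hC z
    _ = ENNReal.ofReal ((C * ‖a‖) ^ 2) := by
        rw [hardyNormSq_hardyFun, norm_smul, Complex.norm_of_nonneg hC0]

end hardyFun

section shift

/-- The coefficient sequence of `z * f`, where `f` has coefficients `c`. -/
def shiftSeq (c : ℕ → ℂ) : ℕ → ℂ
  | 0 => 0
  | n + 1 => c n

lemma hasSum_norm_shiftSeq_sq (a : HardySeq) :
    HasSum (fun n => ‖shiftSeq a n‖ ^ 2) (‖a‖ ^ 2) := by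
  rw [← hasSum_nat_add_iff' 1]
  simpa [shiftSeq] using a.hasSum_norm_sq

/-- Multiplication by `z` on the Hardy space. -/
noncomputable def shift : HardySeq →ₗᵢ[ℂ] HardySeq where
  toFun a := ⟨shiftSeq a, memℓp_two_iff.2 (hasSum_norm_shiftSeq_sq a).summable⟩
  map_add' a b := by
    ext n
    cases n
    · exact (add_zero (0 : ℂ)).symm
    · rfl
  map_smul' c a := by ext n; cases n <;> simp [shiftSeq]
  norm_map' a := (sq_eq_sq₀ (norm_nonneg _) (norm_nonneg _)).1 <|
    (HardySeq.hasSum_norm_sq _).unique (hasSum_norm_shiftSeq_sq a)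

lemma shift_apply_succ (a : HardySeq) (n : ℕ) : shift a (n + 1) = a n := rfl

lemma shift_apply_zero (a : HardySeq) : shift a 0 = 0 := rfl

lemma hardyFun_shift (a : HardySeq) (z : Disc) : hardyFun (shift a) z = z * hardyFun a z := by
  refine (hasPowerSeries_hardyFun (shift a) z).unique ?_
  rw [← hasSum_nat_add_iff' 1]
  simp only [shift_apply_succ, Finset.range_one, Finset.sum_singleton, shift_apply_zero, zero_mul,
    sub_zero]
  exact ((hasPowerSeries_hardyFun a z).mul_left (z : ℂ)).congr_fun fun n => by ring

lemma hardyFun_shift_pow (a : HardySeq) (n : ℕ) (z : Disc) :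
    hardyFun ((shift.toContinuousLinearMap ^ n) a) z = z ^ n * hardyFun a z := by
  induction n with
  | zero => simp
  | succ n ih =>
    rw [pow_succ', mul_apply_eq_comp, LinearIsometry.coe_toContinuousLinearMap, hardyFun_shift, ih]
    ring

end shift

section szegoMul

lemma one_sub_conj_mul_ne_zero (w z : Disc) : 1 - conj (w : ℂ) * z ≠ 0 := by
  intro h
  have hnorm : ‖(w : ℂ)‖ * ‖(z : ℂ)‖ = 1 := by
    rw [← RCLike.norm_conj, ← norm_mul, ← sub_eq_zero.1 h, norm_one]
  nlinarith [w.norm_lt_one, z.norm_lt_one, norm_nonneg (w : ℂ), norm_nonneg (z : ℂ)]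

lemma one_sub_conj_mul_self (w : ℂ) : 1 - conj w * w = ((1 - ‖w‖ ^ 2 : ℝ) : ℂ) := by
  rw [mul_comm, Complex.mul_conj, Complex.normSq_eq_norm_sq]
  push_cast
  rfl

lemma norm_conj_smul_shift_lt_one (w : Disc) :
    ‖conj (w : ℂ) • shift.toContinuousLinearMap‖ < 1 := by
  refine lt_of_le_of_lt ?_ w.norm_lt_one
  rw [norm_smul, RCLike.norm_conj]
  exact mul_le_of_le_one_right (norm_nonneg _) (LinearIsometry.norm_toContinuousLinearMap_le _)

/-- Multiplication by the Szegő kernel `(1 - conj w * z)⁻¹` on the Hardy space. It is defined by a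
Neumann series in the shift. -/
noncomputable def szegoMul (w : Disc) : HardySeq →L[ℂ] HardySeq :=
  ∑' n : ℕ, (conj (w : ℂ) • shift.toContinuousLinearMap) ^ n

lemma szegoMul_sub_conj_smul_shift (w : Disc) (a : HardySeq) :
    szegoMul w a - conj (w : ℂ) • shift (szegoMul w a) = a := by
  simpa [szegoMul, sub_mul] using
    congrArg (fun T : HardySeq →L[ℂ] HardySeq => T a)
      (mul_neg_geom_series _ (norm_conj_smul_shift_lt_one w))

lemma hardyFun_szegoMul (w : Disc) (a : HardySeq) (z : Disc) :
    hardyFun (szegoMul w a) z = (1 - conj (w : ℂ) * z)⁻¹ * hardyFun a z := by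
  have h := congrArg (fun b => hardyFun b z) (szegoMul_sub_conj_smul_shift w a)
  simp only [map_sub, map_smul, Pi.sub_apply, Pi.smul_apply, hardyFun_shift, smul_eq_mul] at h
  rw [← h]
  field_simp [one_sub_conj_mul_ne_zero w z]

lemma norm_szegoMul_le (w : Disc) (a : HardySeq) :
    (1 - ‖(w : ℂ)‖) * ‖szegoMul w a‖ ≤ ‖a‖ := by
  have h := norm_sub_norm_le (szegoMul w a) (conj (w : ℂ) • shift (szegoMul w a))
  rw [szegoMul_sub_conj_smul_shift, norm_smul, RCLike.norm_conj, LinearIsometry.norm_map] at h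
  linarith

lemma hasPowerSeries_inner_szegoMul (a b : HardySeq) :
    HasPowerSeries (fun w => inner ℂ (szegoMul w a) b)
      fun n => inner ℂ ((shift.toContinuousLinearMap ^ n) a) b := by
  intro w
  have hseries := (summable_geometric_of_norm_lt_one (norm_conj_smul_shift_lt_one w)).hasSum
  have hinner := (hseries.mapL (ContinuousLinearMap.apply ℂ HardySeq a)).mapL (innerSL ℂ b)
  simpa [smul_pow, inner_smul_right, szegoMul, mul_comm] using Complex.hasSum_conj'.2 hinner

end szegoMul

/-- The Herglotz transform `∫ (ζ + w) / (ζ - w) * |f ζ|²` of the function `f` on the circle with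
coefficients `a`. Its real part is the Poisson integral of `|f|²`. -/
noncomputable def herglotz (a : HardySeq) (w : Disc) : ℂ :=
  2 * inner ℂ (szegoMul w a) a - (‖a‖ ^ 2 : ℝ)

lemma isHolo_herglotz (a : HardySeq) : IsHolo (herglotz a) :=
  ((hasPowerSeries_inner_szegoMul a a).isHolo.smul 2).sub (isHolo_const _)

lemma herglotz_re (a : HardySeq) (w : Disc) :
    (herglotz a w).re = (1 - ‖(w : ℂ)‖ ^ 2) * ‖szegoMul w a‖ ^ 2 := by
  set k := szegoMul w a with hk
  have ha : a = k - conj (w : ℂ) • shift k := (szegoMul_sub_conj_smul_shift w a).symm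
  have hnorm : ‖a‖ ^ 2 = ‖k‖ ^ 2 - 2 * (conj (w : ℂ) * inner ℂ k (shift k)).re +
      ‖(w : ℂ)‖ ^ 2 * ‖k‖ ^ 2 := by
    conv_lhs => rw [ha]
    rw [@norm_sub_sq ℂ, inner_smul_right, norm_smul, RCLike.norm_conj, LinearIsometry.norm_map,
      mul_pow]
    rfl
  have hinner : (inner ℂ k a).re = ‖k‖ ^ 2 - (conj (w : ℂ) * inner ℂ k (shift k)).re := by
    conv_lhs => rw [ha]
    rw [inner_sub_right, inner_smul_right, Complex.sub_re, inner_self_eq_norm_sq_to_K]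
    norm_cast
  have hre : (herglotz a w).re = 2 * (inner ℂ k a).re - ‖a‖ ^ 2 := by
    simp only [herglotz, hk, Complex.sub_re, Complex.ofReal_re, Complex.mul_re]
    simp
  rw [hre, hinner, hnorm]
  ring

lemma norm_hardyFun_sq_le_herglotz_re (a : HardySeq) (w : Disc) :
    ‖hardyFun a w‖ ^ 2 ≤ (herglotz a w).re := by
  have hpos := w.one_sub_norm_sq_pos
  have h := norm_hardyFun_sq_le (szegoMul w a) w
  rw [hardyFun_szegoMul, one_sub_conj_mul_self, norm_mul, norm_inv,
    Complex.norm_of_nonneg hpos.le] at h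
  rw [herglotz_re]
  calc ‖hardyFun a w‖ ^ 2 = (1 - ‖(w : ℂ)‖ ^ 2) * ((1 - ‖(w : ℂ)‖ ^ 2) *
        ((1 - ‖(w : ℂ)‖ ^ 2)⁻¹ * ‖hardyFun a w‖) ^ 2) := by
        field_simp
    _ ≤ (1 - ‖(w : ℂ)‖ ^ 2) * ‖szegoMul w a‖ ^ 2 := by gcongr

lemma tendsto_herglotz {ι : Type*} {l : Filter ι} {A : ι → HardySeq} {a : HardySeq}
    (h : Tendsto A l (𝓝 a)) (w : Disc) :
    Tendsto (fun i => herglotz (A i) w) l (𝓝 (herglotz a w)) := by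
  have hinner := (((szegoMul w).continuous.tendsto a).comp h).inner (𝕜 := ℂ) h
  exact (hinner.const_mul 2).sub ((Complex.continuous_ofReal.tendsto _).comp (h.norm.pow 2))

/-! ### Harmonic measure and conformal invariance -/

lemma norm_one_sub_conj_mul_sq_sub_norm_sub_sq (w z : ℂ) :
    ‖1 - conj w * z‖ ^ 2 - ‖w - z‖ ^ 2 = (1 - ‖w‖ ^ 2) * (1 - ‖z‖ ^ 2) := by
  simp only [← Complex.normSq_eq_norm_sq, Complex.normSq_apply, Complex.sub_re, Complex.sub_im,
    Complex.mul_re, Complex.mul_im, Complex.conj_re, Complex.conj_im, Complex.one_re,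
    Complex.one_im]
  ring

/-- The Möbius involution of the disc that exchanges `0` and `w`. -/
noncomputable def mobius (w z : Disc) : Disc :=
  ⟨(w - z) / (1 - conj (w : ℂ) * z), by
    have h := norm_one_sub_conj_mul_sq_sub_norm_sub_sq w z
    have hpos := mul_pos w.one_sub_norm_sq_pos z.one_sub_norm_sq_pos
    rw [mem_ball_zero_iff, norm_div, div_lt_one (norm_pos_iff.2 (one_sub_conj_mul_ne_zero w z))]
    exact lt_of_pow_lt_pow_left₀ 2 (norm_nonneg _) (by linarith)⟩

section mobius

variable (w z : Disc)

lemma coe_mobius : (mobius w z : ℂ) = (w - z) / (1 - conj (w : ℂ) * z) := rfl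

lemma one_sub_conj_mul_mobius :
    1 - conj (w : ℂ) * mobius w z =
      ((1 - ‖(w : ℂ)‖ ^ 2 : ℝ) : ℂ) / (1 - conj (w : ℂ) * z) := by
  have h := one_sub_conj_mul_ne_zero w z
  rw [coe_mobius, ← one_sub_conj_mul_self, eq_div_iff h, sub_mul, mul_assoc, div_mul_cancel₀ _ h]
  ring

lemma mobius_mobius : mobius w (mobius w z) = z := by
  apply Subtype.ext
  rw [coe_mobius, one_sub_conj_mul_mobius, ← one_sub_conj_mul_self, coe_mobius,
    div_eq_iff (div_ne_zero (one_sub_conj_mul_ne_zero w w) (one_sub_conj_mul_ne_zero w z)),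
    mul_div_assoc', eq_div_iff (one_sub_conj_mul_ne_zero w z), sub_mul,
    div_mul_cancel₀ _ (one_sub_conj_mul_ne_zero w z)]
  ring

@[simp] lemma mobius_zero : mobius w 0 = w :=
  Subtype.ext <| by simp [coe_mobius]

lemma differentiableOn_mobius :
    DifferentiableOn ℂ (fun z => ((w : ℂ) - z) / (1 - conj (w : ℂ) * z)) (Metric.ball 0 1) :=
  DifferentiableOn.div (by fun_prop) (by fun_prop) fun z hz => one_sub_conj_mul_ne_zero w ⟨z, hz⟩

lemma IsHolo.comp_mobius {f : Disc → ℂ} (hf : IsHolo f) : IsHolo fun z => f (mobius w z) :=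
  isHolo_of_differentiableOn
    (DifferentiableOn.comp hf (differentiableOn_mobius w) fun z hz => (mobius w ⟨z, hz⟩).2)
    fun z => (zeroExt_coe f (mobius w z)).symm

end mobius

section HarmonicMajorant

variable {f g : Disc → ℂ} {r : ℝ}

lemma IsHolo.integral_re_polarPoint (hg : IsHolo g) (h0 : 0 ≤ r) (h1 : r < 1) :
    (2 * Real.pi)⁻¹ * ∫ θ in Set.Ioc 0 (2 * Real.pi), (g (polarPoint h0 h1 θ)).re = (g 0).re := by
  have hd : DiffContOnCl ℂ (zeroExt g) (Metric.ball 0 |r|) := by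
    refine (DifferentiableOn.mono hg ?_).diffContOnCl
    rw [abs_of_nonneg h0]
    exact Metric.closure_ball_subset_closedBall.trans (Metric.closedBall_subset_ball h1)
  have hcircle : ∀ θ, g (polarPoint h0 h1 θ) = zeroExt g (circleMap 0 r θ) := fun θ => by
    rw [circleMap_zero, zeroExt_of_mem g (circle_mem_ball h0 h1 θ), polarPoint]
  have hmean : (2 * Real.pi)⁻¹ • ∫ θ in Set.Ioc 0 (2 * Real.pi), g (polarPoint h0 h1 θ) = g 0 := by
    rw [← zeroExt_coe g 0, ← intervalIntegral.integral_of_le Real.two_pi_pos.le]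
    simp only [hcircle]
    exact hd.circleAverage
  rw [← hmean, Complex.smul_re, smul_eq_mul, ← Complex.reCLM_apply (∫ θ in _, _),
    ← ContinuousLinearMap.integral_comp_comm _ (integrableOn_polarPoint hg.continuous h0 h1)]
  simp only [Complex.reCLM_apply]

lemma IsHolo.norm_apply_zero_sq_le (hf : IsHolo f) (h0 : 0 ≤ r) (h1 : r < 1) :
    ‖f 0‖ ^ 2 ≤
      (2 * Real.pi)⁻¹ * ∫ θ in Set.Ioc 0 (2 * Real.pi), ‖f (polarPoint h0 h1 θ)‖ ^ 2 := by
  have hc := hf.hasPowerSeries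
  rw [hc.apply_zero]
  simpa using le_hasSum (hc.hasSum_norm_sq h0 h1) 0 fun n _ => by positivity

lemma IsHolo.meanSq_eq_ofReal (hf : IsHolo f) (h0 : 0 ≤ r) (h1 : r < 1) :
    meanSq f r = ENNReal.ofReal
      ((2 * Real.pi)⁻¹ * ∫ θ in Set.Ioc 0 (2 * Real.pi), ‖f (polarPoint h0 h1 θ)‖ ^ 2) := by
  have hint : IntegrableOn (fun θ => ‖f (polarPoint h0 h1 θ)‖ ^ 2) (Set.Ioc 0 (2 * Real.pi)) :=
    integrableOn_polarPoint (hf.continuous.norm.pow 2) h0 h1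
  simp only [meanSq_eq_lintegral f h0 h1, enorm_sq_eq_ofReal]
  rw [← ofReal_integral_eq_lintegral_ofReal hint (ae_of_all _ fun _ => by positivity),
    ← ENNReal.ofReal_mul (by positivity)]

lemma hardyNormSq_le_of_add_le_re {u : Disc → ℂ} (hf : IsHolo f) (hu : IsHolo u)
    (hg : IsHolo g) (h : ∀ z, ‖f z‖ ^ 2 + ‖u z‖ ^ 2 ≤ (g z).re) :
    hardyNormSq f ≤ ENNReal.ofReal ((g 0).re - ‖u 0‖ ^ 2) := by
  refine hardyNormSq_le fun r h0 h1 => ?_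
  rw [hf.meanSq_eq_ofReal h0 h1]
  refine ENNReal.ofReal_le_ofReal (le_sub_iff_add_le.2 ?_)
  have hint_f := integrableOn_polarPoint (hf.continuous.norm.pow 2) h0 h1
  have hint_u := integrableOn_polarPoint (hu.continuous.norm.pow 2) h0 h1
  have hint_g := integrableOn_polarPoint (Complex.continuous_re.comp hg.continuous) h0 h1
  calc _ ≤ (2 * Real.pi)⁻¹ * (∫ θ in Set.Ioc 0 (2 * Real.pi), ‖f (polarPoint h0 h1 θ)‖ ^ 2) +
        (2 * Real.pi)⁻¹ * ∫ θ in Set.Ioc 0 (2 * Real.pi), ‖u (polarPoint h0 h1 θ)‖ ^ 2 := by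
        gcongr
        exact hu.norm_apply_zero_sq_le h0 h1
    _ = (2 * Real.pi)⁻¹ * ∫ θ in Set.Ioc 0 (2 * Real.pi),
        (‖f (polarPoint h0 h1 θ)‖ ^ 2 + ‖u (polarPoint h0 h1 θ)‖ ^ 2) := by
        rw [← mul_add]
        exact congrArg _ (integral_add hint_f hint_u).symm
    _ ≤ (2 * Real.pi)⁻¹ * ∫ θ in Set.Ioc 0 (2 * Real.pi), (g (polarPoint h0 h1 θ)).re :=
        mul_le_mul_of_nonneg_left
          (integral_mono (hint_f.add hint_u) hint_g fun θ => h (polarPoint h0 h1 θ))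
          (by positivity)
    _ = (g 0).re := hg.integral_re_polarPoint h0 h1

end HarmonicMajorant

section hardyNormSq_comp_mobius

variable {a b : HardySeq} {w : Disc}

lemma hardyNormSq_comp_mobius_le (a : HardySeq) (w : Disc) :
    hardyNormSq (fun z => hardyFun a (mobius w z)) ≤ ENNReal.ofReal (herglotz a w).re := by
  simpa using hardyNormSq_le_of_add_le_re ((isHolo_hardyFun a).comp_mobius w) (isHolo_const 0)
    ((isHolo_herglotz a).comp_mobius w) fun z => by
      simpa using norm_hardyFun_sq_le_herglotz_re a (mobius w z)

lemma norm_sq_le_of_comp_mobius (h : ∀ z, hardyFun b z = hardyFun a (mobius w z)) :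
    ‖b‖ ^ 2 ≤ (1 - ‖(w : ℂ)‖ ^ 2) * ‖szegoMul w a‖ ^ 2 := by
  have hpos := w.one_sub_norm_sq_pos
  have hle := hardyNormSq_comp_mobius_le a w
  rwa [← funext h, hardyNormSq_hardyFun, herglotz_re,
    ENNReal.ofReal_le_ofReal_iff (by positivity)] at hle

lemma exists_hardyFun_eq_comp_mobius (a : HardySeq) (w : Disc) :
    ∃ b, ∀ z, hardyFun b z = hardyFun a (mobius w z) := by
  obtain ⟨b, hb⟩ := exists_hardyFun_eq (f := fun z => hardyFun a (mobius w z))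
    ⟨(isHolo_hardyFun a).comp_mobius w,
      (hardyNormSq_comp_mobius_le a w).trans_lt ENNReal.ofReal_lt_top⟩
  exact ⟨b, congrFun hb⟩

-- The lower bound is the upper bound applied to the inverse substitution: up to the factor
-- `(1 - |w|²)⁻¹`, the function `b` times the Szegő kernel is `d = (szegoMul w a) ∘ mobius w`.
lemma norm_sq_of_comp_mobius (h : ∀ z, hardyFun b z = hardyFun a (mobius w z)) :
    ‖b‖ ^ 2 = (1 - ‖(w : ℂ)‖ ^ 2) * ‖szegoMul w a‖ ^ 2 := by
  have hpos := w.one_sub_norm_sq_pos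
  refine le_antisymm (norm_sq_le_of_comp_mobius h) ?_
  obtain ⟨d, hd⟩ := exists_hardyFun_eq_comp_mobius (szegoMul w a) w
  have hdb : szegoMul w d = ((1 - ‖(w : ℂ)‖ ^ 2 : ℝ) : ℂ)⁻¹ • b := by
    refine hardyFun_injective (funext fun z => ?_)
    have hne : ((1 - ‖(w : ℂ)‖ ^ 2 : ℝ) : ℂ) ≠ 0 := Complex.ofReal_ne_zero.2 hpos.ne'
    rw [hardyFun_szegoMul, hd, hardyFun_szegoMul, one_sub_conj_mul_mobius, map_smul,
      Pi.smul_apply, h, smul_eq_mul]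
    field_simp [one_sub_conj_mul_ne_zero w z]
  have hle := norm_sq_le_of_comp_mobius (a := d) (b := szegoMul w a) (w := w) fun z => by
    rw [hd, mobius_mobius]
  rw [hdb, norm_smul, norm_inv, Complex.norm_of_nonneg hpos.le, mul_pow] at hle
  calc (1 - ‖(w : ℂ)‖ ^ 2) * ‖szegoMul w a‖ ^ 2
      ≤ (1 - ‖(w : ℂ)‖ ^ 2) *
          ((1 - ‖(w : ℂ)‖ ^ 2) * ((1 - ‖(w : ℂ)‖ ^ 2)⁻¹ ^ 2 * ‖b‖ ^ 2)) := by gcongr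
    _ = ‖b‖ ^ 2 := by field_simp

lemma hardyNormSq_comp_mobius (a : HardySeq) (w : Disc) :
    hardyNormSq (fun z => hardyFun a (mobius w z)) = ENNReal.ofReal (herglotz a w).re := by
  obtain ⟨b, hb⟩ := exists_hardyFun_eq_comp_mobius a w
  rw [← funext hb, hardyNormSq_hardyFun, herglotz_re, norm_sq_of_comp_mobius hb]

end hardyNormSq_comp_mobius

/-- The integral `∫ |f - f w|² dω` with respect to the harmonic measure `ω` of the disc at `w`. By
the Littlewood–Paley formula it is twice the Dirichlet integral of `f` weighted by the Green
function with pole `w`, up to the normalization of the area measure. -/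
noncomputable def harmonicVariance (w : Disc) (f : Disc → ℂ) : ENNReal :=
  hardyNormSq fun z => f (mobius w z) - f w

lemma hardyNormSq_comp_mobius_eq_add {f : Disc → ℂ} (hf : IsHolo f) (w : Disc) :
    hardyNormSq (fun z => f (mobius w z)) = ‖f w‖ₑ ^ 2 + harmonicVariance w f := by
  simpa [harmonicVariance] using (hf.comp_mobius w).hasPowerSeries.hardyNormSq_eq_add

lemma harmonicVariance_le_hardyNormSq_comp_mobius {f : Disc → ℂ} (hf : IsHolo f) (w : Disc) :
    harmonicVariance w f ≤ hardyNormSq fun z => f (mobius w z) :=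
  le_add_self.trans_eq (hardyNormSq_comp_mobius_eq_add hf w).symm

section differenceQuotient

open ContinuousLinearMap (adjoint)

/-- The operator `f ↦ (f - f w) / (z - w)` on the Hardy space. With `S` the shift, it is
`S† (1 - w S†)⁻¹`. -/
noncomputable def differenceQuotient (w : Disc) : HardySeq →L[ℂ] HardySeq :=
  adjoint shift.toContinuousLinearMap ∘L adjoint (szegoMul w)

lemma conj_smul_shift_szegoKernel (z : Disc) :
    conj (z : ℂ) • shift (szegoKernel z) = szegoKernel z - szegoKernel 0 := by
  ext n
  rw [lp.coeFn_smul, lp.coeFn_sub, Pi.smul_apply, Pi.sub_apply]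
  cases n with
  | zero => simp [szegoKernel, shift_apply_zero]
  | succ n => simp [szegoKernel, shift_apply_succ, pow_succ']

lemma hardyFun_adjoint_shift (a : HardySeq) (z : Disc) :
    (z : ℂ) * hardyFun (adjoint shift.toContinuousLinearMap a) z = hardyFun a z - hardyFun a 0 := by
  simp only [hardyFun_apply]
  rw [ContinuousLinearMap.adjoint_inner_right, ← inner_sub_left, ← conj_smul_shift_szegoKernel,
    inner_smul_left, Complex.conj_conj]
  rfl

lemma szegoMul_apply_sub_conj_smul_shift (w : Disc) (a : HardySeq) :
    szegoMul w (a - conj (w : ℂ) • shift a) = a := by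
  refine hardyFun_injective (funext fun z => ?_)
  simp only [hardyFun_szegoMul, map_sub, map_smul, Pi.sub_apply, Pi.smul_apply, hardyFun_shift,
    smul_eq_mul]
  field_simp [one_sub_conj_mul_ne_zero w z]

lemma adjoint_szegoMul_sub_smul_differenceQuotient (w : Disc) (a : HardySeq) :
    adjoint (szegoMul w) a - (w : ℂ) • differenceQuotient w a = a := by
  refine ext_inner_left ℂ fun x => ?_
  rw [differenceQuotient, ContinuousLinearMap.comp_apply, inner_sub_right, inner_smul_right,
    ContinuousLinearMap.adjoint_inner_right, ContinuousLinearMap.adjoint_inner_right,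
    ContinuousLinearMap.adjoint_inner_right, ← Complex.conj_conj (w : ℂ), ← inner_smul_left,
    ← inner_sub_left, ← map_smul, ← map_sub]
  exact congrArg (inner ℂ · a) (szegoMul_apply_sub_conj_smul_shift w x)

lemma sub_mul_hardyFun_differenceQuotient (w : Disc) (a : HardySeq) (z : Disc) :
    ((z : ℂ) - w) * hardyFun (differenceQuotient w a) z = hardyFun a z - hardyFun a w := by
  set b := adjoint (szegoMul w) a
  have hb : ∀ z, hardyFun b z - w * hardyFun (differenceQuotient w a) z = hardyFun a z :=
      fun z => by
    simpa using
      congrArg (fun c => hardyFun c z) (adjoint_szegoMul_sub_smul_differenceQuotient w a)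
  have hq : ∀ z : Disc,
      (z : ℂ) * hardyFun (differenceQuotient w a) z = hardyFun b z - hardyFun b 0 :=
    hardyFun_adjoint_shift b
  linear_combination hq z - hq w + hb z - hb w

lemma eq_of_sub_mul_hardyFun_eq {x y : HardySeq} {w : Disc}
    (h : ∀ z : Disc, ((z : ℂ) - w) * hardyFun x z = ((z : ℂ) - w) * hardyFun y z) : x = y := by
  have heigen : shift (x - y) = (w : ℂ) • (x - y) := hardyFun_injective <| funext fun z => by
    simp only [hardyFun_shift, map_sub, map_smul, Pi.smul_apply, Pi.sub_apply, smul_eq_mul]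
    linear_combination h z
  have hnorm := congrArg norm heigen
  rw [LinearIsometry.norm_map, norm_smul] at hnorm
  have hzero : ‖x - y‖ = 0 := by nlinarith [w.norm_lt_one, norm_nonneg (x - y)]
  exact sub_eq_zero.1 (norm_eq_zero.1 hzero)

lemma norm_linearIsometry_sub_smul {𝕜 E : Type*} [RCLike 𝕜] [NormedAddCommGroup E]
    [InnerProductSpace 𝕜 E] (V : E →ₗᵢ[𝕜] E) (w : 𝕜) (x : E) :
    ‖V x - w • x‖ = ‖x - conj w • V x‖ := by
  rw [← sq_eq_sq₀ (norm_nonneg _) (norm_nonneg _), @norm_sub_sq 𝕜, @norm_sub_sq 𝕜,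
    inner_smul_right, inner_smul_right, norm_smul, norm_smul, RCLike.norm_conj, V.norm_map,
    ← RCLike.conj_re (conj w * inner 𝕜 x (V x)), map_mul (starRingEnd 𝕜),
    RCLike.conj_conj, inner_conj_symm]

lemma harmonicVariance_hardyFun (w : Disc) (a : HardySeq) :
    harmonicVariance w (hardyFun a) =
      ENNReal.ofReal ((1 - ‖(w : ℂ)‖ ^ 2) * ‖differenceQuotient w a‖ ^ 2) := by
  set q := differenceQuotient w a
  have hsub : ∀ z, hardyFun a z - hardyFun a w = hardyFun (shift q - (w : ℂ) • q) z := fun z => by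
    rw [← sub_mul_hardyFun_differenceQuotient, map_sub, map_smul, Pi.sub_apply, Pi.smul_apply,
      hardyFun_shift, smul_eq_mul, sub_mul]
  have hcomm : szegoMul w (shift q - (w : ℂ) • q) =
      shift (szegoMul w q) - (w : ℂ) • szegoMul w q := hardyFun_injective <| funext fun z => by
    simp only [hardyFun_szegoMul, hardyFun_shift, map_sub, map_smul, Pi.sub_apply, Pi.smul_apply,
      smul_eq_mul]
    ring
  simp only [harmonicVariance, hsub]
  rw [hardyNormSq_comp_mobius, herglotz_re, hcomm, norm_linearIsometry_sub_smul,
    szegoMul_sub_conj_smul_shift]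

lemma norm_differenceQuotient_le (w : Disc) (a : HardySeq) :
    (1 - ‖(w : ℂ)‖) * ‖differenceQuotient w a‖ ≤ ‖a‖ := by
  have hpos : 0 < 1 - ‖(w : ℂ)‖ := sub_pos.2 w.norm_lt_one
  have hK : ‖szegoMul w‖ ≤ (1 - ‖(w : ℂ)‖)⁻¹ :=
    ContinuousLinearMap.opNorm_le_bound _ (by positivity) fun a => by
      rw [le_inv_mul_iff₀ hpos]
      exact norm_szegoMul_le w a
  have hS : ‖adjoint shift.toContinuousLinearMap‖ ≤ 1 := by
    rw [LinearIsometryEquiv.norm_map]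
    exact shift.norm_toContinuousLinearMap_le
  rw [← le_inv_mul_iff₀ hpos]
  calc ‖differenceQuotient w a‖ ≤ ‖adjoint shift.toContinuousLinearMap‖ *
        (‖adjoint (szegoMul w)‖ * ‖a‖) :=
        (adjoint shift.toContinuousLinearMap).le_opNorm_of_le
          ((adjoint (szegoMul w)).le_opNorm a)
    _ ≤ 1 * ((1 - ‖(w : ℂ)‖)⁻¹ * ‖a‖) := by
        rw [LinearIsometryEquiv.norm_map adjoint (szegoMul w)]
        gcongr
    _ = (1 - ‖(w : ℂ)‖)⁻¹ * ‖a‖ := one_mul _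

end differenceQuotient

/-- Multiplication by a real number `0 ≤ r ≤ 1` on the disc. -/
def Disc.scale (r : Set.Icc (0 : ℝ) 1) (z : Disc) : Disc :=
  ⟨(r : ℝ) * z, by
    rw [mem_ball_zero_iff, norm_mul, Complex.norm_of_nonneg r.2.1]
    nlinarith [z.norm_lt_one, norm_nonneg (z : ℂ), r.2.1, r.2.2]⟩

section scale

variable {f : Disc → ℂ} (r : Set.Icc (0 : ℝ) 1)

lemma Disc.coe_scale (z : Disc) : (z.scale r : ℂ) = (r : ℝ) * z := rfl

lemma IsHolo.comp_scale (hf : IsHolo f) : IsHolo fun z => f (z.scale r) :=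
  isHolo_of_differentiableOn
    (DifferentiableOn.comp (g := zeroExt f) (f := fun z => ((r : ℝ) : ℂ) * z) hf (by fun_prop)
      fun z hz => (Disc.scale r ⟨z, hz⟩).2)
    fun z => (zeroExt_coe f (z.scale r)).symm

lemma hardyNormSq_comp_scale_le (f : Disc → ℂ) :
    hardyNormSq (fun z => f (z.scale r)) ≤ hardyNormSq f := by
  refine hardyNormSq_le fun s h0 h1 => ?_
  have hr0 : 0 ≤ r * s := mul_nonneg r.2.1 h0
  have hr1 : r * s < 1 := (mul_le_of_le_one_left h0 r.2.2).trans_lt h1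
  refine le_trans (le_of_eq ?_) (meanSq_le_hardyNormSq f hr0 hr1)
  rw [meanSq_eq_lintegral _ h0 h1, meanSq_eq_lintegral _ hr0 hr1]
  congr! 5 with θ
  refine congrArg f (Subtype.ext ?_)
  simp [Disc.coe_scale, polarPoint, mul_assoc]

lemma exists_hardyFun_eq_comp_scale (a : HardySeq) :
    ∃ b, (∀ z, hardyFun b z = hardyFun a (z.scale r)) ∧ ‖b‖ ≤ ‖a‖ := by
  obtain ⟨b, hb, hle⟩ := exists_hardyFun_eq_of_hardyNormSq_le ((isHolo_hardyFun a).comp_scale r)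
    (norm_nonneg a) ((hardyNormSq_comp_scale_le r _).trans_eq (hardyNormSq_hardyFun a))
  exact ⟨b, congrFun hb, hle⟩

lemma norm_differenceQuotient_comp_scale_le {a b : HardySeq}
    (h : ∀ z, hardyFun b z = hardyFun a (z.scale r)) (w : Disc) :
    ‖differenceQuotient w b‖ ≤ 2 * ‖differenceQuotient w a‖ := by
  set q := differenceQuotient w a with hq
  set p := differenceQuotient (w.scale r) q with hp
  obtain ⟨qr, hqr, hqr_le⟩ := exists_hardyFun_eq_comp_scale r q
  obtain ⟨pr, hpr, hpr_le⟩ := exists_hardyFun_eq_comp_scale r p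
  have hb : differenceQuotient w b =
      ((r : ℝ) : ℂ) • qr - ((1 - (r : ℝ) : ℝ) * w : ℂ) • ((r : ℝ) : ℂ) • pr := by
    refine eq_of_sub_mul_hardyFun_eq (w := w) fun z => ?_
    have hqz := sub_mul_hardyFun_differenceQuotient w a (z.scale r)
    have hqw := sub_mul_hardyFun_differenceQuotient w a (w.scale r)
    have hpz := sub_mul_hardyFun_differenceQuotient (w.scale r) q (z.scale r)
    rw [sub_mul_hardyFun_differenceQuotient, h, h]
    simp only [map_sub, map_smul, Pi.sub_apply, Pi.smul_apply, smul_eq_mul, hqr, hpr]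
    simp only [← hq, ← hp, Disc.coe_scale] at hqz hqw hpz
    push_cast
    linear_combination -hqz + hqw + (1 - (r : ℝ)) * w * hpz
  obtain ⟨hr0, hr1⟩ := r.2
  have hr1' := sub_nonneg.2 hr1
  have hp_le := norm_differenceQuotient_le (w.scale r) q
  rw [Disc.coe_scale, norm_mul, Complex.norm_of_nonneg hr0, ← hp] at hp_le
  calc ‖differenceQuotient w b‖
      ≤ r * ‖qr‖ + (1 - r) * ‖(w : ℂ)‖ * (r * ‖pr‖) := by
        rw [hb]
        refine (norm_sub_le _ _).trans_eq ?_
        rw [norm_smul, norm_smul, norm_smul, norm_mul, Complex.norm_of_nonneg hr0,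
          Complex.norm_of_nonneg hr1']
    _ ≤ 1 * ‖q‖ + (1 - r * ‖(w : ℂ)‖) * (1 * ‖p‖) := by
        have hrw := mul_le_of_le_one_right hr0 w.norm_lt_one.le
        gcongr <;> linarith [w.norm_lt_one]
    _ ≤ 2 * ‖q‖ := by linarith

lemma harmonicVariance_comp_scale_le (a : HardySeq) (w : Disc) :
    harmonicVariance w (fun z => hardyFun a (z.scale r)) ≤
      4 * harmonicVariance w (hardyFun a) := by
  obtain ⟨b, hb, -⟩ := exists_hardyFun_eq_comp_scale r a
  have hpos := w.one_sub_norm_sq_pos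
  rw [← funext hb, harmonicVariance_hardyFun, harmonicVariance_hardyFun,
    show (4 : ENNReal) = ENNReal.ofReal (2 ^ 2) by norm_num, ← ENNReal.ofReal_mul (by positivity)]
  refine ENNReal.ofReal_le_ofReal ?_
  rw [mul_left_comm, ← mul_pow]
  gcongr
  exact norm_differenceQuotient_comp_scale_le r hb w

end scale

/-! ### The Littlewood–Paley formula -/

/-- The Dirichlet integral of `f` weighted by the Green function with pole `w`. -/
noncomputable def greenEnergy (w : Disc) (f : Disc → ℂ) : ENNReal :=
  ENNReal.ofReal Real.pi⁻¹ *
    ∫⁻ z in Metric.ball (0 : ℂ) 1, ‖deriv (zeroExt f) z‖ₑ ^ 2 * greenKernel w z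

section greenEnergy

lemma measurable_greenKernel : Measurable fun p : Disc × ℂ => greenKernel p.1 p.2 := by
  have hpole : Measurable fun p : Disc × ℂ => (p.1 : ℂ) :=
    measurable_subtype_coe.comp measurable_fst
  refine Measurable.ite (measurableSet_eq_fun measurable_snd hpole) measurable_const ?_
  exact (Real.measurable_log.comp ((measurable_const.sub
    ((Complex.continuous_conj.measurable.comp hpole).mul measurable_snd)).div
      (measurable_snd.sub hpole)).norm).ennreal_ofReal

lemma measurable_enorm_deriv_sq_mul_greenKernel (f : Disc → ℂ) : Measurable fun p : Disc × ℂ =>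
    ‖deriv (zeroExt f) p.2‖ₑ ^ 2 * greenKernel p.1 p.2 :=
  (((measurable_deriv _).comp measurable_snd).enorm.pow_const 2).mul measurable_greenKernel

lemma measurable_greenEnergy (f : Disc → ℂ) : Measurable fun w => greenEnergy w f :=
  (measurable_enorm_deriv_sq_mul_greenKernel f).lintegral_prod_right'.const_mul _

lemma dirichletIntegral_eq_lintegral_greenEnergy (μ : Measure Disc) [SFinite μ] (f : Disc → ℂ) :
    dirichletIntegral μ f = ∫⁻ w, greenEnergy w f ∂μ := by
  unfold dirichletIntegral greenEnergy greenPotential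
  rw [lintegral_const_mul' _ _ (by simp), lintegral_lintegral_swap
    (measurable_enorm_deriv_sq_mul_greenKernel f).aemeasurable]
  congr 1
  exact lintegral_congr fun z => (lintegral_const_mul' _ _ (by simp)).symm

end greenEnergy

section ConformalInvariance

variable {f : Disc → ℂ} (w z : Disc)

lemma greenKernel_mobius : greenKernel w (mobius w z) = greenKernel 0 z := by
  have hinv : Function.Involutive (mobius w) := mobius_mobius w
  have hpole : (mobius w z : ℂ) = w ↔ (z : ℂ) = ((0 : Disc) : ℂ) := by
    rw [Subtype.coe_inj, Subtype.coe_inj, ← hinv.injective.eq_iff (a := z), mobius_zero]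
  by_cases hz : (z : ℂ) = ((0 : Disc) : ℂ)
  · rw [greenKernel, greenKernel, if_pos (hpole.2 hz), if_pos hz]
  · have hquot : (1 - conj (w : ℂ) * mobius w z) / (mobius w z - w) = -(z : ℂ)⁻¹ := by
      nth_rw 3 [← mobius_mobius w z]
      rw [coe_mobius w (mobius w z), inv_div, ← neg_sub (w : ℂ) (mobius w z : ℂ), div_neg]
    rw [greenKernel, greenKernel, if_neg (hpole.not.2 hz), if_neg hz, hquot]
    simp

lemma hasDerivAt_zeroExt (hf : IsHolo f) :
    HasDerivAt (zeroExt f) (deriv (zeroExt f) z) z :=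
  (DifferentiableOn.differentiableAt hf (Metric.isOpen_ball.mem_nhds z.2)).hasDerivAt

lemma isHolo_mobius : IsHolo fun u => (mobius w u : ℂ) :=
  isHolo_of_differentiableOn (differentiableOn_mobius w) fun _ => rfl

lemma deriv_comp_mobius (hf : IsHolo f) :
    deriv (zeroExt fun u => f (mobius w u)) z =
      deriv (zeroExt f) (mobius w z) * deriv (zeroExt fun u => (mobius w u : ℂ)) z := by
  have hcomp : zeroExt (fun u => f (mobius w u)) =ᶠ[𝓝 (z : ℂ)]
      fun u => zeroExt f (zeroExt (fun u => (mobius w u : ℂ)) u) := by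
    filter_upwards [Metric.isOpen_ball.mem_nhds z.2] with u hu
    rw [zeroExt_of_mem _ hu, zeroExt_of_mem _ hu, zeroExt_coe]
  have hderiv := hasDerivAt_zeroExt (mobius w z) hf
  rw [← zeroExt_coe (fun u => (mobius w u : ℂ)) z] at hderiv ⊢
  rw [hcomp.deriv_eq]
  exact (hderiv.comp (z : ℂ) (hasDerivAt_zeroExt z (isHolo_mobius w))).deriv

lemma det_restrictScalars_toSpanSingleton (c : ℂ) :
    ((ContinuousLinearMap.toSpanSingleton ℂ c).restrictScalars ℝ).det = ‖c‖ ^ 2 := by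
  simp [ContinuousLinearMap.det, LinearMap.det_restrictScalars, Algebra.norm_complex_eq,
    Complex.normSq_eq_norm_sq]

lemma bijOn_zeroExt_mobius :
    Set.BijOn (zeroExt fun u => (mobius w u : ℂ)) (Metric.ball 0 1) (Metric.ball 0 1) := by
  have hmaps : Set.MapsTo (zeroExt fun u => (mobius w u : ℂ)) (Metric.ball 0 1)
      (Metric.ball 0 1) := fun z hz => by
    rw [zeroExt_of_mem _ hz]
    exact (mobius w _).2
  have hinv : Set.LeftInvOn (zeroExt fun u => (mobius w u : ℂ))
      (zeroExt fun u => (mobius w u : ℂ)) (Metric.ball 0 1) := fun z hz => by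
    rw [zeroExt_of_mem _ hz, zeroExt_coe, mobius_mobius]
  exact Set.InvOn.bijOn ⟨hinv, hinv⟩ hmaps hmaps

lemma setLIntegral_ball_eq_comp_mobius (F : ℂ → ENNReal) :
    ∫⁻ z in Metric.ball (0 : ℂ) 1, F z =
      ∫⁻ z in Metric.ball (0 : ℂ) 1, ‖deriv (zeroExt fun u => (mobius w u : ℂ)) z‖ₑ ^ 2 *
        F (zeroExt (fun u => (mobius w u : ℂ)) z) := by
  have hbij := bijOn_zeroExt_mobius w
  have hderiv : ∀ z ∈ Metric.ball (0 : ℂ) 1, HasFDerivWithinAt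
      (zeroExt fun u => (mobius w u : ℂ)) ((ContinuousLinearMap.toSpanSingleton ℂ
        (deriv (zeroExt fun u => (mobius w u : ℂ)) z)).restrictScalars ℝ) (Metric.ball 0 1) z :=
    fun z hz => ((hasDerivAt_zeroExt ⟨z, hz⟩ (isHolo_mobius w)).hasFDerivAt.restrictScalars
      ℝ).hasFDerivWithinAt
  have hchange := lintegral_image_eq_lintegral_abs_det_fderiv_mul volume
    Metric.isOpen_ball.measurableSet hderiv hbij.injOn F
  simpa only [hbij.image_eq, det_restrictScalars_toSpanSingleton, abs_of_nonneg (sq_nonneg ‖_‖),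
    ← enorm_sq_eq_ofReal] using hchange

lemma greenEnergy_comp_mobius (hf : IsHolo f) :
    greenEnergy 0 (fun z => f (mobius w z)) = greenEnergy w f := by
  rw [greenEnergy, greenEnergy, setLIntegral_ball_eq_comp_mobius w fun z =>
    ‖deriv (zeroExt f) z‖ₑ ^ 2 * greenKernel w z]
  congr 1
  refine setLIntegral_congr_fun Metric.isOpen_ball.measurableSet fun z hz => ?_
  have hderiv := deriv_comp_mobius w ⟨z, hz⟩ hf
  have hkernel := greenKernel_mobius w ⟨z, hz⟩
  simp only [zeroExt_of_mem _ hz] at hderiv hkernel ⊢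
  rw [hderiv, ← hkernel, enorm_mul, mul_pow]
  ring

end ConformalInvariance

section LittlewoodPaley

lemma hasDerivAt_pow_mul_log (n : ℕ) {r : ℝ} (hr : r ≠ 0) :
    HasDerivAt (fun r : ℝ => r ^ (n + 1) / (n + 1) ^ 2 - r ^ n * (r * Real.log r) / (n + 1))
      (r ^ n * -Real.log r) r := by
  have hpow := hasDerivAt_pow (n + 1) r
  have hsub := (hpow.div_const ((n + 1 : ℝ) ^ 2)).sub
    ((hpow.mul (Real.hasDerivAt_log hr)).div_const (n + 1 : ℝ))
  refine (hsub.congr_deriv ?_).congr_of_eventuallyEq (Eventually.of_forall fun r => ?_)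
  · push_cast
    field_simp
    ring
  · simp only [Pi.sub_apply, Pi.mul_apply]
    ring

lemma lintegral_pow_mul_neg_log (n : ℕ) :
    ∫⁻ r in Set.Ioo (0 : ℝ) 1, ENNReal.ofReal (r ^ n * -Real.log r) =
      ENNReal.ofReal (((n + 1 : ℝ) ^ 2)⁻¹) := by
  set H : ℝ → ℝ := fun r => r ^ (n + 1) / (n + 1) ^ 2 - r ^ n * (r * Real.log r) / (n + 1)
    with hH
  have hcont : Continuous H := by
    have := Real.continuous_mul_log
    fun_prop
  have hderiv : ∀ r ∈ Set.Ioo (0 : ℝ) 1, HasDerivAt H (r ^ n * -Real.log r) r := fun r hr =>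
    hasDerivAt_pow_mul_log n hr.1.ne'
  have hpos : ∀ r ∈ Set.Ioo (0 : ℝ) 1, 0 ≤ r ^ n * -Real.log r := fun r hr =>
    mul_nonneg (pow_nonneg hr.1.le n) (neg_nonneg.2 (Real.log_nonpos hr.1.le hr.2.le))
  have hint := intervalIntegral.integrableOn_deriv_of_nonneg hcont.continuousOn hderiv hpos
  have hFTC := intervalIntegral.integral_eq_sub_of_hasDerivAt_of_le zero_le_one hcont.continuousOn
    hderiv ((intervalIntegrable_iff_integrableOn_Ioc_of_le zero_le_one).2 hint)
  rw [intervalIntegral.integral_of_le zero_le_one, integral_Ioc_eq_integral_Ioo] at hFTC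
  rw [← ofReal_integral_eq_lintegral_ofReal (hint.mono_set Set.Ioo_subset_Ioc_self), hFTC]
  · simp [hH]
  · exact (ae_restrict_mem measurableSet_Ioo).mono hpos

lemma lintegral_Ioo_neg_pi_pi {F : ℝ → ENNReal} (hF : Function.Periodic F (2 * Real.pi)) :
    ∫⁻ θ in Set.Ioo (-Real.pi) Real.pi, F θ = ∫⁻ θ in Set.Ioc 0 (2 * Real.pi), F θ := by
  have h := (isAddFundamentalDomain_Ioc Real.two_pi_pos (-Real.pi)).setLIntegral_eq
    (isAddFundamentalDomain_Ioc Real.two_pi_pos 0) F hF.map_vadd_zmultiples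
  rwa [zero_add, show -Real.pi + 2 * Real.pi = Real.pi by ring, ← restrict_Ioo_eq_restrict_Ioc] at h

lemma periodic_exp_ofReal_mul_I :
    Function.Periodic (fun θ : ℝ => Complex.exp (θ * Complex.I)) (2 * Real.pi) := fun θ => by
  simp only [Complex.ofReal_add, Complex.ofReal_mul, Complex.ofReal_ofNat, add_mul]
  exact Complex.exp_periodic _

lemma lintegral_Ioo_enorm_zeroExt_sq (f : Disc → ℂ) (r : ℝ) :
    ∫⁻ θ in Set.Ioo (-Real.pi) Real.pi, ‖zeroExt f (r * Complex.exp (θ * Complex.I))‖ₑ ^ 2 =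
      ENNReal.ofReal (2 * Real.pi) * meanSq f r := by
  have hF := periodic_exp_ofReal_mul_I.comp fun u => ‖zeroExt f (r * u)‖ₑ ^ 2
  rw [meanSq, ← mul_assoc, ← ENNReal.ofReal_mul Real.two_pi_pos.le,
    mul_inv_cancel₀ Real.two_pi_pos.ne', ENNReal.ofReal_one, one_mul]
  exact lintegral_Ioo_neg_pi_pi hF

lemma lintegral_ball_eq_polar {F : ℂ → ENNReal} (hF : Measurable F) :
    ∫⁻ z in Metric.ball (0 : ℂ) 1, F z = ∫⁻ r in Set.Ioo (0 : ℝ) 1, ENNReal.ofReal r *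
      ∫⁻ θ in Set.Ioo (-Real.pi) Real.pi, F (r * Complex.exp (θ * Complex.I)) := by
  have hpolar : ∀ p : ℝ × ℝ,
      Complex.polarCoord.symm p = p.1 * Complex.exp (p.2 * Complex.I) := fun p => by
    rw [Complex.polarCoord_symm_apply, Complex.exp_mul_I, Complex.ofReal_cos, Complex.ofReal_sin]
  have hmeas : Measurable fun p : ℝ × ℝ => ENNReal.ofReal p.1 *
      (Metric.ball (0 : ℂ) 1).indicator F (p.1 * Complex.exp (p.2 * Complex.I)) :=
    measurable_fst.ennreal_ofReal.mul
      ((hF.indicator Metric.isOpen_ball.measurableSet).comp (Continuous.measurable (by fun_prop)))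
  have hmem : ∀ r ∈ Set.Ioi (0 : ℝ), ∀ θ : ℝ,
      (r : ℂ) * Complex.exp (θ * Complex.I) ∈ Metric.ball (0 : ℂ) 1 ↔ r ∈ Set.Iio 1 :=
    fun r hr θ => by
      rw [mem_ball_zero_iff, norm_mul, Complex.norm_exp_ofReal_mul_I, mul_one,
        Complex.norm_of_nonneg (le_of_lt hr), Set.mem_Iio]
  have hIoo : Set.Ioo (0 : ℝ) 1 = Set.Iio 1 ∩ Set.Ioi 0 := by
    rw [Set.inter_comm, Set.Ioi_inter_Iio]
  rw [← lintegral_indicator Metric.isOpen_ball.measurableSet,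
    ← Complex.lintegral_comp_polarCoord_symm]
  simp_rw [hpolar, smul_eq_mul]
  rw [polarCoord_target, Measure.volume_eq_prod, ← Measure.prod_restrict,
    lintegral_prod _ hmeas.aemeasurable, hIoo,
    ← Measure.restrict_restrict measurableSet_Iio, ← lintegral_indicator measurableSet_Iio]
  refine setLIntegral_congr_fun measurableSet_Ioi fun r hr => ?_
  by_cases h1 : r ∈ Set.Iio 1
  · simp only [Set.indicator_of_mem h1, Set.indicator_of_mem ((hmem r hr _).2 h1)]
    exact lintegral_const_mul' _ _ ENNReal.ofReal_ne_top
  · simp only [Set.indicator_of_notMem h1, Set.indicator_of_notMem ((hmem r hr _).not.2 h1),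
      mul_zero, lintegral_zero]

lemma greenKernel_zero_polar {r : ℝ} (h0 : 0 < r) (θ : ℝ) :
    greenKernel 0 (r * Complex.exp (θ * Complex.I)) = ENNReal.ofReal (-Real.log r) := by
  have hne : (r : ℂ) * Complex.exp (θ * Complex.I) ≠ ((0 : Disc) : ℂ) :=
    mul_ne_zero (Complex.ofReal_ne_zero.2 h0.ne') (Complex.exp_ne_zero _)
  rw [greenKernel, if_neg hne]
  simp [Complex.norm_exp_ofReal_mul_I, abs_of_pos h0]

lemma HasPowerSeries.deriv_zeroExt {f : Disc → ℂ} {c : ℕ → ℂ} (hc : HasPowerSeries f c) :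
    HasPowerSeries (fun z => deriv (zeroExt f) z) fun n => (n + 1) * c (n + 1) := fun z => by
  have htaylor := Complex.hasSum_taylorSeries_on_ball
    (DifferentiableOn.deriv hc.isHolo Metric.isOpen_ball) z.2
  simp only [sub_zero, smul_eq_mul, ← iteratedDeriv_succ'] at htaylor
  have hcoeff : ∀ n : ℕ, (n.factorial : ℂ)⁻¹ * ((z : ℂ) ^ n * iteratedDeriv (n + 1) (zeroExt f) 0) =
      (n + 1) * c (n + 1) * (z : ℂ) ^ n := fun n => by
    have hn : (n : ℂ) + 1 ≠ 0 := Nat.cast_add_one_ne_zero n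
    rw [hc.unique hc.isHolo.hasPowerSeries]
    simp only [Nat.factorial_succ]
    push_cast
    field_simp
  simpa only [hcoeff] using htaylor

lemma greenEnergy_zero_eq_lintegral_meanSq (f : Disc → ℂ) :
    greenEnergy 0 f = 2 * ∫⁻ r in Set.Ioo (0 : ℝ) 1,
      ENNReal.ofReal (r * -Real.log r) * meanSq (fun z => deriv (zeroExt f) z) r := by
  have hkernel : Measurable fun z => greenKernel 0 z :=
    measurable_greenKernel.comp (measurable_prodMk_left (x := (0 : Disc)))
  have hmeas : Measurable fun z => ‖deriv (zeroExt f) z‖ₑ ^ 2 * greenKernel 0 z :=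
    ((measurable_deriv _).enorm.pow_const 2).mul hkernel
  rw [greenEnergy, lintegral_ball_eq_polar hmeas,
    ← lintegral_const_mul' _ _ ENNReal.ofReal_ne_top, ← lintegral_const_mul' _ _ (by simp)]
  refine setLIntegral_congr_fun measurableSet_Ioo fun r hr => ?_
  have hcircle : ∀ θ : ℝ, deriv (zeroExt f) (r * Complex.exp (θ * Complex.I)) =
      zeroExt (fun z => deriv (zeroExt f) z) (r * Complex.exp (θ * Complex.I)) := fun θ => by
    rw [zeroExt_of_mem _ (circle_mem_ball hr.1.le hr.2 θ)]
  have hconst : ENNReal.ofReal Real.pi⁻¹ * ENNReal.ofReal (2 * Real.pi) = 2 := by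
    rw [← ENNReal.ofReal_mul (by positivity), mul_left_comm, inv_mul_cancel₀ Real.pi_ne_zero]
    simp
  simp only [greenKernel_zero_polar hr.1, hcircle]
  rw [lintegral_mul_const' _ _ ENNReal.ofReal_ne_top, lintegral_Ioo_enorm_zeroExt_sq, ← hconst,
    ENNReal.ofReal_mul hr.1.le]
  ring

lemma two_mul_enorm_succ_mul_sq (n : ℕ) (c : ℂ) :
    2 * (‖((n : ℂ) + 1) * c‖ₑ ^ 2 * ENNReal.ofReal ((((2 * n + 1 : ℕ) + 1 : ℝ) ^ 2)⁻¹)) =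
      2⁻¹ * ‖c‖ₑ ^ 2 := by
  have hn : ‖(n : ℂ) + 1‖ = n + 1 := by exact_mod_cast Complex.norm_natCast (n + 1)
  have htwo : (2 : ENNReal) = ENNReal.ofReal 2 := by simp
  rw [htwo, ← ENNReal.ofReal_inv_of_pos two_pos, enorm_sq_eq_ofReal, enorm_sq_eq_ofReal, norm_mul,
    hn, ← ENNReal.ofReal_mul (by positivity), ← ENNReal.ofReal_mul (by positivity),
    ← ENNReal.ofReal_mul (by positivity)]
  push_cast
  congr 1
  field_simp
  ring

lemma greenEnergy_zero {f : Disc → ℂ} (hf : IsHolo f) :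
    greenEnergy 0 f = 2⁻¹ * hardyNormSq (fun z => f z - f 0) := by
  have hc := hf.hasPowerSeries
  set c := fun n : ℕ => (n.factorial : ℂ)⁻¹ * iteratedDeriv n (zeroExt f) 0
  have hterm : ∀ n : ℕ, Measurable fun r : ℝ => ENNReal.ofReal (r ^ (2 * n + 1) * -Real.log r) :=
    fun n => ((measurable_id.pow_const _).mul Real.measurable_log.neg).ennreal_ofReal
  calc greenEnergy 0 f
      = 2 * ∫⁻ r in Set.Ioo (0 : ℝ) 1, ∑' n : ℕ, ‖((n : ℂ) + 1) * c (n + 1)‖ₑ ^ 2 *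
          ENNReal.ofReal (r ^ (2 * n + 1) * -Real.log r) := by
        rw [greenEnergy_zero_eq_lintegral_meanSq]
        congr 1
        refine setLIntegral_congr_fun measurableSet_Ioo fun r hr => ?_
        have hr0 := hr.1.le
        simp only [hc.deriv_zeroExt.meanSq_eq_tsum hr0 hr.2, ← ENNReal.tsum_mul_left]
        refine tsum_congr fun n => ?_
        rw [mul_left_comm, ← ENNReal.ofReal_mul' (by positivity)]
        ring_nf
    _ = ∑' n : ℕ, 2 * (‖((n : ℂ) + 1) * c (n + 1)‖ₑ ^ 2 *
          ENNReal.ofReal ((((2 * n + 1 : ℕ) + 1 : ℝ) ^ 2)⁻¹)) := by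
        rw [lintegral_tsum fun n => ((hterm n).const_mul _).aemeasurable, ENNReal.tsum_mul_left]
        simp only [lintegral_const_mul _ (hterm _), lintegral_pow_mul_neg_log]
    _ = ∑' n : ℕ, 2⁻¹ * ‖c (n + 1)‖ₑ ^ 2 := by
        exact tsum_congr fun n => two_mul_enorm_succ_mul_sq n _
    _ = 2⁻¹ * hardyNormSq (fun z => f z - f 0) := by
        rw [ENNReal.tsum_mul_left, hc.sub_apply_zero.hardyNormSq_eq_tsum,
          tsum_eq_zero_add' (f := fun n => ‖Function.update c 0 0 n‖ₑ ^ 2) ENNReal.summable]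
        simp

lemma greenEnergy_eq_harmonicVariance {f : Disc → ℂ} (hf : IsHolo f) (w : Disc) :
    greenEnergy w f = 2⁻¹ * harmonicVariance w f := by
  rw [← greenEnergy_comp_mobius w hf, greenEnergy_zero (hf.comp_mobius w), mobius_zero,
    harmonicVariance]

end LittlewoodPaley

/-! ### Closure of an invariant subspace under bounded pointwise limits -/

lemma liminf_add_liminf_le (u v : ℕ → ENNReal) :
    liminf u atTop + liminf v atTop ≤ liminf (fun n => u n + v n) atTop := by
  have hmono : ∀ u : ℕ → ENNReal, Monotone fun n => ⨅ i ≥ n, u i := fun u n m hnm =>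
    le_iInf₂ fun i hi => iInf₂_le i (hnm.trans hi)
  simp only [liminf_eq_iSup_iInf_of_nat]
  rw [ENNReal.iSup_add_iSup_of_monotone (hmono u) (hmono v)]
  exact iSup_mono fun n => le_iInf₂ fun i hi => add_le_add (iInf₂_le i hi) (iInf₂_le i hi)

section WeightedDirichletNorm

variable {f g : Disc → ℂ}

lemma IsHolo.measurable_harmonicVariance (hf : IsHolo f) :
    Measurable fun w => harmonicVariance w f := by
  have hgreen : (fun w => harmonicVariance w f) = fun w => 2 * greenEnergy w f := by
    funext w
    rw [greenEnergy_eq_harmonicVariance hf, ← mul_assoc,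
      ENNReal.mul_inv_cancel two_ne_zero ENNReal.ofNat_ne_top, one_mul]
  rw [hgreen]
  exact (measurable_greenEnergy f).const_mul 2

lemma harmonicVariance_parallelogram (hf : IsHolo f) (hg : IsHolo g) (w : Disc) :
    harmonicVariance w (f + g) + harmonicVariance w (f - g) =
      2 * harmonicVariance w f + 2 * harmonicVariance w g := by
  have h := hardyNormSq_parallelogram ((hf.comp_mobius w).sub (isHolo_const (f w)))
    ((hg.comp_mobius w).sub (isHolo_const (g w)))
  simp only [harmonicVariance, Pi.add_apply, Pi.sub_apply, add_sub_add_comm, sub_sub_sub_comm]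
  exact h

lemma harmonicVariance_smul (c : ℂ) (f : Disc → ℂ) (w : Disc) :
    harmonicVariance w (c • f) = ‖c‖ₑ ^ 2 * harmonicVariance w f := by
  rw [harmonicVariance, harmonicVariance, ← hardyNormSq_smul]
  congr 1
  funext z
  simp only [Pi.smul_apply, smul_sub]

lemma harmonicVariance_le_liminf {F : ℕ → Disc → ℂ} (hF : ∀ n, IsHolo (F n))
    (hlim : ∀ z, Tendsto (fun n => F n z) atTop (𝓝 (f z))) (w : Disc) :
    harmonicVariance w f ≤ liminf (fun n => harmonicVariance w (F n)) atTop :=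
  hardyNormSq_le_liminf (fun n => ((hF n).comp_mobius w).sub (isHolo_const (F n w)))
    fun z => (hlim (mobius w z)).sub (hlim w)

lemma mem_dirichletSpace_iff {μ : Measure Disc} :
    f ∈ dirichletSpace μ ↔ IsHolo f ∧ dirichletNormSq μ f < ⊤ := by
  rw [dirichletNormSq, ENNReal.add_lt_top, ← and_assoc]
  rfl

variable (μ : Measure Disc) [SFinite μ]

lemma IsHolo.dirichletIntegral_eq (hf : IsHolo f) :
    dirichletIntegral μ f = 2⁻¹ * ∫⁻ w, harmonicVariance w f ∂μ := by
  simp only [dirichletIntegral_eq_lintegral_greenEnergy, greenEnergy_eq_harmonicVariance hf]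
  exact lintegral_const_mul' _ _ (by simp)

lemma IsHolo.dirichletNormSq_eq (hf : IsHolo f) :
    dirichletNormSq μ f = hardyNormSq f + 2⁻¹ * ∫⁻ w, harmonicVariance w f ∂μ := by
  rw [dirichletNormSq, hf.dirichletIntegral_eq μ]

lemma dirichletNormSq_parallelogram (hf : IsHolo f) (hg : IsHolo g) :
    dirichletNormSq μ (f + g) + dirichletNormSq μ (f - g) =
      2 * dirichletNormSq μ f + 2 * dirichletNormSq μ g := by
  have hvariance : ∫⁻ w, harmonicVariance w (f + g) ∂μ + ∫⁻ w, harmonicVariance w (f - g) ∂μ =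
      2 * ∫⁻ w, harmonicVariance w f ∂μ + 2 * ∫⁻ w, harmonicVariance w g ∂μ := by
    rw [← lintegral_add_left (hf.add hg).measurable_harmonicVariance,
      ← lintegral_const_mul _ hf.measurable_harmonicVariance,
      ← lintegral_const_mul _ hg.measurable_harmonicVariance,
      ← lintegral_add_left (hf.measurable_harmonicVariance.const_mul 2)]
    exact lintegral_congr fun w => harmonicVariance_parallelogram hf hg w
  rw [(hf.add hg).dirichletNormSq_eq μ, (hf.sub hg).dirichletNormSq_eq μ, hf.dirichletNormSq_eq μ,
    hg.dirichletNormSq_eq μ, add_add_add_comm, ← mul_add, hvariance,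
    hardyNormSq_parallelogram hf hg]
  ring

lemma dirichletNormSq_smul (c : ℂ) (hf : IsHolo f) :
    dirichletNormSq μ (c • f) = ‖c‖ₑ ^ 2 * dirichletNormSq μ f := by
  rw [(hf.smul c).dirichletNormSq_eq μ, hf.dirichletNormSq_eq μ, mul_add, mul_left_comm,
    ← lintegral_const_mul _ hf.measurable_harmonicVariance, hardyNormSq_smul]
  simp only [harmonicVariance_smul]

lemma dirichletNormSq_sub_add_midpoint (hf : IsHolo f) (hg : IsHolo g) :
    dirichletNormSq μ (f - g) + 4 * dirichletNormSq μ (midpoint ℝ f g) =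
      2 * dirichletNormSq μ f + 2 * dirichletNormSq μ g := by
  have hsum : f + g = (2 : ℂ) • midpoint ℝ f g := by
    funext z
    rw [← midpoint_add_self ℝ f g, two_smul]
  have hmid : IsHolo (midpoint ℝ f g) := by
    rw [show midpoint ℝ f g = (2⁻¹ : ℂ) • (f + g) by rw [hsum, inv_smul_smul₀ two_ne_zero]]
    exact (hf.add hg).smul _
  have hfour : ‖(2 : ℂ)‖ₑ ^ 2 = 4 := by
    rw [enorm_sq_eq_ofReal, Complex.norm_ofNat]
    norm_num
  rw [← dirichletNormSq_parallelogram μ hf hg, hsum, dirichletNormSq_smul μ 2 hmid, hfour, add_comm]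

lemma dirichletNormSq_le_liminf {F : ℕ → Disc → ℂ} (hF : ∀ n, IsHolo (F n)) (hf : IsHolo f)
    (hlim : ∀ z, Tendsto (fun n => F n z) atTop (𝓝 (f z))) :
    dirichletNormSq μ f ≤ liminf (fun n => dirichletNormSq μ (F n)) atTop := by
  have hvariance : 2⁻¹ * ∫⁻ w, harmonicVariance w f ∂μ ≤
      liminf (fun n => 2⁻¹ * ∫⁻ w, harmonicVariance w (F n) ∂μ) atTop := by
    rw [ENNReal.liminf_const_mul_of_ne_top (by simp)]
    gcongr
    exact (lintegral_mono fun w => harmonicVariance_le_liminf hF hlim w).trans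
      (lintegral_liminf_le fun n => (hF n).measurable_harmonicVariance)
  simp only [hf.dirichletNormSq_eq μ, (hF _).dirichletNormSq_eq μ]
  exact (add_le_add (hardyNormSq_le_liminf hF hlim) hvariance).trans (liminf_add_liminf_le _ _)

lemma dirichletNormSq_le_of_tendsto {F : ℕ → Disc → ℂ} (hF : ∀ n, IsHolo (F n))
    (hf : IsHolo f) (hlim : ∀ z, Tendsto (fun n => F n z) atTop (𝓝 (f z))) {C : ENNReal}
    (hC : ∀ᶠ n in atTop, dirichletNormSq μ (F n) ≤ C) : dirichletNormSq μ f ≤ C :=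
  (dirichletNormSq_le_liminf μ hF hf hlim).trans (liminf_le_of_frequently_le' hC.frequently)

end WeightedDirichletNorm

section ConvexMinimization

variable {E : Type*} [AddCommGroup E] [Module ℝ E] {Φ : E → ENNReal}

/-- The convex hulls of the tails of a sequence. -/
def convexTail (F : ℕ → E) (n : ℕ) : Set E :=
  convexHull ℝ (F '' Set.Ici n)

lemma mem_convexTail (F : ℕ → E) (n : ℕ) : F n ∈ convexTail F n :=
  subset_convexHull ℝ _ (Set.mem_image_of_mem F Set.self_mem_Ici)

lemma antitone_convexTail (F : ℕ → E) : Antitone (convexTail F) := fun _ _ hnm =>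
  convexHull_mono (Set.image_mono (Set.Ici_subset_Ici.2 hnm))

lemma tendsto_of_mem_convexTail {V : Type*} [SeminormedAddCommGroup V] [NormedSpace ℝ V]
    {F h : ℕ → E} (L : E →ₗ[ℝ] V) {c : V} (hF : Tendsto (fun n => L (F n)) atTop (𝓝 c))
    (hh : ∀ n, h n ∈ convexTail F n) : Tendsto (fun n => L (h n)) atTop (𝓝 c) := by
  refine Metric.nhds_basis_ball.tendsto_right_iff.2 fun ε hε => ?_
  obtain ⟨N, hN⟩ := eventually_atTop.1 (hF.eventually (Metric.ball_mem_nhds c hε))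
  filter_upwards [eventually_ge_atTop N] with n hn
  have hball : Convex ℝ (L ⁻¹' Metric.ball c ε) := (convex_ball c ε).linear_preimage L
  refine convexHull_min ?_ hball (hh n)
  rintro _ ⟨k, hk, rfl⟩
  exact hN k (hn.trans hk)

lemma sub_add_le_of_near_infimum {K : Set E} (hK : Convex ℝ K)
    (hΦ : ∀ x ∈ K, ∀ y ∈ K, Φ (x - y) + 4 * Φ (midpoint ℝ x y) ≤ 2 * Φ x + 2 * Φ y)
    {d B : ENNReal} (hd : ∀ x ∈ K, d ≤ Φ x) {x y : E} (hx : x ∈ K) (hy : y ∈ K)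
    (hxB : Φ x ≤ B) (hyB : Φ y ≤ B) : Φ (x - y) + 4 * d ≤ 4 * B :=
  calc Φ (x - y) + 4 * d ≤ Φ (x - y) + 4 * Φ (midpoint ℝ x y) := by
        gcongr
        exact hd _ (hK.midpoint_mem hx hy)
    _ ≤ 2 * Φ x + 2 * Φ y := hΦ x hx y hy
    _ ≤ 2 * B + 2 * B := by gcongr
    _ = 4 * B := by ring

lemma tendsto_four_mul_add_sub_four_mul {d : ℕ → ENNReal} {D : ENNReal} (hD : D ≠ ⊤)
    (hd : Tendsto d atTop (𝓝 D)) :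
    Tendsto (fun N : ℕ => 4 * (D + ((N : ENNReal) + 1)⁻¹) - 4 * d N) atTop (𝓝 0) := by
  have hinv : Tendsto (fun N : ℕ => ((N : ENNReal) + 1)⁻¹) atTop (𝓝 0) := by
    simpa using (tendsto_add_atTop_iff_nat 1).2 ENNReal.tendsto_inv_nat_nhds_zero
  have hupper := ENNReal.Tendsto.const_mul (a := 4) (tendsto_const_nhds (x := D).add hinv)
    (Or.inr ENNReal.ofNat_ne_top)
  have hlower := ENNReal.Tendsto.const_mul (a := 4) hd (Or.inr ENNReal.ofNat_ne_top)
  simpa using ENNReal.Tendsto.sub hupper hlower (Or.inl (by finiteness))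

lemma exists_mem_forall_sub_le {K : ℕ → Set E} (hK : ∀ n, Convex ℝ (K n)) (hanti : Antitone K)
    (hΦ : ∀ x ∈ K 0, ∀ y ∈ K 0, Φ (x - y) + 4 * Φ (midpoint ℝ x y) ≤ 2 * Φ x + 2 * Φ y)
    {C : ENNReal} (hC : C < ⊤) (hbdd : ∀ n, ∃ x ∈ K n, Φ x ≤ C) :
    ∃ (h : ℕ → E) (ε : ℕ → ENNReal), (∀ n, h n ∈ K n) ∧ Tendsto ε atTop (𝓝 0) ∧
      ∀ N n m, N ≤ n → N ≤ m → Φ (h n - h m) ≤ ε N := by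
  let d : ℕ → ENNReal := fun n => ⨅ x ∈ K n, Φ x
  have hd : ∀ n, ∀ x ∈ K n, d n ≤ Φ x := fun n x hx => iInf₂_le x hx
  have hdC : ∀ n, d n ≤ C := fun n =>
    let ⟨x, hx, hxC⟩ := hbdd n
    (hd n x hx).trans hxC
  have hdmono : Monotone d := fun n m hnm => le_iInf₂ fun x hx => hd n x (hanti hnm hx)
  have hnear : ∀ n : ℕ, ∃ x ∈ K n, Φ x ≤ d n + ((n : ENNReal) + 1)⁻¹ := fun n => by
    have hlt : d n < d n + ((n : ENNReal) + 1)⁻¹ :=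
      ENNReal.lt_add_right ((hdC n).trans_lt hC).ne (by simp)
    obtain ⟨x, hx⟩ := iInf_lt_iff.1 hlt
    obtain ⟨hxK, hxlt⟩ := iInf_lt_iff.1 hx
    exact ⟨x, hxK, hxlt.le⟩
  choose h hhK hhd using hnear
  have hD : ⨆ n, d n ≠ ⊤ := ((iSup_le hdC).trans_lt hC).ne
  refine ⟨h, _, hhK, tendsto_four_mul_add_sub_four_mul hD (tendsto_atTop_iSup hdmono),
    fun N n m hn hm => ENNReal.le_sub_of_add_le_right
      (ENNReal.mul_ne_top ENNReal.ofNat_ne_top ((hdC N).trans_lt hC).ne) ?_⟩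
  have hbound : ∀ k, N ≤ k → Φ (h k) ≤ (⨆ n, d n) + ((N : ENNReal) + 1)⁻¹ := fun k hk =>
    (hhd k).trans (add_le_add (le_iSup d k) (by gcongr))
  have hsub := hanti (Nat.zero_le N)
  exact sub_add_le_of_near_infimum (hK N) (fun x hx y hy => hΦ x (hsub hx) y (hsub hy)) (hd N)
    (hanti hn (hhK n)) (hanti hm (hhK m)) (hbound n hn) (hbound m hm)

end ConvexMinimization

lemma IsInvariantSubspace.isHolo {μ : Measure Disc} {M : Submodule ℂ (Disc → ℂ)}
    (hM : IsInvariantSubspace μ M) {f : Disc → ℂ} (hf : f ∈ M) : IsHolo f :=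
  (hM.subset f hf).1.1

-- Mazur's trick: convex combinations of the tails that nearly minimise the norm are Cauchy.
lemma IsInvariantSubspace.mem_of_tendsto {μ : Measure Disc} [SFinite μ]
    {M : Submodule ℂ (Disc → ℂ)} (hM : IsInvariantSubspace μ M) {F : ℕ → Disc → ℂ}
    {f : Disc → ℂ} (hF : ∀ n, F n ∈ M) (hf : IsHolo f)
    (hlim : ∀ z, Tendsto (fun n => F n z) atTop (𝓝 (f z))) {C : ENNReal} (hC : C < ⊤)
    (hbdd : ∀ n, dirichletNormSq μ (F n) ≤ C) : f ∈ M := by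
  have htail : ∀ n, convexTail F n ⊆ M := fun n =>
    convexHull_min (Set.image_subset_iff.2 fun k _ => hF k) (M.restrictScalars ℝ).convex
  obtain ⟨h, ε, hh, hε, hcauchy⟩ := exists_mem_forall_sub_le (Φ := dirichletNormSq μ)
    (fun n => convex_convexHull ℝ _) (antitone_convexTail F)
    (fun x hx y hy => (dirichletNormSq_sub_add_midpoint μ (hM.isHolo (htail 0 hx))
      (hM.isHolo (htail 0 hy))).le) hC fun n => ⟨F n, mem_convexTail F n, hbdd n⟩
  have hholo : ∀ n, IsHolo (h n) := fun n => hM.isHolo (htail n (hh n))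
  have hpointwise : ∀ z, Tendsto (fun n => h n z) atTop (𝓝 (f z)) := fun z =>
    tendsto_of_mem_convexTail (LinearMap.proj (R := ℝ) (φ := fun _ : Disc => ℂ) z) (hlim z) hh
  have hnorm : ∀ n, dirichletNormSq μ (h n - f) ≤ ε n := fun n =>
    dirichletNormSq_le_of_tendsto μ (fun m => (hholo n).sub (hholo m)) ((hholo n).sub hf)
      (fun z => tendsto_const_nhds.sub (hpointwise z))
      ((eventually_ge_atTop n).mono fun m hm => hcauchy n n m le_rfl hm)
  have hfD := dirichletNormSq_le_of_tendsto μ (fun n => hM.isHolo (hF n)) hf hlim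
    (Eventually.of_forall hbdd)
  exact hM.closed h f (fun n => htail n (hh n))
    (mem_dirichletSpace_iff.2 ⟨hf, hfD.trans_lt hC⟩)
    (tendsto_of_tendsto_of_tendsto_of_le_of_le tendsto_const_nhds hε (fun _ => zero_le) hnorm)

/-! ### Bounded multipliers -/

section Multiplication

variable {φ f : Disc → ℂ} {C : ℝ}

lemma hardyNormSq_mul_le (hC : ∀ z, ‖φ z‖ ≤ C) (f : Disc → ℂ) :
    hardyNormSq (φ * f) ≤ ENNReal.ofReal (C ^ 2) * hardyNormSq f := by
  have hC0 : 0 ≤ C := (norm_nonneg _).trans (hC 0)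
  calc hardyNormSq (φ * f) ≤ hardyNormSq ((C : ℂ) • f) := hardyNormSq_mono fun z => by
        rw [Pi.mul_apply, Pi.smul_apply, smul_eq_mul, norm_mul, norm_mul,
          Complex.norm_of_nonneg hC0]
        gcongr
        exact hC z
    _ = ENNReal.ofReal (C ^ 2) * hardyNormSq f := by
        rw [hardyNormSq_smul, enorm_sq_eq_ofReal, Complex.norm_of_nonneg hC0]

lemma harmonicVariance_mul_le (hφ : IsHolo φ) (hf : IsHolo f) (hC : ∀ z, ‖φ z‖ ≤ C) (w : Disc) :
    harmonicVariance w (φ * f) ≤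
      2 * (ENNReal.ofReal (C ^ 2) * harmonicVariance w f) +
        2 * (‖f w‖ₑ ^ 2 * harmonicVariance w φ) := by
  have hsplit : (fun z => (φ * f) (mobius w z) - (φ * f) w) =
      (fun z => φ (mobius w z)) * (fun z => f (mobius w z) - f w) +
        f w • fun z => φ (mobius w z) - φ w := by
    funext z
    simp only [Pi.mul_apply, Pi.add_apply, Pi.smul_apply, smul_eq_mul]
    ring
  have hfw := (hf.comp_mobius w).sub (isHolo_const (f w))
  have hφw := (hφ.comp_mobius w).sub (isHolo_const (φ w))
  rw [harmonicVariance, hsplit]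
  refine (hardyNormSq_add_le ((hφ.comp_mobius w).mul hfw) (hφw.smul _)).trans ?_
  gcongr
  · exact hardyNormSq_mul_le (fun z => hC (mobius w z)) _
  · exact (hardyNormSq_smul _ _).le

lemma enorm_sq_mul_harmonicVariance_le (hφ : IsHolo φ) (hf : IsHolo f) (hC : ∀ z, ‖φ z‖ ≤ C)
    (w : Disc) :
    ‖f w‖ₑ ^ 2 * harmonicVariance w φ ≤
      2 * harmonicVariance w (φ * f) + 2 * (ENNReal.ofReal (C ^ 2) * harmonicVariance w f) := by
  have hsplit : (f w • fun z => φ (mobius w z) - φ w) =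
      (fun z => (φ * f) (mobius w z) - (φ * f) w) -
        (fun z => φ (mobius w z)) * (fun z => f (mobius w z) - f w) := by
    funext z
    simp only [Pi.mul_apply, Pi.sub_apply, Pi.smul_apply, smul_eq_mul]
    ring
  have hfw := (hf.comp_mobius w).sub (isHolo_const (f w))
  have hφfw := ((hφ.mul hf).comp_mobius w).sub (isHolo_const ((φ * f) w))
  rw [harmonicVariance, ← hardyNormSq_smul, hsplit]
  refine (le_add_self.trans_eq
    (hardyNormSq_parallelogram hφfw ((hφ.comp_mobius w).mul hfw))).trans ?_
  gcongr
  · rfl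
  · exact hardyNormSq_mul_le (fun z => hC (mobius w z)) _

-- The boundary term `‖f w‖² * harmonicVariance w φ` survives dilation of `φ`, and it is controlled
-- by the variances of `φ * f` and `f`.
lemma harmonicVariance_comp_scale_mul_le (hφ : IsHolo φ) (hf : IsHolo f) (hC : ∀ z, ‖φ z‖ ≤ C)
    (r : Set.Icc (0 : ℝ) 1) (w : Disc) :
    harmonicVariance w ((fun z => φ (z.scale r)) * f) ≤
      18 * (ENNReal.ofReal (C ^ 2) * harmonicVariance w f) +
        16 * harmonicVariance w (φ * f) := by
  have hscale : harmonicVariance w (fun z => φ (z.scale r)) ≤ 4 * harmonicVariance w φ := by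
    obtain ⟨a, rfl⟩ := exists_hardyFun_eq
      ⟨hφ, (hardyNormSq_le_of_norm_le hC).trans_lt ENNReal.ofReal_lt_top⟩
    exact harmonicVariance_comp_scale_le r a w
  have hmul := harmonicVariance_mul_le (hφ.comp_scale r) hf (fun z => hC (z.scale r)) w
  grw [hscale] at hmul
  have hterm := enorm_sq_mul_harmonicVariance_le hφ hf hC w
  refine hmul.trans ?_
  calc 2 * (ENNReal.ofReal (C ^ 2) * harmonicVariance w f) +
          2 * (‖f w‖ₑ ^ 2 * (4 * harmonicVariance w φ))
      = 2 * (ENNReal.ofReal (C ^ 2) * harmonicVariance w f) +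
          8 * (‖f w‖ₑ ^ 2 * harmonicVariance w φ) := by ring
    _ ≤ 2 * (ENNReal.ofReal (C ^ 2) * harmonicVariance w f) +
          8 * (2 * harmonicVariance w (φ * f) +
            2 * (ENNReal.ofReal (C ^ 2) * harmonicVariance w f)) := by grw [hterm]
    _ = 18 * (ENNReal.ofReal (C ^ 2) * harmonicVariance w f) +
          16 * harmonicVariance w (φ * f) := by ring

lemma harmonicVariance_coe_le (w : Disc) :
    harmonicVariance w (fun z => (z : ℂ)) ≤ ENNReal.ofReal (1 - ‖(w : ℂ)‖ ^ 2) := by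
  have hbound : hardyNormSq (fun z => (mobius w z : ℂ)) ≤ ENNReal.ofReal (1 ^ 2) :=
    hardyNormSq_le_of_norm_le fun z => (mobius w z).norm_lt_one.le
  rw [hardyNormSq_comp_mobius_eq_add isHolo_coe, enorm_sq_eq_ofReal, one_pow, add_comm] at hbound
  rw [ENNReal.ofReal_sub _ (sq_nonneg _)]
  exact ENNReal.le_sub_of_add_le_right ENNReal.ofReal_ne_top hbound

lemma harmonicVariance_le_of_lipschitz {L : ℝ} {w : Disc}
    (hL : ∀ z, ‖φ z - φ w‖ ≤ L * ‖(z : ℂ) - w‖) :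
    harmonicVariance w φ ≤ ENNReal.ofReal (L ^ 2) * ENNReal.ofReal (1 - ‖(w : ℂ)‖ ^ 2) :=
  calc harmonicVariance w φ ≤ hardyNormSq ((L : ℂ) • fun z => (mobius w z : ℂ) - w) :=
        hardyNormSq_mono fun z => by
          rw [Pi.smul_apply, norm_smul, Complex.norm_real, Real.norm_eq_abs]
          exact (hL _).trans (by gcongr; exact le_abs_self L)
    _ = ENNReal.ofReal (L ^ 2) * harmonicVariance w (fun z => (z : ℂ)) := by
        rw [hardyNormSq_smul, enorm_sq_eq_ofReal, Complex.norm_real, Real.norm_eq_abs, sq_abs,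
          harmonicVariance]
    _ ≤ _ := by gcongr; exact harmonicVariance_coe_le w

lemma enorm_hardyFun_sq_mul_harmonicVariance_le {L : ℝ} {w : Disc}
    (hL : ∀ z, ‖φ z - φ w‖ ≤ L * ‖(z : ℂ) - w‖) (a : HardySeq) :
    ‖hardyFun a w‖ₑ ^ 2 * harmonicVariance w φ ≤
      ENNReal.ofReal (L ^ 2) * hardyNormSq (hardyFun a) :=
  calc ‖hardyFun a w‖ₑ ^ 2 * harmonicVariance w φ
      ≤ ‖hardyFun a w‖ₑ ^ 2 *
          (ENNReal.ofReal (L ^ 2) * ENNReal.ofReal (1 - ‖(w : ℂ)‖ ^ 2)) := by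
        gcongr
        exact harmonicVariance_le_of_lipschitz hL
    _ = ENNReal.ofReal (L ^ 2) *
          ENNReal.ofReal ((1 - ‖(w : ℂ)‖ ^ 2) * ‖hardyFun a w‖ ^ 2) := by
        rw [enorm_sq_eq_ofReal, ENNReal.ofReal_mul' (sq_nonneg _)]
        ring
    _ ≤ _ := by
        rw [hardyNormSq_hardyFun]
        gcongr
        exact norm_hardyFun_sq_le a w

end Multiplication

section PowerSeries

variable {c : ℕ → ℂ}

lemma norm_sum_mul_pow_le (hc : Summable fun n => ‖c n‖) (s : Finset ℕ) (z : Disc) :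
    ‖∑ n ∈ s, c n * (z : ℂ) ^ n‖ ≤ ∑' n, ‖c n‖ := by
  refine (norm_sum_le_of_le s fun n _ => ?_).trans (hc.sum_le_tsum s fun n _ => norm_nonneg _)
  rw [norm_mul, norm_pow]
  exact mul_le_of_le_one_right (norm_nonneg _) (pow_le_one₀ (norm_nonneg _) z.norm_lt_one.le)

lemma norm_pow_sub_pow_le (z w : Disc) (n : ℕ) :
    ‖(z : ℂ) ^ n - (w : ℂ) ^ n‖ ≤ n * ‖(z : ℂ) - w‖ := by
  have hball : Convex ℝ (Metric.ball (0 : ℂ) 1) := convex_ball 0 1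
  refine hball.norm_image_sub_le_of_norm_deriv_le (f := fun z : ℂ => z ^ n)
    (fun x _ => by fun_prop) (fun x hx => ?_) w.2 z.2
  rw [deriv_pow_field, norm_mul, norm_pow, Complex.norm_natCast]
  exact mul_le_of_le_one_right n.cast_nonneg
    (pow_le_one₀ (norm_nonneg x) (mem_ball_zero_iff.1 hx).le)

lemma norm_sum_mul_pow_sub_le (hc : Summable fun n => n * ‖c n‖) (s : Finset ℕ) (z w : Disc) :
    ‖∑ n ∈ s, c n * (z : ℂ) ^ n - ∑ n ∈ s, c n * (w : ℂ) ^ n‖ ≤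
      (∑' n, n * ‖c n‖) * ‖(z : ℂ) - w‖ := by
  simp only [← Finset.sum_sub_distrib, ← mul_sub]
  calc ‖∑ n ∈ s, c n * ((z : ℂ) ^ n - (w : ℂ) ^ n)‖
      ≤ ∑ n ∈ s, n * ‖c n‖ * ‖(z : ℂ) - w‖ := norm_sum_le_of_le s fun n _ => by
        rw [norm_mul, mul_comm (n : ℝ), mul_assoc]
        gcongr
        exact norm_pow_sub_pow_le z w n
    _ ≤ _ := by
        rw [← Finset.sum_mul]
        gcongr
        exact hc.sum_le_tsum s fun n _ => by positivity

lemma HasPowerSeries.summable_mul_norm_mul_pow {f : Disc → ℂ} (hc : HasPowerSeries f c) {r : ℝ}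
    (h0 : 0 ≤ r) (h1 : r < 1) : Summable fun n => n * ‖c n * (r : ℂ) ^ n‖ := by
  refine (summable_nat_add_iff 1).1
    (((hc.deriv_zeroExt.summable_norm_mul_pow h0 h1).mul_right r).congr fun n => ?_)
  rw [norm_mul, norm_mul, norm_pow, Complex.norm_of_nonneg h0]
  norm_cast
  ring

end PowerSeries

lemma IsInvariantSubspace.pow_mul_mem {μ : Measure Disc} {M : Submodule ℂ (Disc → ℂ)}
    (hM : IsInvariantSubspace μ M) {f : Disc → ℂ} (hf : f ∈ M) (n : ℕ) :
    (fun z : Disc => (z : ℂ) ^ n * f z) ∈ M := by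
  induction n with
  | zero => simpa using hf
  | succ n ih =>
    convert hM.shift _ ih using 2 with z
    ring

section DirichletBounds

variable {μ : Measure Disc} [SFinite μ] {φ f : Disc → ℂ}

lemma IsHolo.dirichletNormSq_le (hf : IsHolo f) :
    dirichletNormSq μ f ≤ hardyNormSq f + ∫⁻ w, harmonicVariance w f ∂μ := by
  rw [hf.dirichletNormSq_eq μ]
  gcongr
  exact mul_le_of_le_one_left' (by simp)

lemma lintegral_harmonicVariance_lt_top (hf : f ∈ dirichletSpace μ) :
    ∫⁻ w, harmonicVariance w f ∂μ < ⊤ := by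
  have hfin := hf.2
  rw [hf.1.1.dirichletIntegral_eq μ] at hfin
  exact ENNReal.lt_top_of_mul_ne_top_right hfin.ne (by simp)

lemma dirichletNormSq_comp_scale_mul_le (hφ : IsHolo φ) (hf : IsHolo f) {C : ℝ}
    (hC : ∀ z, ‖φ z‖ ≤ C) (r : Set.Icc (0 : ℝ) 1) :
    dirichletNormSq μ ((fun z => φ (z.scale r)) * f) ≤
      ENNReal.ofReal (C ^ 2) * hardyNormSq f +
        (18 * (ENNReal.ofReal (C ^ 2) * ∫⁻ w, harmonicVariance w f ∂μ) +
          16 * ∫⁻ w, harmonicVariance w (φ * f) ∂μ) := by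
  refine ((hφ.comp_scale r).mul hf).dirichletNormSq_le.trans ?_
  gcongr
  · exact hardyNormSq_mul_le (fun z => hC (z.scale r)) f
  · refine (lintegral_mono (harmonicVariance_comp_scale_mul_le hφ hf hC r)).trans_eq ?_
    rw [lintegral_add_left ((hf.measurable_harmonicVariance.const_mul _).const_mul _),
      lintegral_const_mul' _ _ (by simp), lintegral_const_mul' _ _ (by simp),
      lintegral_const_mul' _ _ (by simp)]

lemma dirichletNormSq_mul_le_of_lipschitz (hφ : IsHolo φ) (hf : f ∈ hardySpace) {C L : ℝ}
    (hC : ∀ z, ‖φ z‖ ≤ C) (hL : ∀ z w, ‖φ z - φ w‖ ≤ L * ‖(z : ℂ) - w‖) :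
    dirichletNormSq μ (φ * f) ≤
      ENNReal.ofReal (C ^ 2) * hardyNormSq f +
        (2 * (ENNReal.ofReal (C ^ 2) * ∫⁻ w, harmonicVariance w f ∂μ) +
          2 * (ENNReal.ofReal (L ^ 2) * hardyNormSq f) * μ Set.univ) := by
  obtain ⟨a, rfl⟩ := exists_hardyFun_eq hf
  refine (hφ.mul hf.1).dirichletNormSq_le.trans ?_
  gcongr
  · exact hardyNormSq_mul_le hC _
  · calc ∫⁻ w, harmonicVariance w (φ * hardyFun a) ∂μ
        ≤ ∫⁻ w, (2 * (ENNReal.ofReal (C ^ 2) * harmonicVariance w (hardyFun a)) +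
            2 * (ENNReal.ofReal (L ^ 2) * hardyNormSq (hardyFun a))) ∂μ :=
          lintegral_mono fun w => (harmonicVariance_mul_le hφ hf.1 hC w).trans <| by
            grw [enorm_hardyFun_sq_mul_harmonicVariance_le (fun z => hL z w) a]
      _ = _ := by
        rw [lintegral_add_right _ measurable_const, lintegral_const,
          lintegral_const_mul' _ _ (by simp), lintegral_const_mul' _ _ (by simp)]

lemma dirichletNormSq_le_of_norm_le (hf : IsHolo f) {C : ℝ} (hC : ∀ z, ‖f z‖ ≤ C) :
    dirichletNormSq μ f ≤ ENNReal.ofReal (C ^ 2) * (1 + μ Set.univ) := by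
  rw [mul_add, mul_one]
  refine hf.dirichletNormSq_le.trans (add_le_add (hardyNormSq_le_of_norm_le hC) ?_)
  rw [← lintegral_const]
  exact lintegral_mono fun w => (harmonicVariance_le_hardyNormSq_comp_mobius hf w).trans
    (hardyNormSq_le_of_norm_le fun z => hC (mobius w z))

end DirichletBounds

lemma mem_dirichletSpace_of_norm_le {μ : Measure Disc} [IsFiniteMeasure μ] {f : Disc → ℂ}
    (hf : IsHolo f) {C : ℝ} (hC : ∀ z, ‖f z‖ ≤ C) : f ∈ dirichletSpace μ :=
  mem_dirichletSpace_iff.2 ⟨hf, (dirichletNormSq_le_of_norm_le hf hC).trans_lt (by finiteness)⟩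

/-- Radii increasing to `1`. -/
noncomputable def radius (n : ℕ) : Set.Icc (0 : ℝ) 1 :=
  ⟨1 - 1 / ((n : ℝ) + 1),
    sub_nonneg.2 (by simpa using Nat.one_div_le_one_div (α := ℝ) n.zero_le),
    sub_le_self _ (by positivity)⟩

lemma radius_lt_one (n : ℕ) : (radius n : ℝ) < 1 :=
  sub_lt_self _ Nat.one_div_pos_of_nat

lemma tendsto_radius : Tendsto (fun n => (radius n : ℝ)) atTop (𝓝 1) := by
  simpa [radius] using
    (tendsto_const_nhds (x := (1 : ℝ))).sub (tendsto_one_div_add_atTop_nhds_zero_nat (𝕜 := ℝ))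

lemma tendsto_scale_radius (z : Disc) : Tendsto (fun n => z.scale (radius n)) atTop (𝓝 z) := by
  refine tendsto_subtype_rng.2 ?_
  have hcoe := ((Complex.continuous_ofReal.tendsto 1).comp tendsto_radius).mul_const (z : ℂ)
  simpa [Disc.coe_scale] using hcoe

section InvariantSubspace

variable {μ : Measure Disc} [IsFiniteMeasure μ] {M : Submodule ℂ (Disc → ℂ)} {φ f : Disc → ℂ}

lemma IsInvariantSubspace.mul_mem_of_summable (hM : IsInvariantSubspace μ M) {c : ℕ → ℂ}
    (hφ : HasPowerSeries φ c) (hc : Summable fun n => n * ‖c n‖) (hf : f ∈ M) : φ * f ∈ M := by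
  have hfD := hM.subset f hf
  have hvariance := lintegral_harmonicVariance_lt_top hfD
  have hhardy := hfD.1.2
  have hc' : Summable fun n => ‖c n‖ := (summable_nat_add_iff 1).1 <|
    ((summable_nat_add_iff 1).2 hc).of_nonneg_of_le (fun n => norm_nonneg _) fun n => by
      push_cast
      nlinarith [norm_nonneg (c (n + 1)), n.cast_nonneg (α := ℝ)]
  let p : ℕ → Disc → ℂ := fun N z => ∑ n ∈ Finset.range N, c n * (z : ℂ) ^ n
  have hp : ∀ N, IsHolo (p N) := fun N => isHolo_of_differentiableOn
    (F := fun z => ∑ n ∈ Finset.range N, c n * z ^ n) (by fun_prop) fun _ => rfl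
  have hmem : ∀ N, p N * f ∈ M := fun N => by
    have hsum : p N * f =
        ∑ n ∈ Finset.range N, c n • fun z : Disc => (z : ℂ) ^ n * f z := by
      funext z
      simp only [p, Pi.mul_apply, Finset.sum_apply, Pi.smul_apply, smul_eq_mul, Finset.sum_mul,
        mul_assoc]
    rw [hsum]
    exact M.sum_mem fun n _ => M.smul_mem _ (hM.pow_mul_mem hf n)
  exact hM.mem_of_tendsto hmem (hφ.isHolo.mul hfD.1.1)
    (fun z => (hφ z).tendsto_sum_nat.mul_const (f z)) (by finiteness) fun N =>
      dirichletNormSq_mul_le_of_lipschitz (hp N) hfD.1 (norm_sum_mul_pow_le hc' _)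
        (norm_sum_mul_pow_sub_le hc _)

lemma IsInvariantSubspace.comp_scale_mul_mem (hM : IsInvariantSubspace μ M) (hφ : IsHolo φ)
    {r : Set.Icc (0 : ℝ) 1} (hr : (r : ℝ) < 1) (hf : f ∈ M) :
    (fun z => φ (z.scale r)) * f ∈ M := by
  have hc := hφ.hasPowerSeries
  refine hM.mul_mem_of_summable (fun z => ?_) (hc.summable_mul_norm_mul_pow r.2.1 hr) hf
  simpa only [Disc.coe_scale, mul_pow, mul_assoc] using hc (z.scale r)

lemma IsInvariantSubspace.mul_mem (hM : IsInvariantSubspace μ M) (hφ : IsHolo φ) {C : ℝ}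
    (hC : ∀ z, ‖φ z‖ ≤ C) (hf : f ∈ M) (hφf : φ * f ∈ dirichletSpace μ) : φ * f ∈ M := by
  have hfD := hM.subset f hf
  have hhardy := hfD.1.2
  have hvariance := lintegral_harmonicVariance_lt_top hfD
  have hvariance_mul := lintegral_harmonicVariance_lt_top hφf
  exact hM.mem_of_tendsto (fun n => hM.comp_scale_mul_mem hφ (radius_lt_one n) hf) hφf.1.1
    (fun z => ((hφ.continuous.tendsto z).comp (tendsto_scale_radius z)).mul_const (f z))
    (by finiteness) fun n => dirichletNormSq_comp_scale_mul_le hφ hfD.1.1 hC (radius n)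

end InvariantSubspace

/-! ### Closure of an invariant subspace under limits in the Hardy space -/

section Truncation

/-- A bounded multiplier for which `truncFactor ε a * hardyFun a` is bounded as well; it tends to
`1` as `ε` tends to `0`. -/
noncomputable def truncFactor (ε : ℝ) (a : HardySeq) (z : Disc) : ℂ :=
  (1 + ε * herglotz a z)⁻¹

variable {ε : ℝ} (a : HardySeq) (z : Disc)

lemma herglotz_re_nonneg : 0 ≤ (herglotz a z).re :=
  (sq_nonneg _).trans (norm_hardyFun_sq_le_herglotz_re a z)

lemma one_le_one_add_herglotz_re (hε : 0 ≤ ε) : 1 ≤ (1 + ε * herglotz a z).re := by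
  simpa using mul_nonneg hε (herglotz_re_nonneg a z)

lemma one_add_herglotz_ne_zero (hε : 0 ≤ ε) : 1 + ε * herglotz a z ≠ 0 :=
  Complex.ne_zero_of_re_pos (zero_lt_one.trans_le (one_le_one_add_herglotz_re a z hε))

lemma isHolo_truncFactor (hε : 0 ≤ ε) : IsHolo (truncFactor ε a) :=
  ((isHolo_const 1).add ((isHolo_herglotz a).smul (ε : ℂ))).inv
    fun z => one_add_herglotz_ne_zero a z hε

lemma norm_truncFactor_le_one (hε : 0 ≤ ε) : ‖truncFactor ε a z‖ ≤ 1 := by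
  rw [truncFactor, norm_inv]
  exact inv_le_one_of_one_le₀ ((one_le_one_add_herglotz_re a z hε).trans (Complex.re_le_norm _))

lemma truncFactor_re (hε : 0 ≤ ε) :
    (truncFactor ε a z).re =
      ‖truncFactor ε a z‖ ^ 2 + ε * (‖truncFactor ε a z‖ ^ 2 * (herglotz a z).re) := by
  have hne : Complex.normSq (1 + ε * herglotz a z) ≠ 0 :=
    Complex.normSq_eq_zero.not.2 (one_add_herglotz_ne_zero a z hε)
  rw [truncFactor, Complex.inv_re, norm_inv, inv_pow, ← Complex.normSq_eq_norm_sq]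
  field_simp
  simp only [Complex.add_re, Complex.one_re, Complex.re_ofReal_mul]

lemma norm_truncFactor_mul_sq_le (hε : 0 < ε) :
    ‖(truncFactor ε a * hardyFun a) z‖ ^ 2 ≤ ε⁻¹ := by
  have hre := truncFactor_re a z hε.le
  have hre_le : (truncFactor ε a z).re ≤ 1 :=
    (Complex.re_le_norm _).trans (norm_truncFactor_le_one a z hε.le)
  have hherglotz : ε * (‖truncFactor ε a z‖ ^ 2 * ‖hardyFun a z‖ ^ 2) ≤
      ε * (‖truncFactor ε a z‖ ^ 2 * (herglotz a z).re) := by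
    gcongr
    exact norm_hardyFun_sq_le_herglotz_re a z
  rw [Pi.mul_apply, norm_mul, mul_pow, ← one_div, le_div_iff₀ hε]
  linarith [sq_nonneg ‖truncFactor ε a z‖]

-- Apply `hardyNormSq_le_of_add_le_re` to the majorant `ε⁻¹ * truncFactor ε a`: by
-- `truncFactor_re` its real part is `‖truncFactor‖² * (ε⁻¹ + Re herglotz)`.
lemma hardyNormSq_truncFactor_mul_comp_mobius_le (hε : 0 < ε) (w : Disc) :
    hardyNormSq (fun z => (truncFactor ε a * hardyFun a) (mobius w z)) ≤
      ENNReal.ofReal (‖truncFactor ε a w‖ ^ 2 * (herglotz a w).re) := by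
  have ht := isHolo_truncFactor a hε.le
  have hsqrt : ‖((Real.sqrt ε⁻¹ : ℝ) : ℂ)‖ ^ 2 = ε⁻¹ := by
    rw [Complex.norm_of_nonneg (Real.sqrt_nonneg _), Real.sq_sqrt (by positivity)]
  have hre : ∀ z, ε⁻¹ * (truncFactor ε a z).re =
      ‖truncFactor ε a z‖ ^ 2 * (herglotz a z).re + ε⁻¹ * ‖truncFactor ε a z‖ ^ 2 := fun z => by
    rw [truncFactor_re a z hε.le]
    field_simp
    ring
  have hmajorant : ∀ z, ‖(truncFactor ε a * hardyFun a) z‖ ^ 2 +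
      ‖((Real.sqrt ε⁻¹ : ℝ) : ℂ) * truncFactor ε a z‖ ^ 2 ≤
        (((ε⁻¹ : ℝ) : ℂ) * truncFactor ε a z).re := fun z => by
    rw [Complex.re_ofReal_mul, hre, Pi.mul_apply, norm_mul, norm_mul, mul_pow, mul_pow, hsqrt]
    gcongr
    exact norm_hardyFun_sq_le_herglotz_re a z
  have h := hardyNormSq_le_of_add_le_re ((ht.mul (isHolo_hardyFun a)).comp_mobius w)
    ((ht.comp_mobius w).smul ((Real.sqrt ε⁻¹ : ℝ) : ℂ)) ((ht.comp_mobius w).smul ((ε⁻¹ : ℝ) : ℂ))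
    fun z => hmajorant (mobius w z)
  simp only [Pi.smul_apply, smul_eq_mul, mobius_zero] at h
  rwa [Complex.re_ofReal_mul, hre, norm_mul, mul_pow, hsqrt, add_sub_cancel_right] at h

lemma harmonicVariance_truncFactor_mul_le (hε : 0 < ε) (w : Disc) :
    harmonicVariance w (truncFactor ε a * hardyFun a) ≤ harmonicVariance w (hardyFun a) := by
  have h := hardyNormSq_truncFactor_mul_comp_mobius_le a hε w
  rw [hardyNormSq_comp_mobius_eq_add ((isHolo_truncFactor a hε.le).mul (isHolo_hardyFun a)),
    ENNReal.ofReal_mul (sq_nonneg _), ← hardyNormSq_comp_mobius,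
    hardyNormSq_comp_mobius_eq_add (isHolo_hardyFun a), ← enorm_sq_eq_ofReal, mul_add, ← mul_pow,
    ← enorm_mul, Pi.mul_apply] at h
  calc harmonicVariance w (truncFactor ε a * hardyFun a)
      ≤ ‖truncFactor ε a w‖ₑ ^ 2 * harmonicVariance w (hardyFun a) :=
        (ENNReal.add_le_add_iff_left (by finiteness)).1 h
    _ ≤ harmonicVariance w (hardyFun a) :=
        mul_le_of_le_one_left' (pow_le_one' (by
          simpa only [enorm_one] using enorm_le_iff_norm_le.2
            ((norm_truncFactor_le_one a w hε.le).trans_eq (norm_one (α := ℂ)).symm)) 2)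

lemma dirichletNormSq_truncFactor_mul_le (μ : Measure Disc) [SFinite μ] (hε : 0 < ε) :
    dirichletNormSq μ (truncFactor ε a * hardyFun a) ≤ dirichletNormSq μ (hardyFun a) := by
  rw [((isHolo_truncFactor a hε.le).mul (isHolo_hardyFun a)).dirichletNormSq_eq μ,
    (isHolo_hardyFun a).dirichletNormSq_eq μ]
  gcongr with w
  · refine hardyNormSq_mono fun z => ?_
    rw [Pi.mul_apply, norm_mul]
    exact mul_le_of_le_one_left (norm_nonneg _) (norm_truncFactor_le_one a z hε.le)
  · exact harmonicVariance_truncFactor_mul_le a hε w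

lemma tendsto_truncFactor (hε : 0 ≤ ε) {A : ℕ → HardySeq} (h : Tendsto A atTop (𝓝 a)) :
    Tendsto (fun n => truncFactor ε (A n) z) atTop (𝓝 (truncFactor ε a z)) :=
  (((tendsto_herglotz h z).const_mul (ε : ℂ)).const_add 1).inv₀ (one_add_herglotz_ne_zero a z hε)

lemma tendsto_truncFactor_one :
    Tendsto (fun n : ℕ => truncFactor (1 / ((n : ℝ) + 1)) a z) atTop (𝓝 1) := by
  have hzero : Tendsto (fun n : ℕ => ((1 / ((n : ℝ) + 1) : ℝ) : ℂ)) atTop (𝓝 0) :=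
    (Complex.continuous_ofReal.tendsto' 0 0 Complex.ofReal_zero).comp
      tendsto_one_div_add_atTop_nhds_zero_nat
  simpa [truncFactor] using ((hzero.mul_const (herglotz a z)).const_add 1).inv₀ (by simp)

end Truncation

section HardyLimit

variable {μ : Measure Disc} [IsFiniteMeasure μ] {M : Submodule ℂ (Disc → ℂ)} {A : ℕ → HardySeq}
  {a : HardySeq}

lemma IsInvariantSubspace.truncFactor_mul_mem (hM : IsInvariantSubspace μ M)
    (hA : ∀ n, hardyFun (A n) ∈ M) (hlim : Tendsto A atTop (𝓝 a)) {ε : ℝ} (hε : 0 < ε) :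
    truncFactor ε a * hardyFun a ∈ M := by
  have hbound : ∀ n z, ‖(truncFactor ε (A n) * hardyFun (A n)) z‖ ≤ Real.sqrt ε⁻¹ := fun n z =>
    Real.le_sqrt_of_sq_le (norm_truncFactor_mul_sq_le (A n) z hε)
  have hholo : ∀ b, IsHolo (truncFactor ε b * hardyFun b) := fun b =>
    (isHolo_truncFactor b hε.le).mul (isHolo_hardyFun b)
  exact hM.mem_of_tendsto (F := fun n => truncFactor ε (A n) * hardyFun (A n))
    (fun n => hM.mul_mem (isHolo_truncFactor _ hε.le)
      (fun z => norm_truncFactor_le_one _ z hε.le) (hA n)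
      (mem_dirichletSpace_of_norm_le (hholo _) (hbound n)))
    (hholo a) (fun z => (tendsto_truncFactor a z hε.le hlim).mul (tendsto_hardyFun hlim z))
    (by finiteness) fun n => dirichletNormSq_le_of_norm_le (hholo _) (hbound n)

lemma IsInvariantSubspace.mem_of_tendsto_hardySeq (hM : IsInvariantSubspace μ M)
    (hA : ∀ n, hardyFun (A n) ∈ M) (hlim : Tendsto A atTop (𝓝 a))
    (ha : hardyFun a ∈ dirichletSpace μ) : hardyFun a ∈ M :=
  hM.mem_of_tendsto
    (fun _ => hM.truncFactor_mul_mem hA hlim Nat.one_div_pos_of_nat) (isHolo_hardyFun a)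
    (fun z => by simpa using (tendsto_truncFactor_one a z).mul_const (hardyFun a z))
    (mem_dirichletSpace_iff.1 ha).2
    fun _ => dirichletNormSq_truncFactor_mul_le a μ Nat.one_div_pos_of_nat

end HardyLimit

/-! ### Shift-invariant subspaces of the Hardy space -/

section mulOp

/-- Multiplication by the bounded holomorphic function `hardyFun p`, acting on coefficient
sequences. -/
noncomputable def mulOp (p : HardySeq) {C : ℝ} (hC : ∀ z, ‖hardyFun p z‖ ≤ C) :
    HardySeq →L[ℂ] HardySeq :=
  have hmul := exists_hardyFun_eq_mul (isHolo_hardyFun p) hC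
  LinearMap.mkContinuous
    { toFun := fun a => (hmul a).choose
      map_add' := fun a b => hardyFun_injective <| by
        rw [map_add hardyFun (hmul a).choose, (hmul a).choose_spec.1, (hmul b).choose_spec.1,
          ← mul_add, ← map_add]
        exact (hmul (a + b)).choose_spec.1
      map_smul' := fun c a => hardyFun_injective <| by
        rw [RingHom.id_apply, map_smul hardyFun c (hmul a).choose, (hmul a).choose_spec.1,
          ← mul_smul_comm, ← map_smul]
        exact (hmul (c • a)).choose_spec.1 }
    C fun a => (hmul a).choose_spec.2

variable {p : HardySeq} {C : ℝ} (hC : ∀ z, ‖hardyFun p z‖ ≤ C)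

lemma hardyFun_mulOp (a : HardySeq) : hardyFun (mulOp p hC a) = hardyFun p * hardyFun a :=
  (exists_hardyFun_eq_mul (isHolo_hardyFun p) hC a).choose_spec.1

lemma norm_mulOp_le : ‖mulOp p hC‖ ≤ C :=
  LinearMap.mkContinuous_norm_le _ ((norm_nonneg _).trans (hC 0))
    fun a => (exists_hardyFun_eq_mul (isHolo_hardyFun p) hC a).choose_spec.2

lemma hardyFun_single (n : ℕ) (z : Disc) : hardyFun (lp.single 2 n 1) z = (z : ℂ) ^ n := by
  refine (hasPowerSeries_hardyFun (lp.single 2 n 1) z).unique ?_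
  convert hasSum_single n fun m hm => ?_ using 1
  · simp
  · simp [hm]

lemma hasSum_smul_single (a : HardySeq) :
    HasSum (fun n => a n • (lp.single 2 n 1 : HardySeq)) a := by
  simpa only [← lp.single_smul, smul_eq_mul, mul_one] using lp.hasSum_single ENNReal.ofNat_ne_top a

lemma mulOp_single (n : ℕ) :
    mulOp p hC (lp.single 2 n 1) = (shift.toContinuousLinearMap ^ n) p :=
  hardyFun_injective <| funext fun z => by
    rw [hardyFun_mulOp, hardyFun_shift_pow, Pi.mul_apply, hardyFun_single, mul_comm]

lemma mulOp_mem {N : Submodule ℂ HardySeq} (hN : IsClosed (N : Set HardySeq))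
    (hpN : ∀ n, (shift.toContinuousLinearMap ^ n) p ∈ N) (a : HardySeq) : mulOp p hC a ∈ N := by
  refine hN.mem_of_tendsto ((mulOp p hC).hasSum (hasSum_smul_single a))
    (Eventually.of_forall fun s => N.sum_mem fun n _ => ?_)
  have hsmul := (mulOp p hC).map_smul (a n) (lp.single 2 n 1)
  rw [mulOp_single] at hsmul
  exact hsmul ▸ N.smul_mem _ (hpN n)

lemma norm_shift_pow (n : ℕ) (a : HardySeq) : ‖(shift.toContinuousLinearMap ^ n) a‖ = ‖a‖ := by
  induction n with
  | zero => simp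
  | succ n ih => rw [pow_succ', mul_apply_eq_comp]; exact (shift.norm_map _).trans ih

lemma adjoint_apply_apply_of_norm_eq {𝕜 E F : Type*} [RCLike 𝕜] [NormedAddCommGroup E]
    [InnerProductSpace 𝕜 E] [CompleteSpace E] [NormedAddCommGroup F] [InnerProductSpace 𝕜 F]
    [CompleteSpace F] {T : E →L[𝕜] F} (hT : ‖T‖ ≤ 1) {x : E} (hx : ‖T x‖ = ‖x‖) :
    T.adjoint (T x) = x := by
  have hle : ‖T.adjoint (T x)‖ ≤ ‖x‖ := by
    have h := T.adjoint.le_of_opNorm_le ((LinearIsometryEquiv.norm_map _ T).trans_le hT) (T x)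
    rwa [one_mul, hx] at h
  have hre : RCLike.re (inner 𝕜 (T.adjoint (T x)) x) = ‖x‖ ^ 2 := by
    rw [ContinuousLinearMap.adjoint_inner_left, inner_self_eq_norm_sq, hx]
  have hsub : ‖T.adjoint (T x) - x‖ ^ 2 ≤ 0 := by
    rw [norm_sub_sq (𝕜 := 𝕜), hre]
    nlinarith [norm_nonneg (T.adjoint (T x))]
  simpa [sub_eq_zero] using le_antisymm hsub (sq_nonneg _)

lemma norm_mulOp (hC : ∀ z, ‖hardyFun p z‖ ≤ 1) (hp : ‖p‖ = 1) (a : HardySeq) :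
    ‖mulOp p hC a‖ = ‖a‖ := by
  refine (ContinuousLinearMap.norm_map_iff_adjoint_comp_self _).2 (ContinuousLinearMap.ext fun a =>
    (((mulOp p hC).adjoint ∘L mulOp p hC).hasSum (hasSum_smul_single a)).unique ?_) a
  rw [one_apply_eq_self]
  convert hasSum_smul_single a using 2 with n
  refine (ContinuousLinearMap.map_smul _ (a n) _).trans (congrArg (a n • ·) ?_)
  refine adjoint_apply_apply_of_norm_eq (norm_mulOp_le hC) ?_
  rw [mulOp_single, norm_shift_pow, hp, lp.norm_single (by norm_num), norm_one]

lemma isClosed_range_mulOp (hC : ∀ z, ‖hardyFun p z‖ ≤ 1) (hp : ‖p‖ = 1) :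
    IsClosed (Set.range (mulOp p hC)) :=
  (AddMonoidHomClass.isometry_of_norm _ (norm_mulOp hC hp)).isClosedEmbedding.isClosed_range

end mulOp

section Beurling

/-- The wandering subspace `N ⊖ zN` of a shift-invariant subspace `N`. -/
noncomputable def wanderingSubspace (N : Submodule ℂ HardySeq) : Submodule ℂ HardySeq :=
  N ⊓ (N.map shift.toLinearMap)ᗮ

lemma inner_shift_pow (n : ℕ) (a b : HardySeq) :
    inner ℂ ((shift.toContinuousLinearMap ^ n) a) ((shift.toContinuousLinearMap ^ n) b) =
      inner ℂ a b := by
  induction n with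
  | zero => simp
  | succ n ih =>
    rw [pow_succ', mul_apply_eq_comp, mul_apply_eq_comp]
    exact (shift.inner_map_map _ _).trans ih

lemma eq_zero_of_forall_exists_shift_eq {P : HardySeq → Prop}
    (hP : ∀ a, P a → ∃ b, P b ∧ shift b = a) {a : HardySeq} (ha : P a) : a = 0 := by
  have hcoeff : ∀ n a, P a → a n = 0 := fun n => by
    induction n with
    | zero =>
      intro a ha
      obtain ⟨b, -, rfl⟩ := hP a ha
      exact shift_apply_zero b
    | succ n ih =>
      intro a ha
      obtain ⟨b, hb, rfl⟩ := hP a ha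
      rw [shift_apply_succ]
      exact ih b hb
  exact lp.ext (funext fun n => hcoeff n a ha)

variable {N : Submodule ℂ HardySeq} {a p q : HardySeq}

lemma exists_shift_add_mem_wanderingSubspace (hN : ∀ a ∈ N, shift a ∈ N)
    (hc : IsClosed (N : Set HardySeq)) (ha : a ∈ N) :
    ∃ b ∈ N, ∃ y ∈ wanderingSubspace N, shift b + y = a := by
  have hclosed : IsClosed (N.map shift.toLinearMap : Set HardySeq) := by
    rw [Submodule.map_coe]
    exact shift.isometry.isClosedEmbedding.isClosedMap _ hc
  have : CompleteSpace (N.map shift.toLinearMap) := hclosed.completeSpace_coe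
  obtain ⟨_, ⟨b, hb, rfl⟩, y, hy, rfl⟩ :=
    (N.map shift.toLinearMap).exists_add_mem_mem_orthogonal a
  exact ⟨b, hb, y, ⟨(N.add_mem_iff_right (hN b hb)).1 ha, hy⟩, rfl⟩

lemma exists_mem_wanderingSubspace_norm_eq_one (hN : ∀ a ∈ N, shift a ∈ N)
    (hc : IsClosed (N : Set HardySeq)) (h0 : N ≠ ⊥) : ∃ p ∈ wanderingSubspace N, ‖p‖ = 1 := by
  obtain ⟨y, hy, hy0⟩ : ∃ y ∈ wanderingSubspace N, y ≠ 0 := by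
    by_contra! hzero
    refine h0 ((Submodule.eq_bot_iff _).2 fun a ha =>
      eq_zero_of_forall_exists_shift_eq (P := (· ∈ N)) (fun a ha => ?_) ha)
    obtain ⟨b, hb, y, hy, rfl⟩ := exists_shift_add_mem_wanderingSubspace hN hc ha
    exact ⟨b, hb, by rw [hzero y hy, add_zero]⟩
  exact ⟨_, (wanderingSubspace N).smul_mem _ hy, norm_smul_inv_norm (𝕜 := ℂ) hy0⟩

lemma inner_shift_of_mem_wanderingSubspace (hp : p ∈ wanderingSubspace N) (ha : a ∈ N) :
    inner ℂ (shift a) p = 0 :=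
  hp.2 _ ⟨a, ha, rfl⟩

lemma shift_pow_mem (hN : ∀ a ∈ N, shift a ∈ N) (ha : a ∈ N) (n : ℕ) :
    (shift.toContinuousLinearMap ^ n) a ∈ N := by
  induction n with
  | zero => simpa
  | succ n ih => rw [pow_succ', mul_apply_eq_comp]; exact hN _ ih

lemma inner_shift_pow_of_mem_wanderingSubspace (hN : ∀ a ∈ N, shift a ∈ N)
    (hp : p ∈ wanderingSubspace N) (ha : a ∈ N) {n : ℕ} (hn : n ≠ 0) :
    inner ℂ ((shift.toContinuousLinearMap ^ n) a) p = 0 := by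
  obtain ⟨m, rfl⟩ := Nat.exists_eq_succ_of_ne_zero hn
  rw [pow_succ', mul_apply_eq_comp]
  exact inner_shift_of_mem_wanderingSubspace hp (shift_pow_mem hN ha m)

lemma norm_hardyFun_le_of_mem_wanderingSubspace (hN : ∀ a ∈ N, shift a ∈ N)
    (hp : p ∈ wanderingSubspace N) (z : Disc) : ‖hardyFun p z‖ ≤ ‖p‖ := by
  have hinner : inner ℂ (szegoMul z p) p = (‖p‖ ^ 2 : ℝ) := by
    refine (hasPowerSeries_inner_szegoMul p p z).unique ?_
    convert hasSum_single 0 fun m hm => ?_ using 1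
    · simp [inner_self_eq_norm_sq_to_K]
    · exact mul_eq_zero_of_left (inner_shift_pow_of_mem_wanderingSubspace hN hp hp.1 hm) _
  have hre : (herglotz p z).re = ‖p‖ ^ 2 := by
    rw [herglotz, hinner, two_mul, add_sub_cancel_right, Complex.ofReal_re]
  have hsq := norm_hardyFun_sq_le_herglotz_re p z
  rw [hre] at hsq
  exact le_of_sq_le_sq hsq (norm_nonneg _)

lemma inner_shift_pow_shift_pow_eq_zero (hN : ∀ a ∈ N, shift a ∈ N)
    (hp : p ∈ wanderingSubspace N) (hq : q ∈ wanderingSubspace N) (hpq : inner ℂ p q = 0)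
    (m n : ℕ) : inner ℂ ((shift.toContinuousLinearMap ^ m) p)
      ((shift.toContinuousLinearMap ^ n) q) = 0 := by
  rcases lt_trichotomy m n with h | rfl | h
  · obtain ⟨k, rfl⟩ := Nat.exists_eq_add_of_lt h
    rw [add_assoc, pow_add, mul_apply_eq_comp, inner_shift_pow, inner_eq_zero_symm]
    exact inner_shift_pow_of_mem_wanderingSubspace hN hp hq.1 k.succ_ne_zero
  · rw [inner_shift_pow, hpq]
  · obtain ⟨k, rfl⟩ := Nat.exists_eq_add_of_lt h
    rw [add_assoc, pow_add, mul_apply_eq_comp, inner_shift_pow]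
    exact inner_shift_pow_of_mem_wanderingSubspace hN hq hp.1 k.succ_ne_zero

lemma eq_zero_of_mem_wanderingSubspace_of_inner_eq_zero (hN : ∀ a ∈ N, shift a ∈ N)
    (hp : p ∈ wanderingSubspace N) (hp1 : ‖p‖ = 1) (hq : q ∈ wanderingSubspace N)
    (hpq : inner ℂ p q = 0) : q = 0 := by
  have hpC : ∀ z, ‖hardyFun p z‖ ≤ 1 := fun z =>
    (norm_hardyFun_le_of_mem_wanderingSubspace hN hp z).trans_eq hp1
  have hqC := norm_hardyFun_le_of_mem_wanderingSubspace hN hq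
  have hcomm : mulOp q hqC p = mulOp p hpC q := hardyFun_injective <| by
    rw [hardyFun_mulOp, hardyFun_mulOp, mul_comm]
  have horth : ∀ m, inner ℂ ((shift.toContinuousLinearMap ^ m) p) (mulOp p hpC q) = 0 := fun m =>
    hcomm ▸ Submodule.mem_orthogonal_singleton_iff_inner_right.1
      (mulOp_mem hqC (Submodule.isClosed_orthogonal _) (fun n =>
        Submodule.mem_orthogonal_singleton_iff_inner_right.2
          (inner_shift_pow_shift_pow_eq_zero hN hp hq hpq m n)) p)
  have hself : inner ℂ (mulOp p hpC q) (mulOp p hpC q) = 0 :=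
    Submodule.mem_orthogonal_singleton_iff_inner_left.1
      (mulOp_mem hpC (Submodule.isClosed_orthogonal _) (fun m =>
        Submodule.mem_orthogonal_singleton_iff_inner_left.2 (horth m)) q)
  rwa [inner_self_eq_zero, ← norm_eq_zero, norm_mulOp hpC hp1, norm_eq_zero] at hself

lemma eq_zero_of_forall_inner_shift_pow_eq_zero (hN : ∀ a ∈ N, shift a ∈ N)
    (hc : IsClosed (N : Set HardySeq)) (hp : p ∈ wanderingSubspace N) (hp1 : ‖p‖ = 1)
    (ha : a ∈ N) (h : ∀ n, inner ℂ ((shift.toContinuousLinearMap ^ n) p) a = 0) : a = 0 := by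
  refine eq_zero_of_forall_exists_shift_eq (P := fun a => a ∈ N ∧
    ∀ n, inner ℂ ((shift.toContinuousLinearMap ^ n) p) a = 0) (fun a ha => ?_) ⟨ha, h⟩
  obtain ⟨⟨b, hb, y, hy, rfl⟩, hinner⟩ :=
    ha.imp_left (exists_shift_add_mem_wanderingSubspace hN hc)
  have hpy : inner ℂ p y = 0 := by
    have hpb := inner_eq_zero_symm.1 (inner_shift_of_mem_wanderingSubspace hp hb)
    simpa [inner_add_right, hpb] using hinner 0
  obtain rfl := eq_zero_of_mem_wanderingSubspace_of_inner_eq_zero hN hp hp1 hy hpy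
  rw [add_zero] at hinner ⊢
  refine ⟨b, ⟨hb, fun n => ?_⟩, rfl⟩
  rw [← hinner (n + 1), pow_succ', mul_apply_eq_comp]
  exact (shift.inner_map_map _ _).symm

theorem exists_eq_range_mulOp (hN : ∀ a ∈ N, shift a ∈ N) (hc : IsClosed (N : Set HardySeq))
    (h0 : N ≠ ⊥) : ∃ p, ‖p‖ = 1 ∧ ∃ hC : ∀ z, ‖hardyFun p z‖ ≤ 1,
      (N : Set HardySeq) = Set.range (mulOp p hC) := by
  obtain ⟨p, hp, hp1⟩ := exists_mem_wanderingSubspace_norm_eq_one hN hc h0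
  have hC : ∀ z, ‖hardyFun p z‖ ≤ 1 := fun z =>
    (norm_hardyFun_le_of_mem_wanderingSubspace hN hp z).trans_eq hp1
  have hmem := mulOp_mem hC hc (shift_pow_mem hN hp.1)
  refine ⟨p, hp1, hC, Set.Subset.antisymm (fun a ha => ?_) (Set.range_subset_iff.2 hmem)⟩
  have hclosed : IsClosed (LinearMap.range (mulOp p hC).toLinearMap : Set HardySeq) :=
    isClosed_range_mulOp hC hp1
  have : CompleteSpace (LinearMap.range (mulOp p hC).toLinearMap) := hclosed.completeSpace_coe
  obtain ⟨_, ⟨b, rfl⟩, u, hu, rfl⟩ :=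
    (LinearMap.range (mulOp p hC).toLinearMap).exists_add_mem_mem_orthogonal a
  have hu0 : u = 0 := eq_zero_of_forall_inner_shift_pow_eq_zero hN hc hp hp1
    ((N.add_mem_iff_right (hmem b)).1 ha) fun n => hu _ ⟨_, mulOp_single hC n⟩
  exact ⟨b, by rw [hu0, add_zero]; rfl⟩

end Beurling

/-! ### Radial limits -/

section BoundaryDerivative

/-- The derivative of the Poisson kernel at `r` against the measure `dζ` on the unit circle, up to
the factor `2πi`. It is the Cauchy kernel for the derivative at `r` minus its reflection in the
circle; the reflected term integrates to zero against holomorphic functions and improves the decay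
of the kernel from `|ζ - r| ^ (-2)` to `(1 - r) |ζ - r| ^ (-3)`. -/
noncomputable def derivKernel (r : ℝ) (ζ : ℂ) : ℂ :=
  ((ζ - r) ^ 2)⁻¹ - ((ζ - (r : ℂ)⁻¹) ^ 2)⁻¹

variable {r : ℝ} {ζ : ℂ}

lemma one_sub_le_norm_sub_ofReal (h0 : 0 ≤ r) (hζ : ‖ζ‖ = 1) : 1 - r ≤ ‖ζ - r‖ := by
  simpa only [hζ, Complex.norm_of_nonneg h0] using norm_sub_norm_le ζ (r : ℂ)

lemma norm_sub_ofReal_pos (h0 : 0 ≤ r) (h1 : r < 1) (hζ : ‖ζ‖ = 1) : 0 < ‖ζ - r‖ :=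
  (sub_pos.2 h1).trans_le (one_sub_le_norm_sub_ofReal h0 hζ)

lemma norm_sub_one_le (h0 : 0 ≤ r) (h1 : r < 1) (hζ : ‖ζ‖ = 1) : ‖ζ - 1‖ ≤ 2 * ‖ζ - r‖ := by
  have hr : ‖(r : ℂ) - 1‖ = 1 - r := by
    rw [← Complex.ofReal_one, ← Complex.ofReal_sub, Complex.norm_real, Real.norm_eq_abs,
      abs_sub_comm, abs_of_nonneg (by linarith)]
  linarith [norm_sub_le_norm_sub_add_norm_sub ζ (r : ℂ) 1, one_sub_le_norm_sub_ofReal h0 hζ]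

lemma norm_sub_inv_ofReal (h0 : 0 < r) (hζ : ‖ζ‖ = 1) : ‖ζ - (r : ℂ)⁻¹‖ = ‖ζ - r‖ / r := by
  have hr : (r : ℂ) ≠ 0 := by exact_mod_cast h0.ne'
  have hconj : ζ * conj ζ = 1 := by simp [Complex.mul_conj', hζ]
  have hreflect : ζ - (r : ℂ)⁻¹ = -(ζ * conj (ζ - r)) / r := by
    rw [map_sub, Complex.conj_ofReal, mul_sub, hconj]
    field_simp
    ring
  rw [hreflect, norm_div, norm_neg, norm_mul, hζ, one_mul, Complex.norm_conj,
    Complex.norm_of_nonneg h0.le]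

lemma derivKernel_eq_div (hζ : ζ - r ≠ 0) (hζ' : ζ - (r : ℂ)⁻¹ ≠ 0) :
    derivKernel r ζ = ((r - (r : ℂ)⁻¹) * ((ζ - r) + (ζ - (r : ℂ)⁻¹))) /
      ((ζ - r) ^ 2 * (ζ - (r : ℂ)⁻¹) ^ 2) := by
  rw [derivKernel, inv_sub_inv (pow_ne_zero 2 hζ) (pow_ne_zero 2 hζ')]
  ring

lemma norm_derivKernel_le (h0 : 0 < r) (h1 : r < 1) (hζ : ‖ζ‖ = 1) :
    ‖derivKernel r ζ‖ ≤ 2 * (1 - r ^ 2) / ‖ζ - r‖ ^ 3 := by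
  have hpos := norm_sub_ofReal_pos h0.le h1 hζ
  have hinv := norm_sub_inv_ofReal h0 hζ
  have hdiff : ‖(r : ℂ) - (r : ℂ)⁻¹‖ = (1 - r ^ 2) / r := by
    rw [← Complex.ofReal_inv, ← Complex.ofReal_sub, Complex.norm_real, Real.norm_eq_abs,
      abs_sub_comm, abs_of_nonneg (sub_nonneg.2 (h1.le.trans (one_le_inv_iff₀.2 ⟨h0, h1.le⟩)))]
    field_simp
  have hsum : ‖(ζ - r) + (ζ - (r : ℂ)⁻¹)‖ ≤ ‖ζ - r‖ * (2 / r) :=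
    calc ‖(ζ - r) + (ζ - (r : ℂ)⁻¹)‖ ≤ ‖ζ - r‖ + ‖ζ - r‖ / r := hinv ▸ norm_add_le _ _
      _ ≤ ‖ζ - r‖ / r + ‖ζ - r‖ / r := by gcongr; exact le_div_self hpos.le h0 h1.le
      _ = ‖ζ - r‖ * (2 / r) := by ring
  have hr2 : 0 ≤ 1 - r ^ 2 := by nlinarith
  rw [derivKernel_eq_div (norm_pos_iff.1 hpos)
    (norm_pos_iff.1 (hinv ▸ div_pos hpos h0)), norm_div, norm_mul, norm_mul, norm_pow, norm_pow,
    hinv, hdiff]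
  calc (1 - r ^ 2) / r * ‖(ζ - r) + (ζ - (r : ℂ)⁻¹)‖ / (‖ζ - r‖ ^ 2 * (‖ζ - r‖ / r) ^ 2)
      ≤ (1 - r ^ 2) / r * (‖ζ - r‖ * (2 / r)) / (‖ζ - r‖ ^ 2 * (‖ζ - r‖ / r) ^ 2) := by gcongr
    _ = 2 * (1 - r ^ 2) / ‖ζ - r‖ ^ 3 := by field_simp

lemma ofReal_mem_unitBall (h0 : 0 ≤ r) (h1 : r < 1) : (r : ℂ) ∈ Metric.ball (0 : ℂ) 1 := by
  rwa [mem_ball_zero_iff, Complex.norm_of_nonneg h0]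

lemma integral_poissonKernel (h0 : 0 ≤ r) (h1 : r < 1) :
    ∫ θ in (0 : ℝ)..2 * Real.pi, (1 - r ^ 2) / ‖circleMap 0 1 θ - r‖ ^ 2 = 2 * Real.pi := by
  have hpoisson : (2 * Real.pi)⁻¹ *
      ∫ θ in (0 : ℝ)..2 * Real.pi, (1 - r ^ 2) / ‖circleMap 0 1 θ - r‖ ^ 2 = 1 := by
    simpa [Real.circleAverage, poissonKernel] using
      (InnerProductSpace.harmonicContOnCl_const (c := (1 : ℝ))).circleAverage_poissonKernel_smul
        (ofReal_mem_unitBall h0 h1)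
  exact ((inv_mul_eq_one₀ Real.two_pi_pos.ne').1 hpoisson).symm

section Estimate

variable {E : ℂ → ℂ} {ε C : ℝ}

lemma norm_derivKernel_mul_le (h0 : 0 < r) (h1 : r < 1) (hζ : ‖ζ‖ = 1) (hε : 0 ≤ ε)
    (hC : 0 ≤ C) (hE : ‖E ζ‖ ≤ ε * ‖ζ - 1‖ + C * ‖ζ - 1‖ ^ 3) :
    ‖derivKernel r ζ * E ζ‖ ≤
      4 * ε * ((1 - r ^ 2) / ‖ζ - r‖ ^ 2) + 16 * C * (1 - r ^ 2) := by
  have hpos := norm_sub_ofReal_pos h0.le h1 hζ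
  have hr2 : 0 ≤ 1 - r ^ 2 := by nlinarith
  calc ‖derivKernel r ζ * E ζ‖
      ≤ 2 * (1 - r ^ 2) / ‖ζ - r‖ ^ 3 * (ε * (2 * ‖ζ - r‖) + C * (2 * ‖ζ - r‖) ^ 3) := by
        rw [norm_mul]
        grw [norm_derivKernel_le h0 h1 hζ, hE, norm_sub_one_le h0.le h1 hζ]
    _ = 4 * ε * ((1 - r ^ 2) / ‖ζ - r‖ ^ 2) + 16 * C * (1 - r ^ 2) := by
        field_simp
        ring

lemma norm_circleIntegral_derivKernel_mul_le (h0 : 0 < r) (h1 : r < 1) (hε : 0 ≤ ε) (hC : 0 ≤ C)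
    (hE : ∀ ζ : ℂ, ‖ζ‖ = 1 → ‖E ζ‖ ≤ ε * ‖ζ - 1‖ + C * ‖ζ - 1‖ ^ 3) :
    ‖∮ ζ in C(0, 1), derivKernel r ζ * E ζ‖ ≤ 2 * Real.pi * (4 * ε + 16 * C * (1 - r ^ 2)) := by
  have hnorm : ∀ θ : ℝ, ‖circleMap 0 1 θ‖ = 1 := fun θ => by simp
  have hpoisson : IntervalIntegrable
      (fun θ : ℝ => 4 * ε * ((1 - r ^ 2) / ‖circleMap 0 1 θ - r‖ ^ 2)) volume 0 (2 * Real.pi) :=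
    Continuous.intervalIntegrable (by
      have := fun θ => (norm_sub_ofReal_pos h0.le h1 (hnorm θ)).ne'
      fun_prop (disch := aesop)) _ _
  have hconst : IntervalIntegrable (fun _ : ℝ => 16 * C * (1 - r ^ 2)) volume 0 (2 * Real.pi) :=
    intervalIntegrable_const
  calc ‖∮ ζ in C(0, 1), derivKernel r ζ * E ζ‖
      ≤ ∫ θ in (0 : ℝ)..2 * Real.pi,
          (4 * ε * ((1 - r ^ 2) / ‖circleMap 0 1 θ - r‖ ^ 2) + 16 * C * (1 - r ^ 2)) := by
        refine intervalIntegral.norm_integral_le_of_norm_le Real.two_pi_pos.le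
          (Eventually.of_forall fun θ _ => ?_) (hpoisson.add hconst)
        rw [norm_smul, deriv_circleMap, norm_mul, Complex.norm_I, hnorm, one_mul, one_mul]
        exact norm_derivKernel_mul_le h0 h1 (hnorm θ) hε hC (hE _ (hnorm θ))
    _ = 2 * Real.pi * (4 * ε + 16 * C * (1 - r ^ 2)) := by
        rw [intervalIntegral.integral_add hpoisson hconst, intervalIntegral.integral_const_mul,
          integral_poissonKernel h0.le h1, intervalIntegral.integral_const, smul_eq_mul]
        ring

end Estimate

lemma sub_inv_ofReal_ne_zero (h0 : 0 < r) (h1 : r < 1) (hζ : ‖ζ‖ ≤ 1) : ζ - (r : ℂ)⁻¹ ≠ 0 := by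
  rintro h
  rw [sub_eq_zero.1 h, norm_inv, Complex.norm_of_nonneg h0.le] at hζ
  exact hζ.not_gt ((one_lt_inv₀ h0).2 h1)

lemma diffContOnCl_inv_sub_inv_sq (h0 : 0 < r) (h1 : r < 1) :
    DiffContOnCl ℂ (fun ζ : ℂ => ((ζ - (r : ℂ)⁻¹) ^ 2)⁻¹) (Metric.ball 0 1) :=
  DiffContOnCl.inv (Differentiable.diffContOnCl (by fun_prop)) fun _ hζ =>
    pow_ne_zero 2 (sub_inv_ofReal_ne_zero h0 h1
      (mem_closedBall_zero_iff.1 (Metric.closure_ball_subset_closedBall hζ)))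

lemma circleIntegrable_inv_sub_sq_mul {c w : ℂ} {R : ℝ} {g : ℂ → ℂ}
    (hg : ContinuousOn g (Metric.sphere c R)) (hw : w ∈ Metric.ball c R) :
    CircleIntegrable (fun ζ => ((ζ - w) ^ 2)⁻¹ * g ζ) c R :=
  ContinuousOn.circleIntegrable (Metric.pos_of_mem_ball hw).le <|
    (ContinuousOn.inv₀ (by fun_prop) fun _ hζ =>
      pow_ne_zero 2 (sub_ne_zero.2 (Metric.sphere_disjoint_ball.ne_of_mem hζ hw))).mul hg

lemma diffContOnCl_dslope {c w : ℂ} {R : ℝ} {g : ℂ → ℂ}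
    (hg : DiffContOnCl ℂ g (Metric.ball c R)) (hw : w ∈ Metric.ball c R) :
    DiffContOnCl ℂ (dslope g w) (Metric.ball c R) :=
  have hball := Metric.isOpen_ball.mem_nhds hw
  ⟨(Complex.differentiableOn_dslope hball).2 hg.differentiableOn,
    (continuousOn_dslope (mem_of_superset hball subset_closure)).2
      ⟨hg.continuousOn, hg.differentiableAt Metric.isOpen_ball hw⟩⟩

lemma circleIntegral_inv_sub_sq_mul {c w : ℂ} {R : ℝ} {g : ℂ → ℂ}
    (hg : DiffContOnCl ℂ g (Metric.ball c R)) (hw : w ∈ Metric.ball c R) :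
    ∮ ζ in C(c, R), ((ζ - w) ^ 2)⁻¹ * g ζ = 2 * Real.pi * Complex.I * deriv g w := by
  have hR : 0 ≤ R := (Metric.pos_of_mem_ball hw).le
  have hsphere := hg.continuousOn_ball.mono Metric.sphere_subset_closedBall
  have hconst : ∮ ζ in C(c, R), ((ζ - w) ^ 2)⁻¹ * g w = 0 := by
    have hzpow := circleIntegral.integral_sub_zpow_of_ne (by decide : (-2 : ℤ) ≠ -1) c w R
    simp only [zpow_neg, zpow_ofNat] at hzpow
    simp only [← smul_eq_mul, circleIntegral.integral_smul_const, hzpow, zero_smul]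
  have hslope : Set.EqOn (fun ζ => ((ζ - w) ^ 2)⁻¹ * g ζ - ((ζ - w) ^ 2)⁻¹ * g w)
      (fun ζ => (ζ - w)⁻¹ • dslope g w ζ) (Metric.sphere c R) := fun ζ hζ => by
    have hne : ζ ≠ w := Metric.sphere_disjoint_ball.ne_of_mem hζ hw
    simp only [dslope_of_ne g hne, slope_def_field, smul_eq_mul, sq, mul_inv]
    ring
  calc ∮ ζ in C(c, R), ((ζ - w) ^ 2)⁻¹ * g ζ
      = ∮ ζ in C(c, R), (((ζ - w) ^ 2)⁻¹ * g ζ - ((ζ - w) ^ 2)⁻¹ * g w) := by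
        rw [circleIntegral.integral_sub (circleIntegrable_inv_sub_sq_mul hsphere hw)
          (circleIntegrable_inv_sub_sq_mul continuousOn_const hw), hconst, sub_zero]
    _ = ∮ ζ in C(c, R), (ζ - w)⁻¹ • dslope g w ζ := circleIntegral.integral_congr hR hslope
    _ = 2 * Real.pi * Complex.I * deriv g w := by
        rw [(diffContOnCl_dslope hg hw).circleIntegral_sub_inv_smul hw, dslope_same, smul_eq_mul]

lemma circleIntegral_derivKernel_mul {g : ℂ → ℂ} (hg : DiffContOnCl ℂ g (Metric.ball 0 1))
    (h0 : 0 < r) (h1 : r < 1) :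
    ∮ ζ in C(0, 1), derivKernel r ζ * g ζ = 2 * Real.pi * Complex.I * deriv g r := by
  have hr := ofReal_mem_unitBall h0.le h1
  have hreflect : DiffContOnCl ℂ (fun ζ => ((ζ - (r : ℂ)⁻¹) ^ 2)⁻¹ * g ζ) (Metric.ball 0 1) :=
    (diffContOnCl_inv_sub_inv_sq h0 h1).smul hg
  have hsphere := hg.continuousOn_ball.mono Metric.sphere_subset_closedBall
  simp only [derivKernel, sub_mul]
  rw [circleIntegral.integral_sub
    (circleIntegrable_inv_sub_sq_mul hsphere hr)
    ((hreflect.continuousOn_ball.mono Metric.sphere_subset_closedBall).circleIntegrable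
      zero_le_one),
    hreflect.circleIntegral_eq_zero zero_le_one, circleIntegral_inv_sub_sq_mul hg hr, sub_zero]

lemma exists_norm_sub_le_of_hasDerivWithinAt {s : Set ℂ} (hs : IsCompact s) {g : ℂ → ℂ}
    {a c : ℂ} (hg : ContinuousOn g s) (hd : HasDerivWithinAt g c s a) {ε : ℝ} (hε : 0 < ε) :
    ∃ C, 0 ≤ C ∧ ∀ ζ ∈ s, ‖g ζ - g a - (ζ - a) * c‖ ≤ ε * ‖ζ - a‖ + C * ‖ζ - a‖ ^ 3 := by
  obtain ⟨A, hA⟩ := hs.exists_bound_of_continuousOn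
    (f := fun ζ => g ζ - g a - (ζ - a) * c) (by fun_prop)
  have hnear := (hasDerivWithinAt_iff_isLittleO.1 hd).bound hε
  obtain ⟨δ, hδ, hnear⟩ := Metric.eventually_nhds_iff.1 (eventually_nhdsWithin_iff.1 hnear)
  refine ⟨max A 0 / δ ^ 3, by positivity, fun ζ hζ => ?_⟩
  rcases lt_or_ge (dist ζ a) δ with hlt | hge
  · exact (hnear hlt hζ).trans (le_add_of_nonneg_right (by positivity))
  · rw [dist_eq_norm] at hge
    calc ‖g ζ - g a - (ζ - a) * c‖ ≤ max A 0 / δ ^ 3 * δ ^ 3 := by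
          rw [div_mul_cancel₀ _ (by positivity)]
          exact (hA ζ hζ).trans (le_max_left _ _)
      _ ≤ max A 0 / δ ^ 3 * ‖ζ - a‖ ^ 3 := by gcongr
      _ ≤ ε * ‖ζ - a‖ + max A 0 / δ ^ 3 * ‖ζ - a‖ ^ 3 := le_add_of_nonneg_left (by positivity)

theorem tendsto_deriv_of_hasDerivWithinAt_sphere {g : ℂ → ℂ} {c : ℂ}
    (hg : DiffContOnCl ℂ g (Metric.ball 0 1))
    (hd : HasDerivWithinAt g c (Metric.sphere 0 1) 1) :
    Tendsto (fun r : ℝ => deriv g r) (𝓝[<] 1) (𝓝 c) := by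
  let h : ℂ → ℂ := fun ζ => g ζ - g 1 - (ζ - 1) * c
  have hh : DiffContOnCl ℂ h (Metric.ball 0 1) :=
    (hg.sub_const _).sub (Differentiable.diffContOnCl (by fun_prop))
  have hderiv : ∀ r : ℝ, 0 < r → r < 1 → deriv h r = deriv g r - c := fun r h0 h1 => by
    have hgr := hg.differentiableAt Metric.isOpen_ball (ofReal_mem_unitBall h0.le h1)
    have hline := ((hasDerivAt_id (r : ℂ)).sub_const 1).mul_const c
    rw [one_mul] at hline
    exact ((hgr.hasDerivAt.sub_const (g 1)).sub hline).deriv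
  rw [Metric.tendsto_nhds]
  intro ε hε
  obtain ⟨C, hC, hbound⟩ := exists_norm_sub_le_of_hasDerivWithinAt (isCompact_sphere 0 1)
    (hg.continuousOn_ball.mono Metric.sphere_subset_closedBall) hd
    (show 0 < ε / 8 by positivity)
  have hlim : Tendsto (fun r : ℝ => 4 * (ε / 8) + 16 * C * (1 - r ^ 2)) (𝓝[<] 1)
      (𝓝 (4 * (ε / 8) + 16 * C * (1 - 1 ^ 2))) :=
    (Continuous.tendsto (by fun_prop) 1).mono_left nhdsWithin_le_nhds
  filter_upwards [hlim.eventually_lt_const (show _ < ε by linarith),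
    Ioo_mem_nhdsLT (zero_lt_one (α := ℝ))] with r hr ⟨h0, h1⟩
  have hkernel := norm_circleIntegral_derivKernel_mul_le (E := h) h0 h1 (by positivity) hC
    fun ζ hζ => hbound ζ (mem_sphere_zero_iff_norm.2 hζ)
  rw [circleIntegral_derivKernel_mul hh h0 h1, hderiv r h0 h1, norm_mul,
    show ‖(2 * Real.pi * Complex.I : ℂ)‖ = 2 * Real.pi by simp [Real.pi_pos.le]] at hkernel
  rw [dist_eq_norm]
  exact (le_of_mul_le_mul_left hkernel Real.two_pi_pos).trans_lt hr

end BoundaryDerivative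

section Fatou

lemma hasDerivWithinAt_range_ofReal {H : ℂ → ℂ} {d : ℂ} {x : ℝ}
    (h : HasDerivAt (fun t : ℝ => H t) d x) :
    HasDerivWithinAt H d (Set.range ((↑) : ℝ → ℂ)) x := by
  rw [hasDerivAt_iff_isLittleO] at h
  rw [hasDerivWithinAt_iff_isLittleO, ← Complex.isometry_ofReal.isEmbedding.map_nhds_eq,
    Asymptotics.isLittleO_map, ← Asymptotics.isLittleO_norm_right]
  refine (h.norm_right).congr (fun t => ?_) fun t => ?_
  · simp
  · simp [← Complex.ofReal_sub]

lemma hasDerivWithinAt_sphere_of_hasDerivAt_exp {g : ℂ → ℂ} {d : ℂ}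
    (h : HasDerivAt (fun t : ℝ => g (Complex.exp (t * Complex.I))) d 0) :
    HasDerivWithinAt g (d / Complex.I) (Metric.sphere 0 1) 1 := by
  have hlog : HasDerivWithinAt (fun ζ => Complex.log ζ / Complex.I) (1 / Complex.I)
      (Metric.sphere 0 1) 1 := by
    simpa using ((Complex.hasDerivAt_log Complex.one_mem_slitPlane).div_const
      Complex.I).hasDerivWithinAt
  have hlog_eq : ∀ ζ ∈ Metric.sphere (0 : ℂ) 1, Complex.log ζ / Complex.I = ζ.arg := fun ζ hζ => by
    rw [Complex.log, mem_sphere_zero_iff_norm.1 hζ, Real.log_one, Complex.ofReal_zero, zero_add,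
      mul_div_cancel_right₀ _ Complex.I_ne_zero]
  have hexp : HasDerivWithinAt (fun w => g (Complex.exp (w * Complex.I))) d
      (Set.range ((↑) : ℝ → ℂ)) (Complex.log 1 / Complex.I) := by
    simpa using hasDerivWithinAt_range_ofReal (H := fun w => g (Complex.exp (w * Complex.I))) h
  rw [div_eq_mul_one_div]
  have hmaps : Set.MapsTo (fun ζ => Complex.log ζ / Complex.I) (Metric.sphere 0 1)
      (Set.range ((↑) : ℝ → ℂ)) := fun ζ hζ => ⟨ζ.arg, (hlog_eq ζ hζ).symm⟩
  refine (hexp.comp 1 hlog hmaps).congr (fun ζ hζ => ?_) (by simp)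
  have hne : ζ ≠ 0 := norm_ne_zero_iff.1 (by simp [mem_sphere_zero_iff_norm.1 hζ])
  rw [Function.comp_apply, div_mul_cancel₀ _ Complex.I_ne_zero, Complex.exp_log hne]

lemma IsHolo.exists_lipschitzWith_hasDerivAt {f : Disc → ℂ} (hf : IsHolo f) {C : ℝ}
    (hC : ∀ z, ‖f z‖ ≤ C) :
    ∃ (F : ℂ → ℂ) (K : NNReal), LipschitzWith K F ∧
      ∀ z ∈ Metric.ball (0 : ℂ) 1, HasDerivAt F (zeroExt f z) z := by
  obtain ⟨F, hF⟩ := DifferentiableOn.isExactOn_ball hf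
  have hlip : LipschitzOnWith C.toNNReal F (Metric.ball 0 1) :=
    (convex_ball 0 1).lipschitzOnWith_of_nnnorm_hasDerivWithin_le
      (fun z hz => (hF z hz).hasDerivWithinAt) fun z hz => by
        rw [← NNReal.coe_le_coe, coe_nnnorm, zeroExt_of_mem f hz]
        exact (hC _).trans (Real.le_coe_toNNReal C)
  obtain ⟨G, hG, hFG⟩ := hlip.extend_finite_dimension
  exact ⟨G, _, hG, fun z hz => (hF z hz).congr_of_eventuallyEq
    (hFG.symm.eventuallyEq_of_mem (Metric.isOpen_ball.mem_nhds hz))⟩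

-- A primitive of `f` is Lipschitz, hence differentiable along the circle almost everywhere, and its
-- tangential derivative determines the radial limit of `f`.
theorem IsHolo.ae_exists_tendsto_radial {f : Disc → ℂ} (hf : IsHolo f) {C : ℝ}
    (hC : ∀ z, ‖f z‖ ≤ C) :
    ∀ᵐ θ : ℝ, ∃ ζ : ℂ, Tendsto
      (fun r : ℝ => zeroExt f ((r : ℂ) * Complex.exp ((θ : ℂ) * Complex.I))) (𝓝[<] 1)
        (𝓝 ζ) := by
  obtain ⟨F, K, hF, hderiv⟩ := hf.exists_lipschitzWith_hasDerivAt hC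
  have hlip : LipschitzWith K fun θ : ℝ => F (circleMap 0 1 θ) :=
    mul_one K ▸ hF.comp (by simpa using lipschitzWith_circleMap 0 1)
  filter_upwards [hlip.ae_differentiableAt] with θ hθ
  set e := Complex.exp (θ * Complex.I)
  have hnorm : ‖e‖ = 1 := Complex.norm_exp_ofReal_mul_I θ
  have hrotate : ∀ ζ ∈ Metric.ball (0 : ℂ) 1,
      HasDerivAt (fun ζ => F (e * ζ)) (zeroExt f (e * ζ) * e) ζ := fun ζ hζ => by
    have hmem : e * ζ ∈ Metric.ball (0 : ℂ) 1 := by simpa [hnorm] using hζ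
    exact (hderiv _ hmem).comp ζ (by simpa using (hasDerivAt_id ζ).const_mul e)
  have hboundary : HasDerivAt (fun t : ℝ => F (e * Complex.exp (t * Complex.I)))
      (deriv (fun θ : ℝ => F (circleMap 0 1 θ)) θ) 0 := by
    have hshift : HasDerivAt (fun t : ℝ => F (circleMap 0 1 (θ + t)))
        (deriv (fun θ : ℝ => F (circleMap 0 1 θ)) θ) 0 :=
      HasDerivAt.comp_const_add θ 0 (by simpa only [add_zero] using hθ.hasDerivAt)
    simpa [circleMap, add_mul, Complex.exp_add] using hshift
  have hlim := tendsto_deriv_of_hasDerivWithinAt_sphere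
    ⟨fun ζ hζ => (hrotate ζ hζ).differentiableAt.differentiableWithinAt,
      (hF.continuous.comp (continuous_const_mul e)).continuousOn⟩
    (hasDerivWithinAt_sphere_of_hasDerivAt_exp hboundary)
  refine ⟨_, (hlim.div_const e).congr' ?_⟩
  filter_upwards [Ioo_mem_nhdsLT (zero_lt_one (α := ℝ))] with r hr
  rw [(hrotate r (ofReal_mem_unitBall hr.1.le hr.2)).deriv,
    mul_div_cancel_right₀ _ (Complex.exp_ne_zero _), mul_comm e]

end Fatou

/-! ### Inner functions and greatest common inner divisors -/

section BoundaryValues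

variable {p : HardySeq} {C : ℝ}

lemma tendsto_polarPoint_radius {f : Disc → ℂ} {θ : ℝ} {ζ : ℂ}
    (h : Tendsto (fun r : ℝ => zeroExt f ((r : ℂ) * Complex.exp ((θ : ℂ) * Complex.I)))
      (𝓝[<] 1) (𝓝 ζ)) :
    Tendsto (fun n => f (polarPoint (radius n).2.1 (radius_lt_one n) θ)) atTop (𝓝 ζ) :=
  (h.comp (tendsto_nhdsWithin_iff.2
    ⟨tendsto_radius, Eventually.of_forall radius_lt_one⟩)).congr fun _ => zeroExt_coe f _

lemma tendsto_mean_norm_sq (a : HardySeq) : Tendsto (fun n => (2 * Real.pi)⁻¹ *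
    ∫ θ in Set.Ioc 0 (2 * Real.pi),
      ‖hardyFun a (polarPoint (radius n).2.1 (radius_lt_one n) θ)‖ ^ 2) atTop (𝓝 (‖a‖ ^ 2)) := by
  simp only [← ((hasPowerSeries_hardyFun a).hasSum_norm_sq _ _).tsum_eq]
  rw [← a.hasSum_norm_sq.tsum_eq]
  refine tendsto_tsum_of_dominated_convergence a.hasSum_norm_sq.summable (fun k => ?_)
    (Eventually.of_forall fun n k => ?_)
  · simpa using (tendsto_radius.pow (2 * k)).const_mul (‖a k‖ ^ 2)
  · have h0 := (radius n).2.1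
    rw [Real.norm_of_nonneg (by positivity)]
    exact mul_le_of_le_one_right (sq_nonneg _) (pow_le_one₀ h0 (radius n).2.2)

lemma norm_sq_eq_integral_radial (hC : ∀ z, ‖hardyFun p z‖ ≤ C) {g : ℝ → ℂ}
    (hg : ∀ᵐ θ : ℝ, Tendsto
      (fun r : ℝ => zeroExt (hardyFun p) ((r : ℂ) * Complex.exp ((θ : ℂ) * Complex.I)))
      (𝓝[<] 1) (𝓝 (g θ))) :
    ‖p‖ ^ 2 = (2 * Real.pi)⁻¹ * ∫ θ in Set.Ioc 0 (2 * Real.pi), ‖g θ‖ ^ 2 := by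
  refine tendsto_nhds_unique (tendsto_mean_norm_sq p) (Tendsto.const_mul _
    (tendsto_integral_of_dominated_convergence (fun _ => C ^ 2) (fun n => ?_)
      continuous_const.integrableOn_Ioc (fun n => Eventually.of_forall fun θ => ?_) ?_))
  · exact (((isHolo_hardyFun p).continuous.comp
      (continuous_polarPoint _ _)).norm.pow 2).aestronglyMeasurable
  · rw [norm_pow, norm_norm]
    exact pow_le_pow_left₀ (norm_nonneg _) (hC _) 2
  · filter_upwards [ae_restrict_of_ae hg] with θ hθ
    exact (tendsto_polarPoint_radius hθ).norm.pow 2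

lemma inv_two_pi_mul_integral_one :
    (2 * Real.pi)⁻¹ * ∫ _ in Set.Ioc 0 (2 * Real.pi), (1 : ℝ) = 1 := by
  rw [setIntegral_const, Real.volume_real_Ioc_of_le Real.two_pi_pos.le, sub_zero, smul_eq_mul,
    mul_one, inv_mul_cancel₀ Real.two_pi_pos.ne']

lemma IsInner.norm_eq_one (h : IsInner (hardyFun p)) : ‖p‖ = 1 := by
  obtain ⟨g, hg⟩ := h.radial.choice
  have hg1 : ∀ᵐ θ ∂volume.restrict (Set.Ioc 0 (2 * Real.pi)), ‖g θ‖ ^ 2 = 1 := by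
    filter_upwards [ae_restrict_of_ae hg] with θ hθ
    rw [hθ.1, one_pow]
  have hp := norm_sq_eq_integral_radial h.bound (hg.mono fun θ hθ => hθ.2)
  rw [integral_congr_ae hg1, inv_two_pi_mul_integral_one] at hp
  exact (pow_eq_one_iff_of_nonneg (norm_nonneg p) two_ne_zero).1 hp

lemma ae_norm_radial_eq_one (hp : ‖p‖ = 1) (hC : ∀ z, ‖hardyFun p z‖ ≤ 1) {g : ℝ → ℂ}
    (hg : ∀ᵐ θ : ℝ, Tendsto
      (fun r : ℝ => zeroExt (hardyFun p) ((r : ℂ) * Complex.exp ((θ : ℂ) * Complex.I)))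
      (𝓝[<] 1) (𝓝 (g θ))) :
    ∀ᵐ θ ∂volume.restrict (Set.Ioc 0 (2 * Real.pi)), ‖g θ‖ = 1 := by
  have hlim := (ae_restrict_of_ae (s := Set.Ioc 0 (2 * Real.pi)) hg).mono
    fun θ hθ => tendsto_polarPoint_radius hθ
  have hle : ∀ᵐ θ ∂volume.restrict (Set.Ioc 0 (2 * Real.pi)), ‖g θ‖ ^ 2 ≤ 1 := hlim.mono
    fun θ hθ => pow_le_one₀ (norm_nonneg _) (le_of_tendsto' hθ.norm fun n => hC _)
  have hmeas : AEStronglyMeasurable g (volume.restrict (Set.Ioc 0 (2 * Real.pi))) :=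
    aestronglyMeasurable_of_tendsto_ae atTop (fun n => ((isHolo_hardyFun p).continuous.comp
      (continuous_polarPoint (radius n).2.1 (radius_lt_one n))).aestronglyMeasurable) hlim
  have hone : IntegrableOn (fun _ => (1 : ℝ)) (Set.Ioc 0 (2 * Real.pi)) :=
    continuous_const.integrableOn_Ioc
  have hint : IntegrableOn (fun θ => ‖g θ‖ ^ 2) (Set.Ioc 0 (2 * Real.pi)) :=
    hone.mono' (hmeas.norm.pow 2) (hle.mono fun θ hθ => by
      rwa [Real.norm_of_nonneg (sq_nonneg _)])
  have hmean : ∫ θ in Set.Ioc 0 (2 * Real.pi), ‖g θ‖ ^ 2 =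
      ∫ _ in Set.Ioc 0 (2 * Real.pi), (1 : ℝ) := by
    refine mul_left_cancel₀ (inv_ne_zero Real.two_pi_pos.ne') ?_
    rw [← norm_sq_eq_integral_radial hC hg, hp, one_pow, inv_two_pi_mul_integral_one]
  filter_upwards [(integral_eq_iff_of_ae_le hint hone hle).1 hmean] with θ hθ
  exact (pow_eq_one_iff_of_nonneg (norm_nonneg _) two_ne_zero).1 hθ

lemma ae_of_periodic {Q : ℝ → Prop} {T : ℝ} (hQ : Function.Periodic Q T) (hT : 0 < T)
    (h : ∀ᵐ x ∂volume.restrict (Set.Ioc 0 T), Q x) : ∀ᵐ x : ℝ, Q x := by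
  rw [ae_restrict_iff' measurableSet_Ioc] at h
  have htranslate : ∀ᵐ x : ℝ, ∀ m : ℤ, x + m • T ∈ Set.Ioc 0 T → Q (x + m • T) :=
    ae_all_iff.2 fun m =>
      (measurePreserving_add_right volume (m • T)).quasiMeasurePreserving.ae h
  filter_upwards [htranslate] with x hx
  obtain ⟨m, hm, -⟩ := existsUnique_add_zsmul_mem_Ioc hT x 0
  rw [zero_add] at hm
  simpa only [hQ.zsmul m x] using hx m hm

lemma isInner_hardyFun (hp : ‖p‖ = 1) (hC : ∀ z, ‖hardyFun p z‖ ≤ 1) : IsInner (hardyFun p) := by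
  obtain ⟨g, hg⟩ := ((isHolo_hardyFun p).ae_exists_tendsto_radial hC).choice
  refine ⟨isHolo_hardyFun p, hC, ae_of_periodic (fun θ => ?_) Real.two_pi_pos ?_⟩
  · simp only [periodic_exp_ofReal_mul_I θ]
  · filter_upwards [ae_norm_radial_eq_one hp hC hg, ae_restrict_of_ae hg] with θ hθ1 hθ
    exact ⟨g θ, hθ1, hθ⟩

end BoundaryValues

lemma mem_innerMultiples_hardyFun_iff {p : HardySeq} {C : ℝ} (hC : ∀ z, ‖hardyFun p z‖ ≤ C)
    {a : HardySeq} : hardyFun a ∈ innerMultiples (hardyFun p) ↔ a ∈ Set.range (mulOp p hC) := by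
  constructor
  · rintro ⟨h, hh, hha⟩
    obtain ⟨b, rfl⟩ := exists_hardyFun_eq hh
    exact ⟨b, hardyFun_injective ((hardyFun_mulOp hC b).trans hha.symm)⟩
  · rintro ⟨b, rfl⟩
    exact ⟨hardyFun b, hardyFun_mem_hardySpace b, hardyFun_mulOp hC b⟩

lemma IsInner.exists_hardyFun_eq {I : Disc → ℂ} (hI : IsInner I) : ∃ p, hardyFun p = I :=
  DirichletDisc.exists_hardyFun_eq
    ⟨hI.holo, (hardyNormSq_le_of_norm_le hI.bound).trans_lt ENNReal.ofReal_lt_top⟩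

/-- The closure in the Hardy space, identified with the space of coefficient sequences, of the
functions of `M` that belong to the Hardy space. -/
noncomputable def hardyClosure (M : Submodule ℂ (Disc → ℂ)) : Submodule ℂ HardySeq :=
  (M.comap hardyFun).topologicalClosure

section hardyClosure

variable {μ : Measure Disc} {M : Submodule ℂ (Disc → ℂ)} {a p : HardySeq}

lemma isClosed_hardyClosure (M : Submodule ℂ (Disc → ℂ)) :
    IsClosed (hardyClosure M : Set HardySeq) :=
  Submodule.isClosed_topologicalClosure _

lemma mem_hardyClosure (ha : hardyFun a ∈ M) : a ∈ hardyClosure M :=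
  Submodule.le_topologicalClosure _ ha

lemma hardyClosure_subset {K : Set HardySeq} (hK : IsClosed K)
    (h : ∀ a, hardyFun a ∈ M → a ∈ K) : (hardyClosure M : Set HardySeq) ⊆ K :=
  closure_minimal h hK

lemma mem_hardyClosure_iff :
    a ∈ hardyClosure M ↔ ∃ A : ℕ → HardySeq, (∀ n, hardyFun (A n) ∈ M) ∧
      Tendsto A atTop (𝓝 a) :=
  mem_closure_iff_seq_limit

lemma IsInvariantSubspace.shift_mem_hardyClosure (hM : IsInvariantSubspace μ M)
    (ha : a ∈ hardyClosure M) : DirichletDisc.shift a ∈ hardyClosure M := by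
  refine hardyClosure_subset ((isClosed_hardyClosure M).preimage DirichletDisc.shift.continuous)
    (fun b hb => mem_hardyClosure ?_) ha
  rw [funext (hardyFun_shift b)]
  exact hM.shift _ hb

lemma IsInvariantSubspace.hardyClosure_ne_bot (hM : IsInvariantSubspace μ M) (hM0 : M ≠ ⊥) :
    hardyClosure M ≠ ⊥ := by
  refine fun h => hM0 ((Submodule.eq_bot_iff _).2 fun f hf => ?_)
  obtain ⟨a, rfl⟩ := exists_hardyFun_eq (hM.subset f hf).1
  have ha : a ∈ hardyClosure M := mem_hardyClosure hf
  rw [h, Submodule.mem_bot] at ha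
  rw [ha, map_zero]

theorem IsInvariantSubspace.exists_isInner_hardyClosure_eq (hM : IsInvariantSubspace μ M)
    (hM0 : M ≠ ⊥) : ∃ p, IsInner (hardyFun p) ∧
      ∃ hC : ∀ z, ‖hardyFun p z‖ ≤ 1, (hardyClosure M : Set HardySeq) = Set.range (mulOp p hC) := by
  obtain ⟨p, hp, hC, hrange⟩ := exists_eq_range_mulOp (fun _ ha => hM.shift_mem_hardyClosure ha)
    (isClosed_hardyClosure M) (hM.hardyClosure_ne_bot hM0)
  exact ⟨p, isInner_hardyFun hp hC, hC, hrange⟩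

lemma mem_range_mulOp_self {C : ℝ} (hC : ∀ z, ‖hardyFun p z‖ ≤ C) : p ∈ Set.range (mulOp p hC) :=
  ⟨_, by simpa using mulOp_single hC 0⟩

lemma mem_innerMultiples_of_mem_hardyClosure {J : Disc → ℂ} (hJ : IsInner J)
    (hJM : ∀ f ∈ M, f ∈ innerMultiples J) (ha : a ∈ hardyClosure M) :
    hardyFun a ∈ innerMultiples J := by
  obtain ⟨j, rfl⟩ := hJ.exists_hardyFun_eq
  rw [mem_innerMultiples_hardyFun_iff hJ.bound]
  exact hardyClosure_subset (isClosed_range_mulOp hJ.bound hJ.norm_eq_one)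
    (fun b hb => (mem_innerMultiples_hardyFun_iff hJ.bound).1 (hJM _ hb)) ha

lemma IsInvariantSubspace.isGreatestCommonInnerDivisor (hM : IsInvariantSubspace μ M)
    (hp : IsInner (hardyFun p)) {C : ℝ} {hC : ∀ z, ‖hardyFun p z‖ ≤ C}
    (h : (hardyClosure M : Set HardySeq) = Set.range (mulOp p hC)) :
    IsGreatestCommonInnerDivisor M (hardyFun p) where
  inner := hp
  dvd f hf := by
    obtain ⟨a, rfl⟩ := exists_hardyFun_eq (hM.subset f hf).1
    rw [mem_innerMultiples_hardyFun_iff hC, ← h]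
    exact mem_hardyClosure hf
  greatest J hJ hJM := by
    have hpM : p ∈ (hardyClosure M : Set HardySeq) := h ▸ mem_range_mulOp_self hC
    exact mem_innerMultiples_of_mem_hardyClosure hJ hJM hpM

theorem IsInvariantSubspace.exists_isGreatestCommonInnerDivisor (hM : IsInvariantSubspace μ M)
    (hM0 : M ≠ ⊥) : ∃ I, IsGreatestCommonInnerDivisor M I := by
  obtain ⟨p, hp, hC, hrange⟩ := hM.exists_isInner_hardyClosure_eq hM0
  exact ⟨hardyFun p, hM.isGreatestCommonInnerDivisor hp hrange⟩

lemma IsInvariantSubspace.mulOp_mem_hardyClosure (hM : IsInvariantSubspace μ M) {C : ℝ}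
    (hC : ∀ z, ‖hardyFun p z‖ ≤ C) (hp : p ∈ hardyClosure M) (a : HardySeq) :
    mulOp p hC a ∈ hardyClosure M :=
  mulOp_mem hC (isClosed_hardyClosure M)
    (shift_pow_mem (fun _ hb => hM.shift_mem_hardyClosure hb) hp) a

theorem IsInvariantSubspace.mem_hardyClosure_of_mem_innerMultiples (hM : IsInvariantSubspace μ M)
    (hM0 : M ≠ ⊥) {I : Disc → ℂ} (hI : IsGreatestCommonInnerDivisor M I)
    (ha : hardyFun a ∈ innerMultiples I) : a ∈ hardyClosure M := by
  obtain ⟨q, rfl⟩ := hI.inner.exists_hardyFun_eq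
  obtain ⟨p, hp, hC, hrange⟩ := hM.exists_isInner_hardyClosure_eq hM0
  have hpM := hM.isGreatestCommonInnerDivisor hp hrange
  have hq : q ∈ hardyClosure M := by
    rw [← SetLike.mem_coe, hrange, ← mem_innerMultiples_hardyFun_iff hC]
    exact hI.greatest _ hp hpM.dvd
  obtain ⟨b, rfl⟩ := (mem_innerMultiples_hardyFun_iff hI.inner.bound).1 ha
  exact hM.mulOp_mem_hardyClosure hI.inner.bound hq b

theorem IsInvariantSubspace.mem_of_mem_hardyClosure [IsFiniteMeasure μ]
    (hM : IsInvariantSubspace μ M) (ha : a ∈ hardyClosure M)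
    (haμ : hardyFun a ∈ dirichletSpace μ) : hardyFun a ∈ M := by
  obtain ⟨A, hA, hlim⟩ := mem_hardyClosure_iff.1 ha
  exact hM.mem_of_tendsto_hardySeq hA hlim haμ

end hardyClosure

end DirichletDisc

theorem mainTheorem10 (μ : MeasureTheory.Measure DirichletDisc.Disc)
    [MeasureTheory.IsFiniteMeasure μ]
    (M : Submodule ℂ (DirichletDisc.Disc → ℂ))
    (hM : DirichletDisc.IsInvariantSubspace μ M) (hM0 : M ≠ ⊥) :
    (∃ I : DirichletDisc.Disc → ℂ, DirichletDisc.IsGreatestCommonInnerDivisor M I) ∧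
    ∀ I : DirichletDisc.Disc → ℂ, DirichletDisc.IsGreatestCommonInnerDivisor M I →
      (M : Set (DirichletDisc.Disc → ℂ)) =
        DirichletDisc.innerMultiples I ∩ DirichletDisc.dirichletSpace μ := by
  refine ⟨hM.exists_isGreatestCommonInnerDivisor hM0, fun I hI => Set.Subset.antisymm
    (fun f hf => ⟨hI.dvd f hf, hM.subset f hf⟩) ?_⟩
  rintro f ⟨hfI, hfμ⟩
  obtain ⟨a, rfl⟩ := DirichletDisc.exists_hardyFun_eq hfμ.1
  have ha : a ∈ DirichletDisc.hardyClosure M :=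
    hM.mem_hardyClosure_of_mem_innerMultiples hM0 hI hfI
  exact hM.mem_of_mem_hardyClosure ha hfμ
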